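/- Let $\Omega=\mathbb T^2\times(-1,1)$ with $\mathbb T=\mathbb R/2\pi\mathbb Z$, let $\Gamma=\mathbb T^2\times\{\pm1\}$ with outward unit normal $\nu$, let $\tau$ range over the unit vectors of the $x$- and $y$-axis, let $\beta>0$ and $\mathbb D v=\tfrac12(\nabla v+\nabla^{\top}v)$. Consider the Navier–Stokes problem with zero force $$v_t-\Delta v+(v\cdot\nabla)v+\nabla q=0,\quad \nabla\cdot v=0\ \text{ in }\Omega,\qquad v\cdot\nu=0,\quad 2(\mathbb Dv\,\nu)\cdot\tau+\beta\,v\cdot\tau=0\ \text{ on }\Gamma,\qquad v(0)=v_0. \tag{NS}$$ Let $m,n\ge1$ and $p\ge0$ be integers, $\mu^2=m^2+n^2$, and let $\lambda=\lambda_{m,n,p}(\beta)$ be the number in $\big(\mu^2+\tfrac{\pi^2}{4}p^2,\ \mu^2+\tfrac{\pi^2}{4}(p+1)^2\big)$ with $$\cot\sqrt{\lambda-\mu^2}=\frac{\sqrt{\lambda-\mu^2}}{\beta}\ \ (p\text{ even}),\qquad \tan\sqrt{\lambda-\mu^2}=-\frac{\sqrt{\lambda-\mu^2}}{\beta}\ \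 (p\text{ odd}).$$ For $a,b,c,d\in\mathbb R$ put $$\mathcal P^u=a\cos(mx)\sin(ny)-b\sin(mx)\sin(ny)-c\sin(mx)\cos(ny)+d\cos(mx)\cos(ny),$$ $$\mathcal P^v=a\sin(mx)\cos(ny)+b\cos(mx)\cos(ny)-c\cos(mx)\sin(ny)-d\sin(mx)\sin(ny),$$ $$u_{m,n,p}(x,y,z)=\mathcal Z(z)\big(\mathcal P^u(x,y),\,-\tfrac mn\mathcal P^v(x,y),\,0\big),$$ where $\mathcal Z(z)=\cos(\sqrt{\lambda-\mu^2}\,z)$ if $p$ is even and $\mathcal Z(z)=\sin(\sqrt{\lambda-\mu^2}\,z)$ if $p$ is odd. Assume that $$a=-c,\ b=d\qquad\text{or}\qquad a=c,\ b=-d .$$ Let $\gamma\in\mathbb R$ and $v_0=\gamma\,u_{m,n,p}$. Then the solution of (NS) is global, unique, and given by $$v(t,x,y,z)=\gamma\,e^{-\lambda t}\,u_{m,n,p}(x,y,z),\qquad q=Q_0\in\mathbb R .$$ Precisely: (i) for every constant $Q_0$, $(v,Q_0)$ is a smooth classical solution of (NS) for all $t\ge0$; (ii) for every $T>0$, $v$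 is a Leray–Hopf weak solution of (NS) on $[0,T)$, with pressure $Q_0$; (iii) for every $T>0$, every Leray–Hopf weak solution of (NS) on $[0,T)$ with initial value $v_0$ equals $v$ a.e. in $(0,T)\times\Omega$, and every pressure associated with it (a locally integrable function for which the momentum equation holds in the sense of distributions) is, up to a null set, a function of $t$ only. Here $H$ is the space of $w\in L^2(\Omega)^3$ with $\nabla\cdot w=0$ in $\Omega$ and $w\cdot\nu=0$ on $\Gamma$, and $V=H\cap H^1(\Omega)^3$; the subscript $\tau$ on a field denotes its tangential component on $\Gamma$. A Leray–Hopf weak solution on $[0,T)$ is a field $w\in L^\infty(0,T;H)\cap L^2(0,T;V)$ such that $$\int_0^T(w,\varphi)\,\chi'\,dt+(v_0,\varphi)\chi(0)=\int_0^T\Big\{2(\mathbb Dw,\mathbb D\varphi)+\beta\int_\Gamma w_\tau\cdot\varphi_\tau+((w\cdot\nabla)w,\varphi)\Big\}\chi\,dt$$ for all $\varphi\in V$ and $\chi\in C_0^\infty[0,T)$, and for a.e. $t\in(0,T)$ $$\tfrac12\|w(t)\|_{L^2(\Omega)}^2+\int_0^t\Big(2\|\mathbb Dw\|_{L^2(\Omega)}^2+\beta\|w_\tau\|_{L^2(\Gamma)}^2\Big)ds\le\tfrac12\|v_0\|_{L^2(\Omega)}^2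 .$$ -/

import Mathlib

open MeasureTheory Set
open scoped ContDiff

noncomputable section

namespace ChannelNS

/-! ### Geometry

The domain is `Ω = 𝕋² × (-1,1)` with `𝕋 = ℝ/2πℤ`.  Functions on `Ω` are represented by functions on
`ℝ³` (only the values in the slab matter) that are `2π`-periodic in the first two coordinates, and
integrals over `Ω` are integrals over one period cell. -/

/-- Points of (and vectors in) `ℝ³`, with coordinates `x 0, x 1, x 2` for `x, y, z`. -/
abbrev Pt : Type := Fin 3 → ℝ

/-- The slab `ℝ² × (-1,1)`, the periodic unfolding of `Ω`. -/
def slab : Set Pt := {x | x 2 ∈ Ioo (-1 : ℝ) 1}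

/-- The planes `z = ± 1`, the periodic unfolding of the boundary `Γ`. -/
def wall : Set Pt := {x | x 2 = 1 ∨ x 2 = -1}

/-- One period cell of the slab. -/
def cell : Set Pt :=
  {x | x 0 ∈ Ico (0 : ℝ) (2 * Real.pi) ∧ x 1 ∈ Ico (0 : ℝ) (2 * Real.pi) ∧ x 2 ∈ Ioo (-1 : ℝ) 1}

/-- Lebesgue measure on `Ω`. -/
def vol : Measure Pt := (volume : Measure Pt).restrict cell

/-- Lebesgue measure on one period cell of `𝕋²`. -/
def vol2 : Measure (ℝ × ℝ) :=
  (volume : Measure (ℝ × ℝ)).restrict (Ico 0 (2 * Real.pi) ×ˢ Ico 0 (2 * Real.pi))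

/-- Surface measure on `Γ = 𝕋² × {1, -1}`. -/
def surf : Measure Pt :=
  vol2.map (fun y => (![y.1, y.2, 1] : Pt)) + vol2.map (fun y => (![y.1, y.2, -1] : Pt))

/-- The outward unit normal on `Γ`: it is `(0,0,1)` at `z = 1` and `(0,0,-1)` at `z = -1`. -/
def normal (x : Pt) : Pt := ![0, 0, x 2]

/-- `2π`-periodicity in the first two coordinates. -/
def PeriodicXY {α : Type} (f : Pt → α) : Prop :=
  ∀ x : Pt, f (x + Pi.single 0 (2 * Real.pi)) = f x ∧ f (x + Pi.single 1 (2 * Real.pi)) = f x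

/-- The measure `dt ⊗ dx` on `Q_T = (0,T) × Ω`. -/
def volQ (T : ℝ) : Measure (ℝ × Pt) := ((volume : Measure ℝ).restrict (Ioo 0 T)).prod vol

/-- The measure `dt ⊗ dS` on `(0,T) × Γ`. -/
def surfQ (T : ℝ) : Measure (ℝ × Pt) := ((volume : Measure ℝ).restrict (Ioo 0 T)).prod surf

/-! ### Differential operators and algebra -/

/-- The partial derivative `∂ᵢ f`. -/
def pd (i : Fin 3) (f : Pt → ℝ) (x : Pt) : ℝ := fderiv ℝ f x (Pi.single i 1)

/-- The Laplacian of a scalar function. -/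
def lap (f : Pt → ℝ) (x : Pt) : ℝ := ∑ j, pd j (pd j f) x

/-- The divergence of a vector field. -/
def dvg (u : Pt → Pt) (x : Pt) : ℝ := ∑ i, pd i (fun y => u y i) x

/-- The gradient matrix `(∇u)ᵢⱼ = ∂ⱼ uᵢ`. -/
def grad (u : Pt → Pt) (x : Pt) : Matrix (Fin 3) (Fin 3) ℝ :=
  Matrix.of fun i j => pd j (fun y => u y i) x

/-- The symmetric part `(A + Aᵀ)/2` of a matrix; `𝔻u = symm (∇u)`. -/
def symm (A : Matrix (Fin 3) (Fin 3) ℝ) : Matrix (Fin 3) (Fin 3) ℝ :=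
  (1 / 2 : ℝ) • (A + A.transpose)

/-- The scalar product `A : B` of matrices. -/
def frob (A B : Matrix (Fin 3) (Fin 3) ℝ) : ℝ := ∑ i, ∑ j, A i j * B i j

/-- The tangential component `a - (a·ν)ν` of a vector `a` at a point `x` of `Γ`. -/
def tang (x a : Pt) : Pt := a - (a ⬝ᵥ normal x) • normal x

/-! ### Classical solutions -/

/-- `(v,q)` is a global-in-time classical solution (smooth up to the boundary and to `t = 0`) of the
Navier–Stokes equations with zero force, unit viscosity, slip-with-friction conditions
`v·ν = 0`, `2(𝔻v ν)·τ + β v·τ = 0` on `Γ` (for `τ` the unit vectors of the first two axes) and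
initial value `v₀`. -/
structure IsClassicalSolution (β : ℝ) (v₀ : Pt → Pt) (v : ℝ → Pt → Pt) (q : ℝ → Pt → ℝ) :
    Prop where
  smooth_v : ContDiff ℝ ∞ (fun s : ℝ × Pt => v s.1 s.2)
  smooth_q : ContDiff ℝ ∞ (fun s : ℝ × Pt => q s.1 s.2)
  periodic_v : ∀ t, PeriodicXY (v t)
  periodic_q : ∀ t, PeriodicXY (q t)
  momentum : ∀ t, 0 < t → ∀ x ∈ slab, ∀ i,
    deriv (fun s => v s x i) t - lap (fun y => v t y i) x
      + ∑ j, v t x j * pd j (fun y => v t y i) x + pd i (q t) x = 0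
  incompressible : ∀ t, 0 < t → ∀ x ∈ slab, dvg (v t) x = 0
  impermeable : ∀ t, 0 < t → ∀ x ∈ wall, v t x ⬝ᵥ normal x = 0
  friction : ∀ t, 0 < t → ∀ x ∈ wall, ∀ τ : Pt, τ = Pi.single 0 1 ∨ τ = Pi.single 1 1 →
    2 * (((symm (grad (v t) x)).mulVec (normal x)) ⬝ᵥ τ) + β * (v t x ⬝ᵥ τ) = 0
  initial : ∀ x ∈ slab, v 0 x = v₀ x

/-! ### Function spaces -/

/-- `f ∈ H¹(Ω)` with weak gradient `g ∈ L²(Ω)` and trace `θ ∈ L²(Γ)`.  All three are pinned down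
(up to null sets) by Green's formula against functions `ψ` that are smooth up to the boundary:
the `ψ` with support away from `Γ` say that `g` is the weak gradient of `f`, the
other ones say that `θ` is its trace. -/
structure HasGradTrace (f : Pt → ℝ) (g : Pt → Pt) (θ : Pt → ℝ) : Prop where
  memLp : MemLp f 2 vol
  memLp_grad : ∀ j, MemLp (fun x => g x j) 2 vol
  memLp_trace : MemLp θ 2 surf
  green : ∀ ψ : Pt → ℝ, ContDiff ℝ ∞ ψ → PeriodicXY ψ → ∀ j,
    (∫ x, g x j * ψ x ∂vol) + (∫ x, f x * pd j ψ x ∂vol) = ∫ x, θ x * ψ x * normal x j ∂surf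

/-- `u ∈ H`: `u` is square integrable on `Ω`, with zero distributional divergence and zero normal
trace on `Γ`.  (The test functions need not vanish on `Γ`, which encodes `u·ν = 0`.) -/
structure InH (u : Pt → Pt) : Prop where
  periodic : PeriodicXY u
  memLp : ∀ i, MemLp (fun x => u x i) 2 vol
  solenoidal : ∀ ψ : Pt → ℝ, ContDiff ℝ ∞ ψ → PeriodicXY ψ → ∫ x, ∑ i, u x i * pd i ψ x ∂vol = 0

/-- `u ∈ V = H ∩ H¹(Ω)`, with weak gradient `Gᵢⱼ = ∂ⱼ uᵢ` and trace `θ` on `Γ`. -/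
structure InV (u : Pt → Pt) (G : Pt → Matrix (Fin 3) (Fin 3) ℝ) (θ : Pt → Pt) : Prop where
  inH : InH u
  grad_trace : ∀ i, HasGradTrace (fun x => u x i) (fun x => G x i) (fun x => θ x i)

/-- The scalar product of `L²(Ω)`. -/
def ip (u φ : Pt → Pt) : ℝ := ∫ x, u x ⬝ᵥ φ x ∂vol

/-- The bilinear form `2(𝔻u,𝔻φ) + β ∫_Γ u_τ·φ_τ`, in terms of gradients and traces. -/
def stokesForm (β : ℝ) (G : Pt → Matrix (Fin 3) (Fin 3) ℝ) (θ : Pt → Pt)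
    (Φ : Pt → Matrix (Fin 3) (Fin 3) ℝ) (η : Pt → Pt) : ℝ :=
  2 * (∫ x, frob (symm (G x)) (symm (Φ x)) ∂vol) + β * ∫ x, tang x (θ x) ⬝ᵥ tang x (η x) ∂surf

/-- The convective term `((u·∇)u, φ)`, where `G = ∇u`. -/
def convection (u : Pt → Pt) (G : Pt → Matrix (Fin 3) (Fin 3) ℝ) (φ : Pt → Pt) : ℝ :=
  ∫ x, (G x).mulVec (u x) ⬝ᵥ φ x ∂vol

/-! ### Weak solutions -/

/-- `w` (with weak spatial gradient `G` and trace `θ` on `Γ`) is a Leray–Hopf weak solution on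
`[0,T)` with initial value `v₀`: it lies in `L^∞(0,T;H) ∩ L²(0,T;V)`, satisfies the weak
formulation against all `φ ∈ V` and all `χ ∈ C₀^∞[0,T)`, and satisfies the energy inequality. -/
structure IsLerayHopf (β : ℝ) (v₀ : Pt → Pt) (T : ℝ) (w : ℝ → Pt → Pt)
    (G : ℝ → Pt → Matrix (Fin 3) (Fin 3) ℝ) (θ : ℝ → Pt → Pt) : Prop where
  memLp : ∀ i, MemLp (fun s : ℝ × Pt => w s.1 s.2 i) 2 (volQ T)
  memLp_grad : ∀ i j, MemLp (fun s : ℝ × Pt => G s.1 s.2 i j) 2 (volQ T)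
  memLp_trace : ∀ i, MemLp (fun s : ℝ × Pt => θ s.1 s.2 i) 2 (surfQ T)
  inV : ∀ᵐ t ∂((volume : Measure ℝ).restrict (Ioo 0 T)), InV (w t) (G t) (θ t)
  bounded : ∃ C : ℝ, ∀ᵐ t ∂((volume : Measure ℝ).restrict (Ioo 0 T)), ip (w t) (w t) ≤ C
  weak : ∀ (φ : Pt → Pt) (Φ : Pt → Matrix (Fin 3) (Fin 3) ℝ) (η : Pt → Pt), InV φ Φ η →
    ∀ χ : ℝ → ℝ, ContDiff ℝ ∞ χ → HasCompactSupport χ → tsupport χ ⊆ Iio T →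
      (∫ t in Ioo 0 T, ip (w t) φ * deriv χ t) + ip v₀ φ * χ 0
        = ∫ t in Ioo 0 T, (stokesForm β (G t) (θ t) Φ η + convection (w t) (G t) φ) * χ t
  energy : ∀ᵐ t ∂((volume : Measure ℝ).restrict (Ioo 0 T)),
    1 / 2 * ip (w t) (w t) + ∫ s in Ioo 0 t, stokesForm β (G s) (θ s) (G s) (θ s)
      ≤ 1 / 2 * ip v₀ v₀

/-- `q` is a pressure for `w` (with `G = ∇w`) on `Q_T`: `q` is locally integrable in `Q_T` and
`w_t - Δw + (w·∇)w + ∇q = 0` in the sense of distributions on `Q_T`.  The test fields `Φ` are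
smooth, periodic, and vanish near `t = 0`, near `t = T` and near `Γ`; they need not be
divergence free. -/
structure IsPressure (T : ℝ) (w : ℝ → Pt → Pt) (G : ℝ → Pt → Matrix (Fin 3) (Fin 3) ℝ)
    (q : ℝ → Pt → ℝ) : Prop where
  periodic : ∀ t, PeriodicXY (q t)
  integrable : ∀ δ : ℝ, 0 < δ → IntegrableOn (fun s : ℝ × Pt => q s.1 s.2)
    {s | s.1 ∈ Ioo δ (T - δ) ∧ |s.2 2| < 1 - δ} (volQ T)
  momentum : ∀ Φ : ℝ → Pt → Pt, ContDiff ℝ ∞ (fun s : ℝ × Pt => Φ s.1 s.2) →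
    (∀ t, PeriodicXY (Φ t)) →
    (∃ δ : ℝ, 0 < δ ∧ ∀ t x, t ≤ δ ∨ T - δ ≤ t ∨ 1 - δ ≤ |x 2| → Φ t x = 0) →
    ∫ s, ((∑ i, w s.1 s.2 i *
          (-(deriv (fun r => Φ r s.2 i) s.1) - lap (fun y => Φ s.1 y i) s.2))
        + (G s.1 s.2).mulVec (w s.1 s.2) ⬝ᵥ Φ s.1 s.2
        - q s.1 s.2 * dvg (Φ s.1) s.2) ∂(volQ T) = 0

/-! ### The constant-pressure eigenfunctions of the Stokes operator -/

/-- `lam` is the eigenvalue `λ_{m,n,p}(β)`: the solution in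
`(μ² + π²p²/4, μ² + π²(p+1)²/4)`, `μ² = m² + n²`, of the transcendental equation which
the friction condition imposes on `cos(√(λ-μ²) z)` (`p` even) or `sin(√(λ-μ²) z)` (`p` odd). -/
def IsEigenvalue (β : ℝ) (m n p : ℕ) (lam : ℝ) : Prop :=
  lam ∈ Ioo ((m : ℝ) ^ 2 + (n : ℝ) ^ 2 + Real.pi ^ 2 / 4 * (p : ℝ) ^ 2)
      ((m : ℝ) ^ 2 + (n : ℝ) ^ 2 + Real.pi ^ 2 / 4 * ((p : ℝ) + 1) ^ 2) ∧
  (Even p → Real.cot (√(lam - ((m : ℝ) ^ 2 + (n : ℝ) ^ 2)))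
    = √(lam - ((m : ℝ) ^ 2 + (n : ℝ) ^ 2)) / β) ∧
  (Odd p → Real.tan (√(lam - ((m : ℝ) ^ 2 + (n : ℝ) ^ 2)))
    = -(√(lam - ((m : ℝ) ^ 2 + (n : ℝ) ^ 2)) / β))

/-- The function `𝒫ᵘ_{m,n}` with coefficients `a, b, c, d`. -/
def Pu (m n : ℕ) (a b c d x y : ℝ) : ℝ :=
  a * Real.cos (m * x) * Real.sin (n * y) - b * Real.sin (m * x) * Real.sin (n * y)
    - c * Real.sin (m * x) * Real.cos (n * y) + d * Real.cos (m * x) * Real.cos (n * y)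

/-- The function `𝒫ᵛ_{m,n}` with coefficients `a, b, c, d`. -/
def Pv (m n : ℕ) (a b c d x y : ℝ) : ℝ :=
  a * Real.sin (m * x) * Real.cos (n * y) + b * Real.cos (m * x) * Real.cos (n * y)
    - c * Real.cos (m * x) * Real.sin (n * y) - d * Real.sin (m * x) * Real.sin (n * y)

/-- The vertical profile `𝒵_{m,n,p}`. -/
def Zfun (m n p : ℕ) (lam z : ℝ) : ℝ :=
  if Even p then Real.cos (√(lam - ((m : ℝ) ^ 2 + (n : ℝ) ^ 2)) * z)
  else Real.sin (√(lam - ((m : ℝ) ^ 2 + (n : ℝ) ^ 2)) * z)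

/-- The eigenfunction `u_{m,n,p} = 𝒵(z) (𝒫ᵘ(x,y), -(m/n) 𝒫ᵛ(x,y), 0)`. -/
def eigenfun (m n p : ℕ) (lam a b c d : ℝ) (x : Pt) : Pt :=
  Zfun m n p lam (x 2) •
    ![Pu m n a b c d (x 0) (x 1), -((m : ℝ) / (n : ℝ)) * Pv m n a b c d (x 0) (x 1), 0]

end ChannelNS

end

/-! Under either relation between the coefficients the addition formulas collapse the two horizontal
polynomials to plus or minus one function of a single phase, mx + ny or ny - mx. The eigenfunction
becomes a shear field F e: the vector e is constant and horizontal, and F is constant along e. Hence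
div(F e) = ∂ₑF = 0 and (F e · ∇)(F e) = F (∂ₑF) e = 0, so the nonlinearity disappears. Moreover ΔF =
-λF, and the transcendental equation for λ is the friction condition for the vertical profile. Thus
F e with amplitude γ exp(-λt) solves the full system with constant pressure.
`exists_shearMode_eq_eigenfun` performs this reduction; everything else is proved for an abstract
`ShearMode`.

The weak eigenvalue equation `ShearMode.stokesForm_eq` turns the weak formulation and the energy
balance of the explicit flow v into scalar identities.

Uniqueness of the velocity is a weak-strong argument. For a weak solution w put z = w - v. The
energy inequality for w, the energy equality for v and the evolution of (w, v), obtained by testing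
with v, bound ½‖z(t)‖² by the time integral of ((w·∇)w, v) minus the Stokes form of z. The crucial
point is `ShearMode.convection_le`. Writing ∇z = 2𝔻z - (∇z)ᵀ, the convective term becomes ∫ 2𝔻z : (v
⊗ z) plus terms of zero integral, the delicate one being ∫ F z · ∂ₑz, handled by
`integral_shear_eq_zero`. Young's inequality bounds the rest by 2‖𝔻z‖² + ½ sup|v|² ‖z‖²; the
dissipation absorbs the first summand exactly and Grönwall's inequality finishes. Neither a Korn nor
a Sobolev inequality is needed, nor density of smooth fields in V.

For the pressure, equality of the velocities forces equality of the weak gradients, so the momentum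
equation says that the distributional spatial gradient of q is zero. Mollifications of q are then
constant along segments at fixed time (`exists_ae_eq_of_gradient_eq_zero`). -/

/-! ### Calculus and measures on the periodic slab, up to the divergence theorem. -/

noncomputable section
namespace ChannelNS

/-! ### Partial derivatives -/

lemma contDiff_pd {f : Pt → ℝ} (hf : ContDiff ℝ ∞ f) (i : Fin 3) : ContDiff ℝ ∞ (pd i f) :=
  (hf.fderiv_right (by simp)).clm_apply contDiff_const

lemma PeriodicXY.pd {f : Pt → ℝ} (hf : PeriodicXY f) (i : Fin 3) : PeriodicXY (pd i f) := by
  have key : ∀ a : Pt, (∀ x, f (x + a) = f x) →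
      ∀ x, ChannelNS.pd i f (x + a) = ChannelNS.pd i f x := by
    intro a ha x
    have h := fderiv_comp_add_right (𝕜 := ℝ) (f := f) (x := x) a
    have h2 : (fun y => f (y + a)) = f := funext ha
    rw [h2] at h
    simp only [ChannelNS.pd, h]
  exact fun x => ⟨key _ (fun x => (hf x).1) x, key _ (fun x => (hf x).2) x⟩

lemma pd_mul {f g : Pt → ℝ} (hf : Differentiable ℝ f) (hg : Differentiable ℝ g) (i : Fin 3)
    (x : Pt) : pd i (fun y => f y * g y) x = pd i f x * g x + f x * pd i g x := by
  simp only [pd]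
  rw [fderiv_fun_mul (hf x) (hg x)]
  simp; ring

lemma pd_add {f g : Pt → ℝ} (hf : Differentiable ℝ f) (hg : Differentiable ℝ g) (i : Fin 3)
    (x : Pt) : pd i (fun y => f y + g y) x = pd i f x + pd i g x := by
  simp only [pd]
  rw [fderiv_fun_add (hf x) (hg x)]
  simp

lemma pd_const (c : ℝ) (i : Fin 3) (x : Pt) : pd i (fun _ => c) x = 0 := by
  simp [pd]

lemma pd_mul_const {f : Pt → ℝ} (hf : Differentiable ℝ f) (c : ℝ) (i : Fin 3) (x : Pt) :
    pd i (fun y => f y * c) x = pd i f x * c := by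
  simp only [pd]
  rw [fderiv_mul_const (hf x)]
  simp; ring

lemma pd_const_mul {f : Pt → ℝ} (hf : Differentiable ℝ f) (c : ℝ) (i : Fin 3) (x : Pt) :
    pd i (fun y => c * f y) x = c * pd i f x := by
  simp only [mul_comm c]; exact pd_mul_const hf c i x

lemma pd_comm {f : Pt → ℝ} (hf : ContDiff ℝ ∞ f) (i j : Fin 3) (x : Pt) :
    pd i (pd j f) x = pd j (pd i f) x := by
  have hs : IsSymmSndFDerivAt ℝ f x :=
    hf.contDiffAt.isSymmSndFDerivAt (by
      rw [minSmoothness_of_isRCLikeNormedField]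
      exact WithTop.coe_le_coe.2 (le_top : (2 : ℕ∞) ≤ ⊤))
  have hd : DifferentiableAt ℝ (fderiv ℝ f) x :=
    ((hf.fderiv_right (m := ∞) (by simp)).differentiable (by simp)) x
  have key : ∀ i j : Fin 3, pd i (pd j f) x
      = fderiv ℝ (fderiv ℝ f) x (Pi.single i 1) (Pi.single j 1) := by
    intro i j
    change fderiv ℝ (fun y => fderiv ℝ f y (Pi.single j 1)) x (Pi.single i 1) = _
    rw [fderiv_clm_apply hd (by fun_prop)]
    simp
  rw [key, key, hs.eq]

lemma fderiv_eq_sum_pd (f : Pt → ℝ) (x a : Pt) : fderiv ℝ f x a = ∑ j, a j * pd j f x := by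
  conv_lhs => rw [pi_eq_sum_univ' a]
  rw [map_sum]
  refine Finset.sum_congr rfl fun j _ => ?_
  rw [map_smul, smul_eq_mul, pd]

/-! ### Periodic functions -/

lemma PeriodicXY.mul {f g : Pt → ℝ} (hf : PeriodicXY f) (hg : PeriodicXY g) :
    PeriodicXY (fun x => f x * g x) := fun x => by
  simp only [(hf x).1, (hf x).2, (hg x).1, (hg x).2, and_self]

lemma PeriodicXY.add {f g : Pt → ℝ} (hf : PeriodicXY f) (hg : PeriodicXY g) :
    PeriodicXY (fun x => f x + g x) := fun x => by
  simp only [(hf x).1, (hf x).2, (hg x).1, (hg x).2, and_self]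

lemma PeriodicXY.comp {α α' : Type} {f : Pt → α} (hf : PeriodicXY f) (k : α → α') :
    PeriodicXY (fun x => k (f x)) := fun x => by
  simp only [(hf x).1, (hf x).2, and_self]

lemma periodicXY_const {α : Type} (c : α) : PeriodicXY (fun _ => c) := fun _ => ⟨rfl, rfl⟩

/-! ### The measures on `Ω` and `Γ` -/

/-- The factors of the period cell. -/
def side : Fin 3 → Set ℝ := ![Ico 0 (2 * Real.pi), Ico 0 (2 * Real.pi), Ioo (-1) 1]

lemma cell_eq_pi : cell = univ.pi side := by
  ext x
  simp [cell, side, Set.mem_pi, Fin.forall_fin_succ]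

lemma vol_eq_pi : vol = Measure.pi (fun i => (volume : Measure ℝ).restrict (side i)) := by
  rw [vol, cell_eq_pi, volume_pi, Measure.restrict_pi_pi]

/-- The closed period cell. -/
def box : Set Pt := Icc ![0, 0, -1] ![2 * Real.pi, 2 * Real.pi, 1]

lemma measurableSet_cell : MeasurableSet cell := by
  rw [cell_eq_pi]
  refine MeasurableSet.univ_pi fun i => ?_
  fin_cases i
  exacts [measurableSet_Ico, measurableSet_Ico, measurableSet_Ioo]

lemma cell_subset_box : cell ⊆ box := by
  rintro x ⟨h0, h1, h2⟩
  simp only [box, mem_Icc, Pi.le_def, Fin.forall_fin_succ]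
  simp [h0.1, h0.2.le, h1.1, h1.2.le, h2.1.le, h2.2.le]

lemma box_eq_pi : box = univ.pi (fun i => Icc ((![0, 0, -1] : Pt) i)
    ((![2 * Real.pi, 2 * Real.pi, 1] : Pt) i)) := (pi_univ_Icc _ _).symm

/-- The faces are null sets. The closed box is compact, which bounds continuous functions, and it is
the domain on which the divergence theorem is stated. -/
lemma vol_eq_box : vol = (volume : Measure Pt).restrict box := by
  rw [vol, box_eq_pi, cell_eq_pi, volume_pi, Measure.restrict_pi_pi, Measure.restrict_pi_pi]
  congr 1
  funext i
  fin_cases i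
  · exact Measure.restrict_congr_set Ico_ae_eq_Icc
  · exact Measure.restrict_congr_set Ico_ae_eq_Icc
  · exact Measure.restrict_congr_set Ioo_ae_eq_Icc

lemma isCompact_box : IsCompact box := isCompact_Icc

instance : IsFiniteMeasure vol := by
  rw [vol_eq_box]
  exact ⟨by rw [Measure.restrict_apply_univ]; exact isCompact_box.measure_lt_top⟩

instance : IsFiniteMeasure vol2 := by
  refine ⟨?_⟩
  rw [vol2, Measure.restrict_apply_univ]
  exact lt_of_le_of_lt (measure_mono (prod_mono Ico_subset_Icc_self Ico_subset_Icc_self))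
    (isCompact_Icc.prod isCompact_Icc).measure_lt_top

instance : IsFiniteMeasure surf := by unfold surf; infer_instance

lemma measurable_plane (c : ℝ) : Measurable (fun y : ℝ × ℝ => (![y.1, y.2, c] : Pt)) := by
  refine measurable_pi_lambda _ fun i => ?_
  fin_cases i
  exacts [measurable_fst, measurable_snd, measurable_const]

lemma ae_vol_mem_cell : ∀ᵐ x ∂vol, x ∈ cell := ae_restrict_mem measurableSet_cell

lemma ae_vol2_mem : ∀ᵐ y ∂vol2, y ∈ Ico 0 (2 * Real.pi) ×ˢ Ico 0 (2 * Real.pi) :=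
  ae_restrict_mem (measurableSet_Ico.prod measurableSet_Ico)

lemma measurableSet_wall : MeasurableSet (wall ∩ box) := by
  refine MeasurableSet.inter ?_ measurableSet_Icc
  exact ((measurableSet_singleton (1 : ℝ)).preimage (measurable_pi_apply 2)).union
    ((measurableSet_singleton (-1 : ℝ)).preimage (measurable_pi_apply 2))

lemma ae_surf_mem : ∀ᵐ x ∂surf, x ∈ wall ∩ box := by
  rw [surf, ae_add_measure_iff]
  have h : ∀ c : ℝ, c = 1 ∨ c = -1 →
      ∀ᵐ x ∂(vol2.map (fun y => (![y.1, y.2, c] : Pt))), x ∈ wall ∩ box := by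
    intro c hc
    refine (ae_map_iff (measurable_plane c).aemeasurable measurableSet_wall).2 ?_
    filter_upwards [ae_vol2_mem] with y hy
    refine ⟨by simpa [wall] using hc, ?_⟩
    simp only [mem_prod, mem_Ico] at hy
    simp only [box, mem_Icc, Pi.le_def, Fin.forall_fin_succ]
    rcases hc with rfl | rfl <;> simp [hy.1.1, hy.1.2.le, hy.2.1, hy.2.2.le]
  exact ⟨h 1 (Or.inl rfl), h (-1) (Or.inr rfl)⟩

lemma exists_bound_on_box {f : Pt → ℝ} (hf : Continuous f) : ∃ C, ∀ x ∈ box, |f x| ≤ C :=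
  isCompact_box.exists_bound_of_continuousOn hf.continuousOn

lemma memLp_vol_of_continuous {f : Pt → ℝ} (hf : Continuous f) (p : ENNReal) : MemLp f p vol := by
  obtain ⟨C, hC⟩ := exists_bound_on_box hf
  refine MemLp.of_bound hf.aestronglyMeasurable C ?_
  filter_upwards [ae_vol_mem_cell] with x hx using hC x (cell_subset_box hx)

lemma memLp_surf_of_continuous {f : Pt → ℝ} (hf : Continuous f) (p : ENNReal) :
    MemLp f p surf := by
  obtain ⟨C, hC⟩ := exists_bound_on_box hf
  refine MemLp.of_bound hf.aestronglyMeasurable C ?_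
  filter_upwards [ae_surf_mem] with x hx using hC x hx.2

lemma integrable_vol_of_continuous {f : Pt → ℝ} (hf : Continuous f) : Integrable f vol :=
  memLp_one_iff_integrable.1 (memLp_vol_of_continuous hf 1)

lemma integrable_surf_of_continuous {f : Pt → ℝ} (hf : Continuous f) : Integrable f surf :=
  memLp_one_iff_integrable.1 (memLp_surf_of_continuous hf 1)

lemma integral_surf {f : Pt → ℝ} (hf : Continuous f) :
    ∫ x, f x ∂surf = ∫ y, f ![y.1, y.2, 1] ∂vol2 + ∫ y, f ![y.1, y.2, -1] ∂vol2 := by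
  have hi : Integrable f surf := integrable_surf_of_continuous hf
  rw [surf] at hi ⊢
  rw [integral_add_measure (hi.mono_measure (Measure.le_add_right le_rfl))
    (hi.mono_measure (Measure.le_add_left le_rfl)),
    integral_map (measurable_plane 1).aemeasurable hf.aestronglyMeasurable,
    integral_map (measurable_plane (-1)).aemeasurable hf.aestronglyMeasurable]

/-- The right-hand side is the form in which the divergence theorem delivers integrals over faces.
-/
lemma integral_vol2 (f : ℝ × ℝ → ℝ) :
    ∫ y, f y ∂vol2 = ∫ x in Icc (![0, 0] : Fin 2 → ℝ) ![2 * Real.pi, 2 * Real.pi], f (x 0, x 1) := by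
  have h := volume_preserving_finTwoArrow ℝ
  have e : vol2 = (volume : Measure (ℝ × ℝ)).restrict
      (Icc 0 (2 * Real.pi) ×ˢ Icc 0 (2 * Real.pi)) := by
    rw [vol2, Measure.volume_eq_prod, ← Measure.prod_restrict, ← Measure.prod_restrict,
      Measure.restrict_congr_set (Ico_ae_eq_Icc (a := (0 : ℝ)) (b := 2 * Real.pi))]
  rw [e, ← h.setIntegral_preimage_emb (MeasurableEquiv.measurableEmbedding _)]
  congr 2
  ext x
  simp [Pi.le_def, Fin.forall_fin_two]

/-- The divergence theorem on `Ω` for one partial derivative of a smooth function. -/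
lemma integral_pd {f : Pt → ℝ} (hf : ContDiff ℝ ∞ f) (hp : PeriodicXY f) (j : Fin 3) :
    ∫ x, pd j f x ∂vol = ∫ x, f x * normal x j ∂surf := by
  have hpi := Real.pi_pos
  have hle : (![0, 0, -1] : Pt) ≤ ![2 * Real.pi, 2 * Real.pi, 1] := by
    simp only [Pi.le_def, Fin.forall_fin_succ]
    simp [hpi.le]
  -- The vector field has `f` in slot `j` and zero elsewhere, so its divergence is ∂ⱼf and only the
  -- two faces orthogonal to direction `j` carry flux.
  have hdiv := integral_divergence_of_hasFDerivAt_off_countable' (n := 2) _ _ hle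
    (fun i => if i = j then f else 0) (fun i x => if i = j then fderiv ℝ f x else 0) ∅
    countable_empty
    (fun i => by
      split_ifs
      · exact hf.continuous.continuousOn
      · exact continuousOn_const)
    (fun x _ i => by
      split_ifs
      · exact (hf.differentiable (by simp) x).hasFDerivAt
      · exact hasFDerivAt_const (0 : ℝ) x)
    (by
      have : (fun x => ∑ i, (if i = j then fderiv ℝ f x else 0) (Pi.single i 1)) = pd j f := by
        ext x
        rw [Finset.sum_eq_single j]
        · simp [pd]
        · intro b _ hb; simp [hb]
        · simp
      rw [this]
      exact (contDiff_pd hf j).continuous.continuousOn.integrableOn_compact isCompact_Icc)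
  have hL : (fun x => ∑ i, (if i = j then fderiv ℝ f x else 0) (Pi.single i 1)) = pd j f := by
    ext x
    rw [Finset.sum_eq_single j]
    · simp [pd]
    · intro b _ hb; simp [hb]
    · simp
  rw [vol_eq_box, box, ← hL, hdiv, Finset.sum_eq_single j (by intro b _ hb; simp [hb]) (by simp)]
  have hc : Continuous fun x => f x * normal x j := by
    refine hf.continuous.mul ?_
    unfold normal
    fin_cases j
    exacts [continuous_const, continuous_const, continuous_apply 2]
  rw [integral_surf hc, integral_vol2, integral_vol2]
  simp only [if_true]
  fin_cases j
  -- Horizontal directions: opposite faces carry the same values by periodicity and cancel, in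
  -- agreement with `normal x j = 0`.
  · have e : ∀ (c : ℝ) (x : Fin 2 → ℝ), (0 : Fin 3).insertNth c x = (![c, x 0, x 1] : Pt) := by
      intro c x
      ext k
      fin_cases k <;> rfl
    have : ∀ x : Fin 2 → ℝ, f ![2 * Real.pi, x 0, x 1] = f ![0, x 0, x 1] := by
      intro x
      rw [← (hp ![0, x 0, x 1]).1]
      congr 1
      ext k
      fin_cases k <;> simp
    have h2 : (![2 * Real.pi, 2 * Real.pi, 1] : Pt) 0 = 2 * Real.pi := rfl
    have h3 : (![0, 0, -1] : Pt) 0 = 0 := rfl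
    simp only [normal, Fin.zero_eta, e, h2, h3, this]
    simp
  · have e : ∀ (c : ℝ) (x : Fin 2 → ℝ), (1 : Fin 3).insertNth c x = (![x 0, c, x 1] : Pt) := by
      intro c x
      ext k
      fin_cases k <;> rfl
    have : ∀ x : Fin 2 → ℝ, f ![x 0, 2 * Real.pi, x 1] = f ![x 0, 0, x 1] := by
      intro x
      rw [← (hp ![x 0, 0, x 1]).2]
      congr 1
      ext k
      fin_cases k <;> simp
    have h2 : (![2 * Real.pi, 2 * Real.pi, 1] : Pt) 1 = 2 * Real.pi := rfl
    have h3 : (![0, 0, -1] : Pt) 1 = 0 := rfl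
    simp only [normal, Fin.mk_one, e, h2, h3, this]
    simp
  -- Vertical direction: the two faces make up Γ, and the sign of each flux is the third component
  -- of the normal.
  · have e : ∀ (c : ℝ) (x : Fin 2 → ℝ), (2 : Fin 3).insertNth c x = (![x 0, x 1, c] : Pt) := by
      intro c x
      ext k
      fin_cases k <;> rfl
    have d0 : (![0, 0, -1] : Pt) ∘ (2 : Fin 3).succAbove = ![0, 0] := by
      ext k; fin_cases k <;> rfl
    have d1 : (![2 * Real.pi, 2 * Real.pi, 1] : Pt) ∘ (2 : Fin 3).succAbove
        = ![2 * Real.pi, 2 * Real.pi] := by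
      ext k; fin_cases k <;> rfl
    have h2 : (![2 * Real.pi, 2 * Real.pi, 1] : Pt) 2 = 1 := rfl
    have h3 : (![0, 0, -1] : Pt) 2 = -1 := rfl
    simp only [normal, Fin.reduceFinMk, e, d0, d1, h2, h3]
    simp [integral_neg, sub_eq_add_neg]

end ChannelNS
end

/-! ### Horizontal translations, periodization, and the fundamental lemma on Ω. -/

noncomputable section
namespace ChannelNS

/-! ### Translations along the walls -/

lemma two_pi_pos : (0 : ℝ) < 2 * Real.pi := by positivity

/-- The point of `[0,2π) × [0,2π) × ℝ` equivalent to `x`. -/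
def wrap (x : Pt) : Pt := ![toIcoMod two_pi_pos 0 (x 0), toIcoMod two_pi_pos 0 (x 1), x 2]

lemma PeriodicXY.apply_wrap {α : Type} {f : Pt → α} (hf : PeriodicXY f) (x : Pt) :
    f (wrap x) = f x := by
  have h0 : Function.Periodic f (Pi.single 0 (2 * Real.pi)) := fun y => (hf y).1
  have h1 : Function.Periodic f (Pi.single 1 (2 * Real.pi)) := fun y => (hf y).2
  have e : wrap x = x - toIcoDiv two_pi_pos 0 (x 0) • Pi.single 0 (2 * Real.pi)
      - toIcoDiv two_pi_pos 0 (x 1) • Pi.single 1 (2 * Real.pi) := by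
    ext k
    fin_cases k <;> simp [wrap]
  rw [e, h1.sub_zsmul_eq, h0.sub_zsmul_eq]

lemma PeriodicXY.comp_add {α : Type} {f : Pt → α} (hf : PeriodicXY f) (a : Pt) :
    PeriodicXY (fun x => f (x + a)) := fun x => by
  constructor
  · simpa only [add_right_comm] using (hf (x + a)).1
  · simpa only [add_right_comm] using (hf (x + a)).2

lemma PeriodicXY.exists_bound {f : Pt → ℝ} (hp : PeriodicXY f) (hf : Continuous f) :
    ∃ C, 0 ≤ C ∧ ∀ x : Pt, x 2 ∈ Icc (-1 : ℝ) 1 → |f x| ≤ C := by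
  obtain ⟨C, hC⟩ := exists_bound_on_box hf
  refine ⟨max C 0, le_max_right _ _, fun x hx => ?_⟩
  rw [← hp.apply_wrap]
  refine (hC _ ?_).trans (le_max_left _ _)
  have h0 := toIcoMod_mem_Ico two_pi_pos 0 (x 0)
  have h1 := toIcoMod_mem_Ico two_pi_pos 0 (x 1)
  rw [zero_add] at h0 h1
  simp only [box, mem_Icc, Pi.le_def, Fin.forall_fin_succ, wrap]
  simp [h0.1, h0.2.le, h1.1, h1.2.le, hx.1, hx.2]

/-- The map factors through the circle: project to `AddCircle L`, rotate, take the representative in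
[0, L). Each of the three steps preserves measure. -/
lemma measurePreserving_toIcoMod_add {L : ℝ} (hL : 0 < L) (h : ℝ) :
    MeasurePreserving (fun x => toIcoMod hL 0 (x + h)) (volume.restrict (Ico 0 L))
      (volume.restrict (Ico 0 L)) := by
  have : Fact (0 < L) := ⟨hL⟩
  have hmk : MeasurePreserving (fun x : ℝ => (x : AddCircle L)) (volume.restrict (Ico 0 L))
      volume := by
    have := AddCircle.measurePreserving_mk L 0
    rwa [zero_add, Measure.restrict_congr_set (Ioc_ae_eq_Icc (μ := volume) (a := 0) (b := L)),
      ← Measure.restrict_congr_set (Ico_ae_eq_Icc (μ := volume) (a := 0) (b := L))] at this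
  set s : AddCircle L → ℝ := fun y => (AddCircle.measurableEquivIco L 0 y : ℝ) with hs
  have hs_meas : Measurable s :=
    measurable_subtype_coe.comp (AddCircle.measurableEquivIco L 0).measurable
  have hs_mk : ∀ x : ℝ, s (x : AddCircle L) = toIcoMod hL 0 x := fun x => rfl
  have hs_mp : MeasurePreserving s volume (volume.restrict (Ico 0 L)) := by
    refine ⟨hs_meas, ?_⟩
    rw [← hmk.map_eq, Measure.map_map hs_meas hmk.measurable]
    have : (s ∘ fun x : ℝ => (x : AddCircle L)) =ᵐ[volume.restrict (Ico 0 L)] id := by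
      filter_upwards [ae_restrict_mem measurableSet_Ico] with x hx
      simp only [Function.comp, hs_mk, id]
      exact (toIcoMod_eq_self hL).2 (by simpa using hx)
    rw [Measure.map_congr this, Measure.map_id]
  have hadd : MeasurePreserving (fun y : AddCircle L => y + (h : AddCircle L)) volume volume :=
    measurePreserving_add_right volume _
  exact hs_mp.comp (hadd.comp hmk)

/-- Coordinatewise this is a shift modulo 2π in two factors and the identity in the third. Periodic
functions do not see the wrapping, so their integrals and L² norms over Ω are invariant under
horizontal translation. -/
lemma measurePreserving_wrap_add {a : Pt} (ha : a 2 = 0) :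
    MeasurePreserving (fun x => wrap (x + a)) vol vol := by
  have h := measurePreserving_pi
    (fun i => (volume : Measure ℝ).restrict (side i))
    (fun i => (volume : Measure ℝ).restrict (side i))
    (f := fun i t => if i = 2 then t else toIcoMod two_pi_pos 0 (t + a i)) (by
      intro i
      fin_cases i
      · exact measurePreserving_toIcoMod_add two_pi_pos (a 0)
      · exact measurePreserving_toIcoMod_add two_pi_pos (a 1)
      · exact MeasurePreserving.id _)
  rw [← vol_eq_pi] at h
  convert h using 1
  ext x i
  fin_cases i <;> simp [wrap, ha]

lemma PeriodicXY.integral_add {f : Pt → ℝ} (hp : PeriodicXY f)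
    (hf : AEStronglyMeasurable f vol) {a : Pt} (ha : a 2 = 0) :
    ∫ x, f (x + a) ∂vol = ∫ x, f x ∂vol := by
  have h := measurePreserving_wrap_add ha
  conv_rhs => rw [← h.map_eq]
  rw [integral_map h.measurable.aemeasurable (by rwa [h.map_eq])]
  simp only [hp.apply_wrap]

lemma PeriodicXY.memLp_add {f : Pt → ℝ} (hp : PeriodicXY f) (hf : MemLp f 2 vol) {a : Pt}
    (ha : a 2 = 0) : MemLp (fun x => f (x + a)) 2 vol := by
  have h := hf.comp_measurePreserving (measurePreserving_wrap_add ha)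
  simpa only [Function.comp_def, hp.apply_wrap] using h

lemma PeriodicXY.eLpNorm_add {f : Pt → ℝ} (hp : PeriodicXY f) (hf : MemLp f 2 vol) {a : Pt}
    (ha : a 2 = 0) : eLpNorm (fun x => f (x + a)) 2 vol = eLpNorm f 2 vol := by
  have h := eLpNorm_comp_measurePreserving hf.1 (measurePreserving_wrap_add ha) (p := 2)
  simpa only [Function.comp_def, hp.apply_wrap] using h

/-! ### Periodization of compactly supported functions -/

section Periodize

variable {E : Type*} [NormedAddCommGroup E] [NormedSpace ℝ E]

/-- The function which agrees with `ψ` on `{0 ≤ ℓ < L}` and is periodic with period `a`, where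
`ℓ a = L`. -/
def periodize (ℓ : E →L[ℝ] ℝ) (L : ℝ) (a : E) (ψ : E → ℝ) (x : E) : ℝ := ψ (x - ⌊ℓ x / L⌋ • a)

/-- The floor jumps only where ℓ is a multiple of L. Near those hyperplanes the periodization
vanishes, because the support of ψ keeps the distance δ from ℓ = 0 and from ℓ = L. -/
lemma contDiff_periodize {ℓ : E →L[ℝ] ℝ} {L : ℝ} (hL : 0 < L) {a : E} (ha : ℓ a = L) {ψ : E → ℝ}
    (hψ : ContDiff ℝ ∞ ψ) {δ : ℝ} (hδ : 0 < δ) (hs : ∀ x, ψ x ≠ 0 → δ ≤ ℓ x ∧ ℓ x ≤ L - δ) :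
    ContDiff ℝ ∞ (periodize ℓ L a ψ) := by
  rw [contDiff_iff_contDiffAt]
  intro x
  have hfl : ∀ y, (⌊ℓ y / L⌋ : ℝ) * L ≤ ℓ y ∧ ℓ y < (⌊ℓ y / L⌋ : ℝ) * L + L := by
    intro y
    have h1 := Int.floor_le (ℓ y / L)
    have h2 := Int.lt_floor_add_one (ℓ y / L)
    rw [le_div_iff₀ hL] at h1
    rw [div_lt_iff₀ hL] at h2
    exact ⟨h1, by linarith⟩
  set k := ⌊ℓ x / L⌋ with hk
  -- Strictly inside a strip the floor is locally constant and the periodization is a single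
  -- translate of ψ. On the edge of a strip it is locally zero.
  rcases (hfl x).1.lt_or_eq with h | h
  · have hev : periodize ℓ L a ψ =ᶠ[nhds x] fun y => ψ (y - k • a) := by
      have h1 : ∀ᶠ y in nhds x, (k : ℝ) * L < ℓ y := ℓ.continuous.continuousAt.eventually_const_lt h
      have h2 : ∀ᶠ y in nhds x, ℓ y < (k : ℝ) * L + L :=
        ℓ.continuous.continuousAt.eventually_lt_const (hfl x).2
      filter_upwards [h1, h2] with y hy1 hy2
      have : ⌊ℓ y / L⌋ = k := by
        rw [Int.floor_eq_iff, le_div_iff₀ hL, div_lt_iff₀ hL]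
        exact ⟨hy1.le, by linarith⟩
      simp only [periodize, this]
    refine ContDiffAt.congr_of_eventuallyEq ?_ hev
    exact (hψ.comp (contDiff_id.sub contDiff_const)).contDiffAt
  · have hev : periodize ℓ L a ψ =ᶠ[nhds x] fun _ => 0 := by
      have h1 : ∀ᶠ y in nhds x, (k : ℝ) * L - δ < ℓ y :=
        ℓ.continuous.continuousAt.eventually_const_lt (by rw [h]; linarith)
      have h2 : ∀ᶠ y in nhds x, ℓ y < (k : ℝ) * L + δ :=
        ℓ.continuous.continuousAt.eventually_lt_const (by rw [h]; linarith)
      filter_upwards [h1, h2] with y hy1 hy2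
      by_contra hne
      obtain ⟨h3, h4⟩ := hs _ hne
      rw [map_sub, map_zsmul, ha, zsmul_eq_mul] at h3 h4
      set j := ⌊ℓ y / L⌋ with hj
      -- A nonzero value close to the hyperplane ℓ = kL would produce integers with j < k < j + 1.
      have h5 : (j : ℝ) * L < k * L := by linarith
      have h6 : (k : ℝ) * L < (j + 1) * L := by linarith
      have h7 := lt_of_mul_lt_mul_right h5 hL.le
      have h8 := lt_of_mul_lt_mul_right h6 hL.le
      norm_cast at h7 h8
      omega
    exact contDiffAt_const.congr_of_eventuallyEq hev

/-- Each period lies in the kernel of the other functional, so the two periodizations do not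
interfere. The space is general in order to serve both functions on space and functions on
space-time; the last clause carries over support properties in the remaining variables. -/
lemma exists_periodization {ℓ₀ ℓ₁ : E →L[ℝ] ℝ} {L : ℝ} (hL : 0 < L) {a₀ a₁ : E} (h₀₀ : ℓ₀ a₀ = L)
    (h₁₁ : ℓ₁ a₁ = L) (h₁₀ : ℓ₁ a₀ = 0) (h₀₁ : ℓ₀ a₁ = 0) {ψ : E → ℝ}
    (hψ : ContDiff ℝ ∞ ψ) {δ : ℝ} (hδ : 0 < δ)
    (hs : ∀ x, ψ x ≠ 0 → (δ ≤ ℓ₀ x ∧ ℓ₀ x ≤ L - δ) ∧ (δ ≤ ℓ₁ x ∧ ℓ₁ x ≤ L - δ)) :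
    ∃ Ψ : E → ℝ, ContDiff ℝ ∞ Ψ ∧ (∀ x, Ψ (x + a₀) = Ψ x ∧ Ψ (x + a₁) = Ψ x) ∧
      (∀ x, ℓ₀ x ∈ Ico 0 L → ℓ₁ x ∈ Ico 0 L → Ψ x = ψ x) ∧
      ∀ x, ∃ j k : ℤ, Ψ x = ψ (x - j • a₀ - k • a₁) := by
  have hper : ∀ (ℓ : E →L[ℝ] ℝ) (a : E) (φ : E → ℝ) (x : E), ℓ a = L →
      periodize ℓ L a φ (x + a) = periodize ℓ L a φ x := by
    intro ℓ a φ x ha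
    have : ⌊ℓ (x + a) / L⌋ = ⌊ℓ x / L⌋ + 1 := by
      rw [map_add, ha, add_div, div_self hL.ne', Int.floor_add_one]
    simp only [periodize, this, add_smul, one_smul]
    congr 1
    abel
  have hfl : ∀ t ∈ Ico 0 L, ⌊t / L⌋ = 0 := by
    intro t ht
    rw [Int.floor_eq_iff, le_div_iff₀ hL, div_lt_iff₀ hL]
    simpa using ht
  refine ⟨periodize ℓ₁ L a₁ (periodize ℓ₀ L a₀ ψ), ?_, fun x => ⟨?_, hper _ _ _ _ h₁₁⟩, ?_, ?_⟩
  · refine contDiff_periodize hL h₁₁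
      (contDiff_periodize hL h₀₀ hψ hδ fun x hx => (hs x hx).1) hδ fun x hx => ?_
    have := (hs _ hx).2
    rwa [map_sub, map_zsmul, h₁₀, smul_zero, sub_zero] at this
  · rw [periodize, map_add, h₁₀, add_zero, add_sub_right_comm, hper _ _ _ _ h₀₀]
    rfl
  · intro x hx0 hx1
    simp [periodize, hfl _ hx0, hfl _ hx1]
  · intro x
    refine ⟨⌊ℓ₀ x / L⌋, ⌊ℓ₁ x / L⌋, ?_⟩
    simp only [periodize, map_sub, map_zsmul, h₀₁, smul_zero, sub_zero]
    congr 1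
    abel

end Periodize

/-! ### Test functions on the period cell -/

/-- The open period cell. -/
def openCell : Set Pt :=
  {x | x 0 ∈ Ioo (0 : ℝ) (2 * Real.pi) ∧ x 1 ∈ Ioo (0 : ℝ) (2 * Real.pi) ∧ x 2 ∈ Ioo (-1 : ℝ) 1}

lemma openCell_subset_cell : openCell ⊆ cell := fun _ hx =>
  ⟨Ioo_subset_Ico_self hx.1, Ioo_subset_Ico_self hx.2.1, hx.2.2⟩

lemma isOpen_openCell : IsOpen openCell := by
  refine (isOpen_Ioo.preimage (continuous_apply 0)).inter
    ((isOpen_Ioo.preimage (continuous_apply 1)).inter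
      (isOpen_Ioo.preimage (continuous_apply (2 : Fin 3))))

/-- On an open set the fundamental lemma with compactly supported test functions is available. -/
lemma vol_eq_openCell : vol = (volume : Measure Pt).restrict openCell := by
  have e : openCell = univ.pi
      (![Ioo 0 (2 * Real.pi), Ioo 0 (2 * Real.pi), Ioo (-1) 1] : Fin 3 → Set ℝ) := by
    ext x
    simp [openCell, Set.mem_pi, Fin.forall_fin_succ]
  rw [vol, e, cell_eq_pi, volume_pi, Measure.restrict_pi_pi, Measure.restrict_pi_pi]
  congr 1
  funext i
  fin_cases i
  · exact Measure.restrict_congr_set (Ioo_ae_eq_Ico).symm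
  · exact Measure.restrict_congr_set (Ioo_ae_eq_Ico).symm
  · rfl

/-- The distance-like function which is positive exactly on the open period cell. -/
def cellGap (x : Pt) : ℝ :=
  min (min (min (x 0) (2 * Real.pi - x 0)) (min (x 1) (2 * Real.pi - x 1))) (1 - |x 2|)

lemma continuous_cellGap : Continuous cellGap := by
  unfold cellGap; fun_prop

lemma cellGap_pos {x : Pt} (hx : x ∈ openCell) : 0 < cellGap x := by
  obtain ⟨⟨h1, h2⟩, ⟨h3, h4⟩, h5, h6⟩ := hx
  simp only [cellGap, lt_min_iff, sub_pos, abs_lt]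
  exact ⟨⟨⟨h1, h2⟩, h3, h4⟩, h5, h6⟩

lemma le_cellGap_iff {δ : ℝ} {x : Pt} : δ ≤ cellGap x ↔
    ((δ ≤ x 0 ∧ x 0 ≤ 2 * Real.pi - δ) ∧ (δ ≤ x 1 ∧ x 1 ≤ 2 * Real.pi - δ)) ∧ |x 2| ≤ 1 - δ := by
  simp only [cellGap, le_min_iff]
  constructor
  · rintro ⟨⟨⟨h1, h2⟩, h3, h4⟩, h5⟩
    exact ⟨⟨⟨h1, by linarith⟩, h3, by linarith⟩, by linarith⟩
  · rintro ⟨⟨⟨h1, h2⟩, h3, h4⟩, h5⟩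
    exact ⟨⟨⟨h1, by linarith⟩, h3, by linarith⟩, by linarith⟩

/-- The fundamental lemma of the calculus of variations on `Ω`. -/
lemma ae_eq_zero_of_forall_test {p : Pt → ℝ} (hp : Integrable p vol)
    (h : ∀ ψ : Pt → ℝ, ContDiff ℝ ∞ ψ → PeriodicXY ψ →
      (∃ δ > 0, ∀ x : Pt, 1 - δ ≤ |x 2| → ψ x = 0) → ∫ x, ψ x * p x ∂vol = 0) :
    ∀ᵐ x ∂vol, p x = 0 := by
  have hp' := hp
  rw [vol_eq_openCell] at hp' ⊢
  rw [ae_restrict_iff' isOpen_openCell.measurableSet]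
  refine isOpen_openCell.ae_eq_zero_of_integral_contDiff_smul_eq_zero
    (IntegrableOn.locallyIntegrableOn hp') fun ψ hψ hc hsupp => ?_
  -- Compactness gives the support a uniform margin δ. Horizontally it makes the periodization
  -- smooth; vertically it makes it vanish near the walls.
  obtain ⟨δ, hδ, hδK⟩ := hc.isCompact.exists_forall_le' continuous_cellGap.continuousOn (a := 0)
    fun x hx => cellGap_pos (hsupp hx)
  have hne : ∀ x, ψ x ≠ 0 → δ ≤ cellGap x := fun x hx => hδK x (subset_tsupport _ hx)
  obtain ⟨Ψ, hΨ, hper, heq, hval⟩ := exists_periodization (ℓ₀ := ContinuousLinearMap.proj (R := ℝ)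
    (φ := fun _ : Fin 3 => ℝ) 0) (ℓ₁ := ContinuousLinearMap.proj (R := ℝ)
    (φ := fun _ : Fin 3 => ℝ) 1) (L := 2 * Real.pi) two_pi_pos
    (a₀ := Pi.single 0 (2 * Real.pi)) (a₁ := Pi.single 1 (2 * Real.pi)) (by simp) (by simp)
    (by simp) (by simp) hψ hδ (fun x hx => (le_cellGap_iff.1 (hne x hx)).1)
  have h1 := h Ψ hΨ hper ⟨δ / 2, half_pos hδ, fun x hx => by
    obtain ⟨j, k, hjk⟩ := hval x
    by_contra hx0
    rw [hjk] at hx0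
    have := (le_cellGap_iff.1 (hne _ hx0)).2
    simp at this
    linarith⟩
  rw [← h1, vol, ← setIntegral_eq_integral_of_forall_compl_eq_zero (s := cell)]
  · refine setIntegral_congr_fun measurableSet_cell fun x hx => ?_
    simp only [smul_eq_mul]
    rw [heq x hx.1 hx.2.1]
  · intro x hx
    have : ψ x = 0 := by
      by_contra h0
      exact hx (openCell_subset_cell (hsupp (subset_tsupport _ h0)))
    simp [this]

end ChannelNS
end

/-! ### L² estimates on Ω and the vanishing of the shear transport integral. -/

noncomputable section
namespace ChannelNS

/-! ### The `L²` norm on `Ω` -/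

/-- The `L²(Ω)` norm of a scalar function. -/
def l2 (f : Pt → ℝ) : ℝ := (eLpNorm f 2 vol).toReal

lemma l2_nonneg (f : Pt → ℝ) : 0 ≤ l2 f := ENNReal.toReal_nonneg

lemma abs_integral_mul_le {f g : Pt → ℝ} (hf : MemLp f 2 vol) (hg : MemLp g 2 vol) :
    |∫ x, f x * g x ∂vol| ≤ l2 f * l2 g := by
  have h := abs_real_inner_le_norm (hf.toLp f) (hg.toLp g)
  rw [L2.inner_def, Lp.norm_toLp, Lp.norm_toLp] at h
  refine le_trans (le_of_eq ?_) h
  congr 1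
  refine integral_congr_ae ?_
  filter_upwards [hf.coeFn_toLp, hg.coeFn_toLp] with x h1 h2
  rw [h1, h2]
  simp [mul_comm]

lemma l2_sub_le {f g k : Pt → ℝ} (hf : MemLp f 2 vol) (hg : MemLp g 2 vol) (hk : MemLp k 2 vol) :
    l2 (f - g) ≤ l2 (k - f) + l2 (k - g) := by
  have h : f - g = (k - g) - (k - f) := by ext x; simp
  have h2 := eLpNorm_sub_le (hk.sub hg).1 (hk.sub hf).1 (p := 2) (by norm_num)
  rw [← h] at h2
  have h3 := ENNReal.toReal_mono
    (ENNReal.add_ne_top.2 ⟨(hk.sub hg).eLpNorm_ne_top, (hk.sub hf).eLpNorm_ne_top⟩) h2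
  rw [ENNReal.toReal_add (hk.sub hg).eLpNorm_ne_top (hk.sub hf).eLpNorm_ne_top] at h3
  unfold l2
  linarith

lemma integrable_mul_vol {f g : Pt → ℝ} (hf : MemLp f 2 vol) (hg : MemLp g 2 vol) :
    Integrable (fun x => f x * g x) vol := hf.integrable_mul hg

/-- Smooth periodic functions are dense in `L²(Ω)`. -/
lemma exists_smooth_l2_sub_le {p : Pt → ℝ} (hp : MemLp p 2 vol) {ε : ℝ} (hε : 0 < ε) :
    ∃ ψ : Pt → ℝ, ContDiff ℝ ∞ ψ ∧ PeriodicXY ψ ∧ l2 (p - ψ) ≤ ε := by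
  -- Density is proved by duality: an L² function orthogonal to all smooth periodic functions is
  -- zero by `ae_eq_zero_of_forall_test`.
  let M : Submodule ℝ (Lp ℝ 2 vol) :=
    { carrier := {q | ∃ ψ : Pt → ℝ, ContDiff ℝ ∞ ψ ∧ PeriodicXY ψ ∧ q =ᵐ[vol] ψ}
      add_mem' := by
        rintro q r ⟨ψ, h1, h2, h3⟩ ⟨φ, h4, h5, h6⟩
        exact ⟨_, h1.add h4, h2.add h5, (Lp.coeFn_add q r).trans (h3.add h6)⟩
      zero_mem' := ⟨0, contDiff_const, periodicXY_const 0, Lp.coeFn_zero _ _ _⟩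
      smul_mem' := by
        rintro c q ⟨ψ, h1, h2, h3⟩
        refine ⟨fun x => c * ψ x, contDiff_const.mul h1, (periodicXY_const c).mul h2, ?_⟩
        filter_upwards [Lp.coeFn_smul c q, h3] with x h4 h5
        rw [h4, Pi.smul_apply, h5, smul_eq_mul] }
  have hM : Mᗮ = ⊥ := by
    rw [Submodule.eq_bot_iff]
    intro q hq
    have hq2 : MemLp q 2 vol := Lp.memLp q
    have h0 : ∀ᵐ x ∂vol, q x = 0 := by
      refine ae_eq_zero_of_forall_test (hq2.integrable (by norm_num)) fun ψ hψ hper _ => ?_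
      have hψ2 := memLp_vol_of_continuous hψ.continuous 2
      have h := (Submodule.mem_orthogonal M q).1 hq (hψ2.toLp ψ) ⟨ψ, hψ, hper, hψ2.coeFn_toLp⟩
      rw [L2.inner_def] at h
      rw [← h]
      refine integral_congr_ae ?_
      filter_upwards [hψ2.coeFn_toLp] with x hx
      rw [hx]
      simp [mul_comm]
    exact (Lp.eq_zero_iff_ae_eq_zero).2 h0
  rw [← Submodule.topologicalClosure_eq_top_iff] at hM
  have hmem : hp.toLp p ∈ closure (M : Set (Lp ℝ 2 vol)) := by
    rw [← Submodule.topologicalClosure_coe, hM]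
    trivial
  obtain ⟨q, ⟨ψ, hψ, hper, hq⟩, hdist⟩ := Metric.mem_closure_iff.1 hmem ε hε
  refine ⟨ψ, hψ, hper, ?_⟩
  rw [dist_eq_norm, Lp.norm_def] at hdist
  refine le_trans (le_of_eq ?_) hdist.le
  unfold l2
  congr 1
  refine eLpNorm_congr_ae ?_
  filter_upwards [Lp.coeFn_sub (hp.toLp p) q, hp.coeFn_toLp, hq] with x h1 h2 h3
  rw [h1, Pi.sub_apply, Pi.sub_apply, h2, h3]

/-! ### Skew-symmetry of a shear transport term -/

section Shear

variable {e : Pt} {f g : Pt → ℝ}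

/-- The derivative in the shift falls on the smooth factor and is then moved to `f` by the weak
derivative. -/
lemma hasDerivAt_integral_translate (he : e 2 = 0) (hf : MemLp f 2 vol)
    (hweak : ∀ ψ : Pt → ℝ, ContDiff ℝ ∞ ψ → PeriodicXY ψ →
      ∫ x, f x * fderiv ℝ ψ x e ∂vol = -∫ x, g x * ψ x ∂vol)
    {ψ : Pt → ℝ} (hψ : ContDiff ℝ ∞ ψ) (hper : PeriodicXY ψ) (h : ℝ) :
    HasDerivAt (fun s : ℝ => ∫ x, f x * ψ (x + s • e) ∂vol)
      (-∫ x, g x * ψ (x + h • e) ∂vol) h := by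
  have hsm : ContDiff ℝ ∞ fun x : Pt => ψ (x + h • e) := hψ.comp (contDiff_id.add contDiff_const)
  rw [← hweak _ hsm (hper.comp_add _)]
  have hD : Continuous fun x => fderiv ℝ ψ x e :=
    ((hψ.fderiv_right (m := ∞) (by simp)).clm_apply contDiff_const).continuous
  have hDper : PeriodicXY fun x => fderiv ℝ ψ x e := by
    have : (fun x => fderiv ℝ ψ x e) = fun x => ∑ j, e j * pd j ψ x :=
      funext fun x => fderiv_eq_sum_pd ψ x e
    rw [this]
    intro x
    simp only [(hper.pd _ x).1, (hper.pd _ x).2, and_self]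
  obtain ⟨C, hC0, hC⟩ := hDper.exists_bound hD
  have hf1 : Integrable f vol := hf.integrable (by norm_num)
  have hmeas : ∀ s : ℝ, Continuous fun x : Pt => ψ (x + s • e) := fun s =>
    hψ.continuous.comp (continuous_id.add continuous_const)
  refine (hasDerivAt_integral_of_dominated_loc_of_deriv_le (F := fun s x => f x * ψ (x + s • e))
    (F' := fun s x => f x * fderiv ℝ ψ (x + s • e) e) (bound := fun x => ‖f x‖ * C)
    (s := univ) Filter.univ_mem ?_ ?_ ?_ ?_ ?_ ?_).2.congr_deriv ?_
  · exact Filter.Eventually.of_forall fun s => hf.1.mul (hmeas s).aestronglyMeasurable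
  · exact integrable_mul_vol hf (memLp_vol_of_continuous (hmeas h) 2)
  · exact hf.1.mul (hD.comp (continuous_id.add continuous_const)).aestronglyMeasurable
  · filter_upwards [ae_vol_mem_cell] with x hx s _
    rw [norm_mul]
    refine mul_le_mul_of_nonneg_left (hC _ ?_) (norm_nonneg _)
    simpa [he] using Ioo_subset_Icc_self hx.2.2
  · exact hf1.norm.mul_const C
  · refine Filter.Eventually.of_forall fun x s _ => ?_
    have h1 : HasDerivAt (fun s : ℝ => x + s • e) e s := by
      simpa using ((hasDerivAt_id s).smul_const e).const_add x
    exact (((hψ.differentiable (by simp) (x + s • e)).hasFDerivAt).comp_hasDerivAt s h1).const_mul _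
  · refine integral_congr_ae (Filter.Eventually.of_forall fun x => ?_)
    dsimp only
    rw [fderiv_comp_add_right]

lemma memLp_translate {ψ : Pt → ℝ} (hψ : Continuous ψ) (a : Pt) :
    MemLp (fun x => ψ (x + a)) 2 vol :=
  memLp_vol_of_continuous (hψ.comp (continuous_id.add continuous_const)) 2

/-- Translations preserve the L² norm, so the derivative in the shift is uniformly bounded, and the
mean value inequality on an interval of length 2|h| applies. Only the L² norm of ψ enters, which
makes the bound usable along L² approximations. -/
lemma abs_integral_translate_sub_le (he : e 2 = 0) (hf : MemLp f 2 vol) (hg : MemLp g 2 vol)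
    (hweak : ∀ ψ : Pt → ℝ, ContDiff ℝ ∞ ψ → PeriodicXY ψ →
      ∫ x, f x * fderiv ℝ ψ x e ∂vol = -∫ x, g x * ψ x ∂vol)
    {ψ : Pt → ℝ} (hψ : ContDiff ℝ ∞ ψ) (hper : PeriodicXY ψ) (h : ℝ) :
    |∫ x, f x * ψ (x + h • e) ∂vol - ∫ x, f x * ψ (x + (-h) • e) ∂vol|
      ≤ l2 g * l2 ψ * (2 * |h|) := by
  have hb : ∀ s : ℝ, ‖-∫ x, g x * ψ (x + s • e) ∂vol‖ ≤ l2 g * l2 ψ := by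
    intro s
    rw [norm_neg]
    have h1 := abs_integral_mul_le hg (memLp_translate hψ.continuous (s • e))
    rwa [l2, l2, hper.eLpNorm_add (memLp_vol_of_continuous hψ.continuous 2) (by simp [he])] at h1
  have := Convex.norm_image_sub_le_of_norm_hasDerivWithin_le (s := univ)
    (f := fun s : ℝ => ∫ x, f x * ψ (x + s • e) ∂vol) (x := -h) (y := h)
    (fun s _ => (hasDerivAt_integral_translate he hf hweak hψ hper s).hasDerivWithinAt)
    (fun s _ => hb s) convex_univ (mem_univ _) (mem_univ _)
  refine this.trans (le_of_eq ?_)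
  rw [sub_neg_eq_add, ← two_mul, norm_mul, Real.norm_eq_abs, Real.norm_eq_abs,
    abs_of_pos (two_pos : (0 : ℝ) < 2)]

/-- If `f` has the weak derivative `g` in the horizontal direction `e` and `V` does not depend on
the coordinate along `e`, then `∫ V f g = 0`. -/
lemma integral_shear_eq_zero {V : Pt → ℝ} (he : e 2 = 0) (hV : Continuous V) (hVper : PeriodicXY V)
    (hVe : ∀ x (s : ℝ), V (x + s • e) = V x)
    (hf : MemLp f 2 vol) (hfper : PeriodicXY f) (hg : MemLp g 2 vol)
    (hweak : ∀ ψ : Pt → ℝ, ContDiff ℝ ∞ ψ → PeriodicXY ψ →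
      ∫ x, f x * fderiv ℝ ψ x e ∂vol = -∫ x, g x * ψ x ∂vol) :
    ∫ x, V x * (f x * g x) ∂vol = 0 := by
  set p : Pt → ℝ := fun x => V x * f x with hp
  have hpper : PeriodicXY p := hVper.mul hfper
  have hp2 : MemLp p 2 vol := by
    obtain ⟨C, _, hC⟩ := hVper.exists_bound hV
    refine MemLp.of_le_mul (c := C) hf (hV.aestronglyMeasurable.mul hf.1) ?_
    filter_upwards [ae_vol_mem_cell] with x hx
    rw [norm_mul]
    exact mul_le_mul_of_nonneg_right (hC x (Ioo_subset_Icc_self hx.2.2)) (norm_nonneg _)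
  have hes : ∀ s : ℝ, (s • e) 2 = 0 := fun s => by simp [he]
  -- Translating by s e turns f(x) V(x) f(x - s e) into f(x + s e) V(x) f(x), because V is constant
  -- along `e`.
  have hsymm : ∀ s : ℝ, ∫ x, f x * p (x + (-s) • e) ∂vol = ∫ x, f x * p (x + s • e) ∂vol := by
    intro s
    have hmeas : AEStronglyMeasurable (fun x => f x * p (x + (-s) • e)) vol :=
      hf.1.mul (hpper.memLp_add hp2 (hes _)).1
    have h1 := (hfper.mul (hpper.comp_add ((-s) • e))).integral_add hmeas (hes s)
    rw [← h1]
    refine integral_congr_ae (Filter.Eventually.of_forall fun x => ?_)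
    simp only [hp, hVe, neg_smul, add_neg_cancel_right]
    ring
  have hcs : ∀ (q : Pt → ℝ), MemLp q 2 vol → PeriodicXY q → ∀ s : ℝ,
      |∫ x, f x * q (x + s • e) ∂vol| ≤ l2 f * l2 q := by
    intro q hq hqper s
    have h1 := abs_integral_mul_le hf (hqper.memLp_add hq (hes s))
    rwa [l2, l2, hqper.eLpNorm_add hq (hes s)] at h1
  have hcont : ∀ {ψ : Pt → ℝ}, ContDiff ℝ ∞ ψ → MemLp ψ 2 vol := fun hψ =>
    memLp_vol_of_continuous hψ.continuous 2
  have hsub : ∀ {q r : Pt → ℝ}, MemLp q 2 vol → PeriodicXY q → MemLp r 2 vol → PeriodicXY r →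
      ∀ s : ℝ, ∫ x, f x * (q - r) (x + s • e) ∂vol
        = ∫ x, f x * q (x + s • e) ∂vol - ∫ x, f x * r (x + s • e) ∂vol := by
    intro q r hq hqp hr hrp s
    rw [← integral_sub (integrable_mul_vol hf (hqp.memLp_add hq (hes s)))
      (integrable_mul_vol hf (hrp.memLp_add hr (hes s)))]
    simp only [Pi.sub_apply, mul_sub]
  have hpersub : ∀ {q r : Pt → ℝ}, PeriodicXY q → PeriodicXY r → PeriodicXY (q - r) := by
    intro q r hq hr x
    simp only [Pi.sub_apply, (hq x).1, (hq x).2, (hr x).1, (hr x).2, and_self]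
  have hkey : ∀ ε : ℝ, 0 < ε → ∀ ψ : Pt → ℝ, ContDiff ℝ ∞ ψ → PeriodicXY ψ → l2 (p - ψ) ≤ ε →
      |∫ x, g x * ψ x ∂vol| ≤ l2 g * ε := by
    intro ε hε ψ hψ hper hle
    -- The odd part of the correlation with `p` is zero, so only ψ - p matters, whose norm is at
    -- most ε. The Lipschitz estimate requires a smooth function, so `p` is replaced by a second
    -- approximant φ at distance δ, and δ tends to zero with h fixed.
    have hlip : ∀ h : ℝ, |∫ x, f x * ψ (x + h • e) ∂vol - ∫ x, f x * ψ (x + (-h) • e) ∂vol|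
        ≤ 2 * (l2 g * ε) * |h| := by
      intro h
      refine le_of_forall_pos_le_add fun η hη => ?_
      -- The replacement costs at most 2δ(‖g‖|h| + ‖f‖); the summand 1 keeps the denominator
      -- positive.
      set δ : ℝ := η / (2 * (l2 g * |h|) + 2 * l2 f + 1) with hδ
      have hden : 0 < 2 * (l2 g * |h|) + 2 * l2 f + 1 := by
        have := mul_nonneg (l2_nonneg g) (abs_nonneg h)
        have := l2_nonneg f
        linarith
      have hδpos : 0 < δ := div_pos hη hden
      obtain ⟨φ, hφ, hφper, hφle⟩ := exists_smooth_l2_sub_le hp2 hδpos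
      have h1 := abs_integral_translate_sub_le he hf hg hweak (hψ.sub hφ) (hpersub hper hφper) h
      have h2 : l2 (ψ - φ) ≤ ε + δ := (l2_sub_le (hcont hψ) (hcont hφ) hp2).trans
        (add_le_add hle hφle)
      have h1' : |∫ x, f x * (ψ - φ) (x + h • e) ∂vol
          - ∫ x, f x * (ψ - φ) (x + (-h) • e) ∂vol| ≤ l2 g * (ε + δ) * (2 * |h|) :=
        h1.trans (mul_le_mul_of_nonneg_right (mul_le_mul_of_nonneg_left h2 (l2_nonneg g))
          (by positivity))
      rw [hsub (hcont hψ) hper (hcont hφ) hφper, hsub (hcont hψ) hper (hcont hφ) hφper] at h1'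
      have h3 := hcs _ (hp2.sub (hcont hφ)) (hpersub hpper hφper) h
      have h4 := hcs _ (hp2.sub (hcont hφ)) (hpersub hpper hφper) (-h)
      rw [hsub hp2 hpper (hcont hφ) hφper] at h3 h4
      rw [hsymm] at h4
      have h5 : l2 f * l2 (p - φ) ≤ l2 f * δ := mul_le_mul_of_nonneg_left hφle (l2_nonneg f)
      have h6 : δ * (2 * (l2 g * |h|) + 2 * l2 f + 1) = η := div_mul_cancel₀ _ hden.ne'
      rw [abs_le] at h1' h3 h4 ⊢
      constructor <;> nlinarith
    have hd1 := hasDerivAt_integral_translate he hf hweak hψ hper 0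
    have hd2 : HasDerivAt (fun s : ℝ => ∫ x, f x * ψ (x + (-s) • e) ∂vol)
        (-(-∫ x, g x * ψ (x + (0 : ℝ) • e) ∂vol)) 0 := by
      have := hasDerivAt_integral_translate he hf hweak hψ hper (-0)
      simpa [Function.comp_def] using this.scomp (0 : ℝ) (hasDerivAt_neg (0 : ℝ))
    -- The odd part has derivative -2∫ g ψ at zero, and the Lipschitz constant 2‖g‖ε bounds its
    -- modulus.
    have hd := hd1.sub hd2
    have hC0 : 0 ≤ 2 * (l2 g * ε) := by
      have := mul_nonneg (l2_nonneg g) hε.le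
      linarith
    have hfin := hd.le_of_lip' hC0 (Filter.Eventually.of_forall fun s => by
      have := hlip s
      simpa using this)
    simp only [zero_smul, add_zero, Real.norm_eq_abs] at hfin
    rw [neg_neg, show ∀ t : ℝ, -t - t = -(2 * t) by intro t; ring, abs_neg, abs_mul, abs_two]
      at hfin
    linarith
  have hzero : ∫ x, g x * p x ∂vol = 0 := by
    rw [← abs_eq_zero]
    refine le_antisymm (le_of_forall_pos_le_add fun η hη => ?_) (abs_nonneg _)
    have hden : 0 < 2 * l2 g + 1 := by have := l2_nonneg g; linarith
    set ε : ℝ := η / (2 * l2 g + 1) with hε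
    have hεpos : 0 < ε := div_pos hη hden
    obtain ⟨ψ, hψ, hper, hle⟩ := exists_smooth_l2_sub_le hp2 hεpos
    have h1 := hkey ε hεpos ψ hψ hper hle
    have h2 := abs_integral_mul_le hg (hp2.sub (hcont hψ))
    have h3 : ∫ x, g x * (p - ψ) x ∂vol = ∫ x, g x * p x ∂vol - ∫ x, g x * ψ x ∂vol := by
      rw [← integral_sub (integrable_mul_vol hg hp2) (integrable_mul_vol hg (hcont hψ))]
      simp only [Pi.sub_apply, mul_sub]
    rw [h3] at h2
    have h4 : l2 g * l2 (p - ψ) ≤ l2 g * ε := mul_le_mul_of_nonneg_left hle (l2_nonneg g)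
    have h5 : ε * (2 * l2 g + 1) = η := div_mul_cancel₀ _ hden.ne'
    rw [abs_le] at h1 h2 ⊢
    constructor <;> nlinarith
  rw [← hzero]
  refine integral_congr_ae (Filter.Eventually.of_forall fun x => ?_)
  simp only [hp]
  ring

end Shear

end ChannelNS
end

/-! ### Green's formula and shear modes as weak eigenfunctions. -/

noncomputable section
namespace ChannelNS

/-! ### Green's formula -/

lemma hasGradTrace_of_contDiff {f : Pt → ℝ} (hf : ContDiff ℝ ∞ f) (hp : PeriodicXY f) :
    HasGradTrace f (fun x j => pd j f x) f where
  memLp := memLp_vol_of_continuous hf.continuous 2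
  memLp_grad j := memLp_vol_of_continuous (contDiff_pd hf j).continuous 2
  memLp_trace := memLp_surf_of_continuous hf.continuous 2
  green ψ hψ hψp j := by
    have h1 : Integrable (fun x => pd j f x * ψ x) vol :=
      integrable_vol_of_continuous ((contDiff_pd hf j).continuous.mul hψ.continuous)
    have h2 : Integrable (fun x => f x * pd j ψ x) vol :=
      integrable_vol_of_continuous (hf.continuous.mul (contDiff_pd hψ j).continuous)
    rw [← integral_pd (hf.mul hψ) (hp.mul hψp) j, ← integral_add h1 h2]
    refine integral_congr_ae (Filter.Eventually.of_forall fun x => ?_)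
    exact (pd_mul (hf.differentiable (by simp)) (hψ.differentiable (by simp)) j x).symm

lemma HasGradTrace.sub {f f' : Pt → ℝ} {g g' : Pt → Pt} {θ θ' : Pt → ℝ}
    (h : HasGradTrace f g θ) (h' : HasGradTrace f' g' θ') :
    HasGradTrace (fun x => f x - f' x) (fun x => g x - g' x) (fun x => θ x - θ' x) where
  memLp := h.memLp.sub h'.memLp
  memLp_grad j := (h.memLp_grad j).sub (h'.memLp_grad j)
  memLp_trace := h.memLp_trace.sub h'.memLp_trace
  green ψ hψ hψp j := by
    have hψ2 := memLp_vol_of_continuous hψ.continuous 2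
    have hdψ := memLp_vol_of_continuous (contDiff_pd hψ j).continuous 2
    have hν : Continuous fun x : Pt => normal x j := by
      unfold normal
      fin_cases j
      exacts [continuous_const, continuous_const, continuous_apply 2]
    have hs : ∀ {τ : Pt → ℝ}, MemLp τ 2 surf → Integrable (fun x => τ x * ψ x * normal x j) surf := by
      intro τ hτ
      simp only [mul_assoc]
      exact hτ.integrable_mul (memLp_surf_of_continuous (hψ.continuous.mul hν) 2)
    have e1 := h.green ψ hψ hψp j
    have e2 := h'.green ψ hψ hψp j
    simp only [Pi.sub_apply, sub_mul]
    rw [integral_sub (integrable_mul_vol (h.memLp_grad j) hψ2)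
      (integrable_mul_vol (h'.memLp_grad j) hψ2), integral_sub (integrable_mul_vol h.memLp hdψ)
      (integrable_mul_vol h'.memLp hdψ), integral_sub (hs h.memLp_trace) (hs h'.memLp_trace),
      ← e1, ← e2]
    ring

lemma InH.sub {u u' : Pt → Pt} (h : InH u) (h' : InH u') : InH (fun x => u x - u' x) where
  periodic x := by
    simp only [(h.periodic x).1, (h.periodic x).2, (h'.periodic x).1, (h'.periodic x).2, and_self]
  memLp i := (h.memLp i).sub (h'.memLp i)
  solenoidal ψ hψ hψp := by
    have hi : ∀ {w : Pt → Pt}, InH w → Integrable (fun x => ∑ i, w x i * pd i ψ x) vol := fun hw =>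
      integrable_finsetSum _ fun i _ => integrable_mul_vol (hw.memLp i)
        (memLp_vol_of_continuous (contDiff_pd hψ i).continuous 2)
    have := integral_sub (hi h) (hi h')
    rw [h.solenoidal ψ hψ hψp, h'.solenoidal ψ hψ hψp, sub_zero] at this
    rw [← this]
    simp only [Pi.sub_apply, sub_mul, Finset.sum_sub_distrib]

lemma InV.sub {u u' : Pt → Pt} {G G' : Pt → Matrix (Fin 3) (Fin 3) ℝ} {θ θ' : Pt → Pt}
    (h : InV u G θ) (h' : InV u' G' θ') :
    InV (fun x => u x - u' x) (fun x => G x - G' x) (fun x => θ x - θ' x) where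
  inH := h.inH.sub h'.inH
  grad_trace i := (h.grad_trace i).sub (h'.grad_trace i)

lemma ip_comm (u w : Pt → Pt) : ip u w = ip w u := by
  simp only [ip, dotProduct_comm]

lemma frob_comm (A B : Matrix (Fin 3) (Fin 3) ℝ) : frob A B = frob B A := by
  simp only [frob, mul_comm]

lemma stokesForm_comm (β : ℝ) (G : Pt → Matrix (Fin 3) (Fin 3) ℝ) (θ : Pt → Pt)
    (Φ : Pt → Matrix (Fin 3) (Fin 3) ℝ) (η : Pt → Pt) :
    stokesForm β G θ Φ η = stokesForm β Φ η G θ := by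
  simp only [stokesForm, frob_comm, dotProduct_comm]

lemma two_mul_frob_symm (A B : Matrix (Fin 3) (Fin 3) ℝ) :
    2 * frob (symm A) (symm B) = ∑ i, ∑ j, A i j * (B i j + B j i) := by
  simp only [frob, symm, Fin.sum_univ_three, Matrix.smul_apply, Matrix.add_apply,
    Matrix.transpose_apply, smul_eq_mul]
  ring

/-! ### Shear modes -/

/-- `F e` is a shear flow in the horizontal direction `e` which is an eigenfunction, with
eigenvalue `lam` and zero pressure, of the Stokes operator with friction on the walls. -/
structure ShearMode (β lam : ℝ) (F : Pt → ℝ) (e : Pt) : Prop where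
  smooth : ContDiff ℝ ∞ F
  periodic : PeriodicXY F
  lap_eq : ∀ x, lap F x = -lam * F x
  invariant : ∀ x (s : ℝ), F (x + s • e) = F x
  horizontal : e 2 = 0
  friction : ∀ x ∈ wall, pd 2 F x * x 2 + β * F x = 0

/-- The velocity field of a shear flow. -/
def shearField (F : Pt → ℝ) (e : Pt) : Pt → Pt := fun x => F x • e

namespace ShearMode

variable {β lam : ℝ} {F : Pt → ℝ} {e : Pt}

lemma differentiable (S : ShearMode β lam F e) : Differentiable ℝ F :=
  S.smooth.differentiable (by simp)

lemma const_mul (S : ShearMode β lam F e) (c : ℝ) : ShearMode β lam (fun x => c * F x) e where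
  smooth := contDiff_const.mul S.smooth
  periodic := (periodicXY_const c).mul S.periodic
  lap_eq x := by
    have h := S.lap_eq x
    have : ∀ j, pd j (fun x => c * F x) = fun x => c * pd j F x := fun j =>
      funext fun x => pd_const_mul S.differentiable c j x
    simp only [lap, this] at h ⊢
    rw [Finset.sum_congr rfl fun j _ =>
      pd_const_mul ((contDiff_pd S.smooth j).differentiable (by simp)) c j x, ← Finset.mul_sum, h]
    ring
  invariant x s := by rw [S.invariant]
  horizontal := S.horizontal
  friction x hx := by
    rw [pd_const_mul S.differentiable]
    linear_combination c * S.friction x hx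

/-- The invariance of `F` along `e`, differentiated at s = 0. This single identity yields both
incompressibility and the vanishing of the convective term. -/
lemma sum_pd_eq_zero (S : ShearMode β lam F e) (x : Pt) : ∑ j, e j * pd j F x = 0 := by
  rw [← fderiv_eq_sum_pd]
  have h1 : HasDerivAt (fun s : ℝ => x + s • e) e 0 := by
    simpa using ((hasDerivAt_id (0 : ℝ)).smul_const e).const_add x
  have h2 : HasFDerivAt F (fderiv ℝ F x) (x + (0 : ℝ) • e) := by
    simpa using (S.differentiable x).hasFDerivAt
  have h3 := h2.comp_hasDerivAt (0 : ℝ) h1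
  have h4 : F ∘ (fun s : ℝ => x + s • e) = fun _ => F x := funext fun s => S.invariant x s
  rw [h4] at h3
  exact h3.unique (hasDerivAt_const _ _)

lemma contDiff_apply (S : ShearMode β lam F e) (i : Fin 3) :
    ContDiff ℝ ∞ fun x => shearField F e x i :=
  S.smooth.mul contDiff_const

lemma periodic_field (S : ShearMode β lam F e) : PeriodicXY (shearField F e) :=
  S.periodic.comp fun t => t • e

lemma pd_apply (S : ShearMode β lam F e) (i j : Fin 3) (x : Pt) :
    pd j (fun y => shearField F e y i) x = pd j F x * e i :=
  pd_mul_const S.differentiable (e i) j x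

lemma grad_apply (S : ShearMode β lam F e) (x : Pt) (i j : Fin 3) :
    grad (shearField F e) x i j = pd j F x * e i :=
  S.pd_apply i j x

lemma lap_apply (S : ShearMode β lam F e) (i : Fin 3) (x : Pt) :
    lap (fun y => shearField F e y i) x = -lam * shearField F e x i := by
  have : ∀ j, pd j (fun y => shearField F e y i) = fun x => pd j F x * e i := fun j =>
    funext fun x => S.pd_apply i j x
  simp only [lap, this]
  rw [Finset.sum_congr rfl fun j _ =>
    pd_mul_const ((contDiff_pd S.smooth j).differentiable (by simp)) (e i) j x, ← Finset.sum_mul]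
  have h := S.lap_eq x
  rw [lap] at h
  rw [h, shearField, Pi.smul_apply, smul_eq_mul, mul_assoc]

lemma dvg_eq_zero (S : ShearMode β lam F e) (x : Pt) : dvg (shearField F e) x = 0 := by
  rw [← S.sum_pd_eq_zero x, dvg]
  exact Finset.sum_congr rfl fun i _ => by rw [S.pd_apply, mul_comm]

lemma mulVec_grad (S : ShearMode β lam F e) (x : Pt) :
    (grad (shearField F e) x).mulVec (shearField F e x) = 0 := by
  ext i
  have h := S.sum_pd_eq_zero x
  simp only [Matrix.mulVec, dotProduct, S.grad_apply, shearField, Pi.smul_apply, smul_eq_mul,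
    Pi.zero_apply]
  rw [Fin.sum_univ_three] at h ⊢
  linear_combination (F x * e i) * h

lemma convection_eq_zero (S : ShearMode β lam F e) (φ : Pt → Pt) :
    convection (shearField F e) (grad (shearField F e)) φ = 0 := by
  simp [convection, S.mulVec_grad]

/-- Against a horizontal field every boundary term needed for the divergence drops out: the
horizontal components meet a zero component of the normal, and the vertical component is itself
zero. -/
lemma inV (S : ShearMode β lam F e) :
    InV (shearField F e) (grad (shearField F e)) (shearField F e) where
  inH :=
    { periodic := S.periodic_field
      memLp := fun i => memLp_vol_of_continuous (S.contDiff_apply i).continuous 2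
      solenoidal := fun ψ hψ hψp => by
        have hi : ∀ i, Integrable (fun x => shearField F e x i * pd i ψ x) vol := fun i =>
          integrable_vol_of_continuous
            ((S.contDiff_apply i).continuous.mul (contDiff_pd hψ i).continuous)
        have hi' : ∀ i, Integrable (fun x => pd i (fun y => shearField F e y i) x * ψ x) vol :=
          fun i => integrable_vol_of_continuous
            ((contDiff_pd (S.contDiff_apply i) i).continuous.mul hψ.continuous)
        have hg : ∀ i, ∫ x, shearField F e x i * pd i ψ x ∂vol
            = -∫ x, pd i (fun y => shearField F e y i) x * ψ x ∂vol := by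
          intro i
          have h := (hasGradTrace_of_contDiff (S.contDiff_apply i)
            (S.periodic_field.comp fun a => a i)).green ψ hψ hψp i
          have h0 : ∀ x, shearField F e x i * ψ x * normal x i = 0 := by
            intro x
            fin_cases i <;> simp [normal, shearField, S.horizontal]
          simp only [h0, integral_zero] at h
          linarith
        rw [integral_finsetSum _ fun i _ => hi i, Finset.sum_congr rfl fun i _ => hg i,
          Finset.sum_neg_distrib, ← integral_finsetSum _ fun i _ => hi' i]
        simp only [← Finset.sum_mul]
        have : ∀ x, ∑ i, pd i (fun y => shearField F e y i) x = 0 := S.dvg_eq_zero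
        simp [this] }
  grad_trace i := hasGradTrace_of_contDiff (S.contDiff_apply i) (S.periodic_field.comp fun a => a i)

/-- A shear mode is a weak eigenfunction of the Stokes operator. -/
lemma stokesForm_eq (S : ShearMode β lam F e) {φ : Pt → Pt} {Φ : Pt → Matrix (Fin 3) (Fin 3) ℝ}
    {η : Pt → Pt} (h : InV φ Φ η) :
    stokesForm β Φ η (grad (shearField F e)) (shearField F e) = lam * ip φ (shearField F e) := by
  -- Ψ is twice the symmetric gradient of the shear field. It is smooth, so it can take over the
  -- derivatives that φ has only weakly.
  set Ψ : Fin 3 → Fin 3 → Pt → ℝ := fun i j x => pd j F x * e i + pd i F x * e j with hΨ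
  have hΨs : ∀ i j, ContDiff ℝ ∞ (Ψ i j) := fun i j =>
    ((contDiff_pd S.smooth j).mul contDiff_const).add ((contDiff_pd S.smooth i).mul contDiff_const)
  have hΨp : ∀ i j, PeriodicXY (Ψ i j) := fun i j =>
    ((S.periodic.pd j).mul (periodicXY_const _)).add ((S.periodic.pd i).mul (periodicXY_const _))
  have hν : ∀ j, Continuous fun x : Pt => normal x j := fun j => by
    unfold normal
    fin_cases j
    exacts [continuous_const, continuous_const, continuous_apply 2]
  have hint1 : ∀ i j, Integrable (fun x => Φ x i j * Ψ i j x) vol := fun i j =>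
    integrable_mul_vol ((h.grad_trace i).memLp_grad j)
      (memLp_vol_of_continuous (hΨs i j).continuous 2)
  have hint2 : ∀ i j, Integrable (fun x => φ x i * pd j (Ψ i j) x) vol := fun i j =>
    integrable_mul_vol (h.inH.memLp i)
      (memLp_vol_of_continuous (contDiff_pd (hΨs i j) j).continuous 2)
  have hint3 : ∀ i j, Integrable (fun x => η x i * Ψ i j x * normal x j) surf := fun i j => by
    simp only [mul_assoc]
    exact (h.grad_trace i).memLp_trace.integrable_mul
      (memLp_surf_of_continuous ((hΨs i j).continuous.mul (hν j)) 2)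
  -- In div Ψ the first half is the Laplacian of the field and the second is the gradient of its
  -- divergence, hence zero.
  have hdiv : ∀ i x, ∑ j, pd j (Ψ i j) x = -lam * (F x * e i) := by
    intro i x
    have h1 : ∀ j, pd j (Ψ i j) x = pd j (pd j F) x * e i + pd j (pd i F) x * e j := by
      intro j
      have hd : ∀ k, Differentiable ℝ (pd k F) := fun k =>
        (contDiff_pd S.smooth k).differentiable (by simp)
      rw [hΨ]
      rw [pd_add ((hd j).mul_const _) ((hd i).mul_const _), pd_mul_const (hd j),
        pd_mul_const (hd i)]
    have h2 : ∑ j, pd j (pd i F) x * e j = 0 := by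
      have hs : ∀ y, ∑ j, pd j F y * e j = 0 := fun y => by
        rw [← S.sum_pd_eq_zero y]; exact Finset.sum_congr rfl fun j _ => mul_comm _ _
      have hd : ∀ k, Differentiable ℝ (pd k F) := fun k =>
        (contDiff_pd S.smooth k).differentiable (by simp)
      have h3 : pd i (fun y => ∑ j, pd j F y * e j) x = 0 := by
        simp only [hs, pd_const]
      rw [← h3]
      simp only [Fin.sum_univ_three]
      have hm : ∀ k, Differentiable ℝ fun y => pd k F y * e k := fun k => (hd k).mul_const _
      have hm2 : Differentiable ℝ fun y => pd 0 F y * e 0 + pd 1 F y * e 1 := (hm 0).add (hm 1)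
      rw [pd_add hm2 (hm 2), pd_add (hm 0) (hm 1), pd_mul_const (hd 0),
        pd_mul_const (hd 1), pd_mul_const (hd 2), pd_comm S.smooth 0 i, pd_comm S.smooth 1 i,
        pd_comm S.smooth 2 i]
    rw [Finset.sum_congr rfl fun j _ => h1 j, Finset.sum_add_distrib, h2, add_zero,
      ← Finset.sum_mul]
    have h4 := S.lap_eq x
    rw [lap] at h4
    rw [h4, mul_assoc]
  have hvol : 2 * ∫ x, frob (symm (Φ x)) (symm (grad (shearField F e) x)) ∂vol
      = ∑ i, ∑ j, ∫ x, Φ x i j * Ψ i j x ∂vol := by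
    rw [← integral_const_mul]
    simp only [two_mul_frob_symm, S.grad_apply]
    rw [integral_finsetSum _ fun i _ => integrable_finsetSum _ fun j _ => hint1 i j]
    exact Finset.sum_congr rfl fun i _ => integral_finsetSum _ fun j _ => hint1 i j
  have hgreen : ∀ i j, ∫ x, Φ x i j * Ψ i j x ∂vol = ∫ x, η x i * Ψ i j x * normal x j ∂surf
      - ∫ x, φ x i * pd j (Ψ i j) x ∂vol := fun i j => by
    rw [← (h.grad_trace i).green (Ψ i j) (hΨs i j) (hΨp i j) j]
    ring
  have hip : ∑ i, ∑ j, ∫ x, φ x i * pd j (Ψ i j) x ∂vol = -(lam * ip φ (shearField F e)) := by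
    rw [Finset.sum_congr rfl fun i _ => (integral_finsetSum _ fun j _ => hint2 i j).symm,
      ← integral_finsetSum _ fun i _ => integrable_finsetSum _ fun j _ => hint2 i j, ip,
      ← integral_const_mul, ← integral_neg]
    refine integral_congr_ae (Filter.Eventually.of_forall fun x => ?_)
    simp only [← Finset.mul_sum, hdiv, dotProduct, shearField, Pi.smul_apply, smul_eq_mul]
    rw [Finset.mul_sum, ← Finset.sum_neg_distrib]
    exact Finset.sum_congr rfl fun i _ => by ring
  -- Since e 2 = 0, the traction Ψν on a wall is the normal derivative of `F` times `e`, and the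
  -- friction condition makes it -βF e.
  have hsurf : ∑ i, ∑ j, ∫ x, η x i * Ψ i j x * normal x j ∂surf
      = -(β * ∫ x, tang x (η x) ⬝ᵥ tang x (shearField F e x) ∂surf) := by
    rw [Finset.sum_congr rfl fun i _ => (integral_finsetSum _ fun j _ => hint3 i j).symm,
      ← integral_finsetSum _ fun i _ => integrable_finsetSum _ fun j _ => hint3 i j,
      ← integral_const_mul, ← integral_neg]
    refine integral_congr_ae ?_
    filter_upwards [ae_surf_mem] with x hx
    have h0 := S.horizontal
    have h1 := S.friction x hx.1
    simp only [tang, normal, shearField, dotProduct, Fin.sum_univ_three, hΨ, Pi.sub_apply,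
      Pi.smul_apply, smul_eq_mul, h0, Matrix.cons_val_zero, Matrix.cons_val_one, Matrix.cons_val]
    linear_combination (η x 0 * e 0 + η x 1 * e 1) * h1
  rw [stokesForm, hvol, Finset.sum_congr rfl fun i _ => Finset.sum_congr rfl fun j _ => hgreen i j]
  simp only [Finset.sum_sub_distrib]
  rw [hip, hsurf]
  ring

end ShearMode

end ChannelNS
end

/-! ### Existence: the decaying shear flow as a classical and as a weak solution. -/

noncomputable section
namespace ChannelNS

/-! ### Space-time measures -/

instance (T : ℝ) : IsFiniteMeasure (volQ T) := by unfold volQ; infer_instance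

instance (T : ℝ) : IsFiniteMeasure (surfQ T) := by unfold surfQ; infer_instance

lemma ae_volQ_mem (T : ℝ) : ∀ᵐ s ∂(volQ T), s.1 ∈ Ioo 0 T ∧ s.2 ∈ cell := by
  have h1 : ∀ᵐ s ∂(volQ T), s.1 ∈ Ioo 0 T :=
    Measure.quasiMeasurePreserving_fst.ae (ae_restrict_mem measurableSet_Ioo)
  have h2 : ∀ᵐ s ∂(volQ T), s.2 ∈ cell :=
    Measure.quasiMeasurePreserving_snd.ae ae_vol_mem_cell
  exact h1.and h2

lemma exists_bound_volQ {f : ℝ × Pt → ℝ} (hf : Continuous f) (T : ℝ) :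
    ∃ C, ∀ t ∈ Icc 0 T, ∀ x ∈ box, |f (t, x)| ≤ C := by
  obtain ⟨C, hC⟩ := ((isCompact_Icc (a := (0 : ℝ)) (b := T)).prod
    isCompact_box).exists_bound_of_continuousOn hf.continuousOn
  exact ⟨C, fun t ht x hx => hC (t, x) ⟨ht, hx⟩⟩

lemma memLp_volQ_of_continuous {f : ℝ × Pt → ℝ} (hf : Continuous f) (p : ENNReal) (T : ℝ) :
    MemLp f p (volQ T) := by
  obtain ⟨C, hC⟩ := exists_bound_volQ hf T
  refine MemLp.of_bound hf.aestronglyMeasurable C ?_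
  filter_upwards [ae_volQ_mem T] with s hs
  exact hC _ (Ioo_subset_Icc_self hs.1) _ (cell_subset_box hs.2)

lemma memLp_surfQ_of_continuous {f : ℝ × Pt → ℝ} (hf : Continuous f) (p : ENNReal) (T : ℝ) :
    MemLp f p (surfQ T) := by
  obtain ⟨C, hC⟩ := exists_bound_volQ hf T
  refine MemLp.of_bound hf.aestronglyMeasurable C ?_
  have h1 : ∀ᵐ s ∂(surfQ T), s.1 ∈ Ioo 0 T :=
    Measure.quasiMeasurePreserving_fst.ae (ae_restrict_mem measurableSet_Ioo)
  have h2 : ∀ᵐ s ∂(surfQ T), s.2 ∈ wall ∩ box :=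
    Measure.quasiMeasurePreserving_snd.ae ae_surf_mem
  filter_upwards [h1, h2] with s hs1 hs2
  exact hC _ (Ioo_subset_Icc_self hs1) _ hs2.2

lemma integrable_volQ_of_continuous {f : ℝ × Pt → ℝ} (hf : Continuous f) (T : ℝ) :
    Integrable f (volQ T) :=
  memLp_one_iff_integrable.1 (memLp_volQ_of_continuous hf 1 T)

/-! ### Space-time test functions -/

/-- The time derivative of a function on space-time. -/
def dt (φ : ℝ × Pt → ℝ) (s : ℝ × Pt) : ℝ := fderiv ℝ φ s (1, 0)

/-- The spatial partial derivatives of a function on space-time. -/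
def dx (j : Fin 3) (φ : ℝ × Pt → ℝ) (s : ℝ × Pt) : ℝ := fderiv ℝ φ s (0, Pi.single j 1)

lemma contDiff_dt {φ : ℝ × Pt → ℝ} (hφ : ContDiff ℝ ∞ φ) : ContDiff ℝ ∞ (dt φ) :=
  (hφ.fderiv_right (by simp)).clm_apply contDiff_const

lemma contDiff_dx {φ : ℝ × Pt → ℝ} (hφ : ContDiff ℝ ∞ φ) (j : Fin 3) : ContDiff ℝ ∞ (dx j φ) :=
  (hφ.fderiv_right (by simp)).clm_apply contDiff_const

lemma hasDerivAt_dt {φ : ℝ × Pt → ℝ} (hφ : ContDiff ℝ ∞ φ) (t : ℝ) (x : Pt) :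
    HasDerivAt (fun r => φ (r, x)) (dt φ (t, x)) t := by
  have h1 : HasDerivAt (fun r : ℝ => (r, x)) ((1 : ℝ), (0 : Pt)) t :=
    (hasDerivAt_id t).prodMk (hasDerivAt_const t x)
  exact (hφ.differentiable (by simp) (t, x)).hasFDerivAt.comp_hasDerivAt t h1

lemma pd_slice {φ : ℝ × Pt → ℝ} (hφ : ContDiff ℝ ∞ φ) (t : ℝ) (j : Fin 3) :
    pd j (fun y => φ (t, y)) = fun x => dx j φ (t, x) := by
  ext x
  have h1 : HasFDerivAt (fun y : Pt => (t, y)) (ContinuousLinearMap.inr ℝ ℝ Pt) x :=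
    hasFDerivAt_prodMk_right t x
  have h2 := (hφ.differentiable (by simp) (t, x)).hasFDerivAt.comp x h1
  have h3 : fderiv ℝ (fun y => φ (t, y)) x
      = (fderiv ℝ φ (t, x)).comp (ContinuousLinearMap.inr ℝ ℝ Pt) := h2.fderiv
  rw [pd, h3, dx]
  simp

lemma lap_slice {φ : ℝ × Pt → ℝ} (hφ : ContDiff ℝ ∞ φ) (t : ℝ) (x : Pt) :
    lap (fun y => φ (t, y)) x = ∑ j, dx j (dx j φ) (t, x) := by
  simp only [lap, pd_slice hφ, pd_slice (contDiff_dx hφ _)]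

lemma contDiff_slice {φ : ℝ × Pt → ℝ} (hφ : ContDiff ℝ ∞ φ) (t : ℝ) :
    ContDiff ℝ ∞ fun y => φ (t, y) :=
  hφ.comp (contDiff_const.prodMk contDiff_id)

/-- Smooth space-periodic functions on space-time which vanish near `t = 0`, near `t = T` and near
the walls. -/
structure IsTest (T : ℝ) (φ : ℝ × Pt → ℝ) : Prop where
  smooth : ContDiff ℝ ∞ φ
  periodic : ∀ t, PeriodicXY fun x => φ (t, x)
  vanish : ∃ δ : ℝ, 0 < δ ∧ ∀ t x, t ≤ δ ∨ T - δ ≤ t ∨ 1 - δ ≤ |x 2| → φ (t, x) = 0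

lemma pd_eq_zero_of_vanish {ψ : Pt → ℝ} {δ : ℝ} (hδ : 0 < δ)
    (h : ∀ x : Pt, 1 - δ ≤ |x 2| → ψ x = 0) (j : Fin 3) {x : Pt} (hx : 1 ≤ |x 2|) :
    pd j ψ x = 0 := by
  have hc : Continuous fun y : Pt => |y 2| := by fun_prop
  have hev : ψ =ᶠ[nhds x] fun _ => 0 := by
    filter_upwards [hc.continuousAt.eventually_const_lt (show 1 - δ < |x 2| by linarith)] with y hy
    exact h y hy.le
  rw [pd, hev.fderiv_eq]
  simp

lemma one_le_abs_of_mem_wall {x : Pt} (hx : x ∈ wall) : 1 ≤ |x 2| := by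
  rcases hx with h | h <;> simp [h]

lemma integral_surf_eq_zero {f : Pt → ℝ} (h : ∀ x ∈ wall, f x = 0) : ∫ x, f x ∂surf = 0 := by
  refine integral_eq_zero_of_ae ?_
  filter_upwards [ae_surf_mem] with x hx using h x hx.1

/-- Green's second formula. -/
lemma integral_mul_lap {F ψ : Pt → ℝ} (hF : ContDiff ℝ ∞ F) (hFp : PeriodicXY F)
    (hψ : ContDiff ℝ ∞ ψ) (hψp : PeriodicXY ψ) {δ : ℝ} (hδ : 0 < δ)
    (h : ∀ x : Pt, 1 - δ ≤ |x 2| → ψ x = 0) :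
    ∫ x, F x * lap ψ x ∂vol = ∫ x, lap F x * ψ x ∂vol := by
  have hj : ∀ j, ∫ x, F x * pd j (pd j ψ) x ∂vol = ∫ x, pd j (pd j F) x * ψ x ∂vol := by
    intro j
    have h1 := (hasGradTrace_of_contDiff hF hFp).green (pd j ψ) (contDiff_pd hψ j) (hψp.pd j) j
    have h2 := (hasGradTrace_of_contDiff (contDiff_pd hF j) (hFp.pd j)).green ψ hψ hψp j
    rw [integral_surf_eq_zero fun x hx => by
      rw [pd_eq_zero_of_vanish hδ h j (one_le_abs_of_mem_wall hx)]; ring] at h1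
    rw [integral_surf_eq_zero fun x hx => by
      rw [h x (by have := one_le_abs_of_mem_wall hx; linarith)]; ring] at h2
    linarith
  have hi1 : ∀ j, Integrable (fun x => F x * pd j (pd j ψ) x) vol := fun j =>
    integrable_vol_of_continuous
      (hF.continuous.mul (contDiff_pd (contDiff_pd hψ j) j).continuous)
  have hi2 : ∀ j, Integrable (fun x => pd j (pd j F) x * ψ x) vol := fun j =>
    integrable_vol_of_continuous
      ((contDiff_pd (contDiff_pd hF j) j).continuous.mul hψ.continuous)
  simp only [lap, Finset.mul_sum, Finset.sum_mul]
  rw [integral_finsetSum _ fun j _ => hi1 j, integral_finsetSum _ fun j _ => hi2 j]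
  exact Finset.sum_congr rfl fun j _ => hj j

lemma IsTest.integral_dx {T : ℝ} {φ : ℝ × Pt → ℝ} (hφ : IsTest T φ) (j : Fin 3) :
    ∫ s, dx j φ s ∂(volQ T) = 0 := by
  rw [volQ, integral_prod _ (integrable_volQ_of_continuous (contDiff_dx hφ.smooth j).continuous T)]
  obtain ⟨δ, hδ, h⟩ := hφ.vanish
  have : ∀ t, ∫ x, dx j φ (t, x) ∂vol = 0 := by
    intro t
    rw [← pd_slice hφ.smooth, integral_pd (contDiff_slice hφ.smooth t) (hφ.periodic t)]
    refine integral_surf_eq_zero fun x hx => ?_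
    rw [h t x (Or.inr (Or.inr (by have := one_le_abs_of_mem_wall hx; linarith))), zero_mul]
  simp [this]

/-! ### The decaying shear flow -/

/-- The amplitude `γ e^{-λt}`. -/
def decay (γ lam t : ℝ) : ℝ := γ * Real.exp (-lam * t)

lemma hasDerivAt_decay (γ lam t : ℝ) : HasDerivAt (decay γ lam) (-lam * decay γ lam t) t := by
  have h := (((hasDerivAt_id t).const_mul (-lam)).exp).const_mul γ
  refine h.congr_deriv ?_
  simp only [decay, id]
  ring

lemma contDiff_decay (γ lam : ℝ) : ContDiff ℝ ∞ (decay γ lam) := by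
  unfold decay; fun_prop

lemma continuous_decay (γ lam : ℝ) : Continuous (decay γ lam) := (contDiff_decay γ lam).continuous

lemma decay_zero (γ lam : ℝ) : decay γ lam 0 = γ := by simp [decay]

/-- The velocity field `γ e^{-λt} F e`. -/
def shearFlow (γ lam : ℝ) (F : Pt → ℝ) (e : Pt) (t : ℝ) : Pt → Pt :=
  shearField (fun x => decay γ lam t * F x) e

lemma ip_shearField_const_mul (c : ℝ) (F : Pt → ℝ) (e : Pt) (φ : Pt → Pt) :
    ip (shearField (fun x => c * F x) e) φ = c * ip (shearField F e) φ := by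
  simp only [ip, shearField, mul_smul, smul_dotProduct, smul_eq_mul, integral_const_mul]

lemma integral_Ioo_deriv {f f' : ℝ → ℝ} {t : ℝ} (ht : 0 ≤ t) (hf : ∀ s, HasDerivAt f (f' s) s)
    (hf' : Continuous f') : ∫ s in Ioo 0 t, f' s = f t - f 0 := by
  rw [← integral_Ioc_eq_integral_Ioo, ← intervalIntegral.integral_of_le ht]
  exact intervalIntegral.integral_eq_sub_of_hasDerivAt (fun s _ => hf s)
    (hf'.intervalIntegrable _ _)

lemma ip_shearFlow_self (γ lam : ℝ) (F : Pt → ℝ) (e : Pt) (t : ℝ) :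
    ip (shearFlow γ lam F e t) (shearFlow γ lam F e t)
      = decay γ lam t * (decay γ lam t * ip (shearField F e) (shearField F e)) := by
  simp only [shearFlow]
  rw [ip_shearField_const_mul, ip_comm, ip_shearField_const_mul]

/-- The energy identity for the decaying shear flow. -/
lemma shearFlow_energy_eq (γ lam : ℝ) (F : Pt → ℝ) (e : Pt) {t : ℝ} (ht : 0 ≤ t) :
    1 / 2 * ip (shearFlow γ lam F e t) (shearFlow γ lam F e t)
      + ∫ s in Ioo 0 t, lam * ip (shearFlow γ lam F e s) (shearFlow γ lam F e s)
      = 1 / 2 * ip (shearFlow γ lam F e 0) (shearFlow γ lam F e 0) := by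
  simp only [ip_shearFlow_self]
  set K := ip (shearField F e) (shearField F e) with hK
  have hdc := continuous_decay γ lam
  have hFTC := integral_Ioo_deriv ht
    (f := fun s => -(1 / 2) * (decay γ lam s * (decay γ lam s * K)))
    (f' := fun s => lam * (decay γ lam s * (decay γ lam s * K)))
    (fun s => (((hasDerivAt_decay γ lam s).mul
      ((hasDerivAt_decay γ lam s).mul_const K)).const_mul (-(1 / 2))).congr_deriv (by ring))
    (by fun_prop)
  rw [hFTC]
  linarith

lemma continuous_ip_shearFlow_self (γ lam : ℝ) (F : Pt → ℝ) (e : Pt) :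
    Continuous fun t => ip (shearFlow γ lam F e t) (shearFlow γ lam F e t) := by
  simp only [ip_shearFlow_self]
  exact (continuous_decay γ lam).mul ((continuous_decay γ lam).mul continuous_const)

namespace ShearMode

variable {β lam : ℝ} {F : Pt → ℝ} {e : Pt}

lemma flow (S : ShearMode β lam F e) (γ t : ℝ) :
    ShearMode β lam (fun x => decay γ lam t * F x) e := S.const_mul _

lemma contDiff_flow (S : ShearMode β lam F e) (γ : ℝ) (i : Fin 3) :
    ContDiff ℝ ∞ fun s : ℝ × Pt => shearFlow γ lam F e s.1 s.2 i :=
  ((((contDiff_decay γ lam).comp contDiff_fst).mul (S.smooth.comp contDiff_snd)).mul contDiff_const)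

lemma isClassicalSolution (S : ShearMode β lam F e) (γ Q₀ : ℝ) :
    IsClassicalSolution β (shearFlow γ lam F e 0) (shearFlow γ lam F e) (fun _ _ => Q₀) where
  smooth_v := contDiff_pi.2 fun i => S.contDiff_flow γ i
  smooth_q := contDiff_const
  periodic_v t := (S.flow γ t).periodic_field
  periodic_q _ := periodicXY_const Q₀
  momentum t _ x _ i := by
    have h1 : deriv (fun s => shearFlow γ lam F e s x i) t
        = -lam * shearFlow γ lam F e t x i := by
      have := (((hasDerivAt_decay γ lam t).mul_const (F x)).mul_const (e i)).deriv
      rw [show (fun s => shearFlow γ lam F e s x i) = fun s => decay γ lam s * F x * e i from rfl,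
        this]
      simp only [shearFlow, shearField, Pi.smul_apply, smul_eq_mul]
      ring
    have h2 := (S.flow γ t).lap_apply i x
    have h3 := congrFun ((S.flow γ t).mulVec_grad x) i
    simp only [Matrix.mulVec, dotProduct, grad, Matrix.of_apply, Pi.zero_apply] at h3
    have h4 : ∑ j, shearFlow γ lam F e t x j * pd j (fun y => shearFlow γ lam F e t y i) x = 0 := by
      rw [← h3]
      exact Finset.sum_congr rfl fun j _ => mul_comm _ _
    rw [h1, h4, pd_const]
    simp only [shearFlow] at h2 ⊢
    rw [h2]
    ring
  incompressible t _ x _ := (S.flow γ t).dvg_eq_zero x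
  impermeable t _ x _ := by
    simp [shearFlow, shearField, normal, S.horizontal, dotProduct, Fin.sum_univ_three]
  friction t _ x hx τ hτ := by
    have h0 := S.horizontal
    have h1 := (S.flow γ t).friction x hx
    have h2 := (S.flow γ t).grad_apply x
    simp only [shearFlow]
    rcases hτ with rfl | rfl
    · simp [Matrix.mulVec, dotProduct, Fin.sum_univ_three, symm, h2, normal, h0]
      simp only [shearField, Pi.smul_apply, smul_eq_mul]
      linear_combination e 0 * h1
    · simp [Matrix.mulVec, dotProduct, Fin.sum_univ_three, symm, h2, normal, h0]
      simp only [shearField, Pi.smul_apply, smul_eq_mul]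
      linear_combination e 1 * h1
  initial _ _ := rfl

lemma continuous_grad_flow (S : ShearMode β lam F e) (γ : ℝ) (i j : Fin 3) :
    Continuous fun s : ℝ × Pt => grad (shearFlow γ lam F e s.1) s.2 i j := by
  have : (fun s : ℝ × Pt => grad (shearFlow γ lam F e s.1) s.2 i j)
      = fun s => dx j (fun s : ℝ × Pt => shearFlow γ lam F e s.1 s.2 i) s := by
    ext s
    exact congrFun (pd_slice (S.contDiff_flow γ i) s.1 j) s.2
  rw [this]
  exact (contDiff_dx (S.contDiff_flow γ i) j).continuous

/-- Against a fixed φ every term is a multiple of decay(t) (F e, φ): the Stokes form contributes the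
factor λ and the convective term nothing. What is left is the fundamental theorem of calculus for
decay · χ. The energy inequality holds with equality. -/
lemma isLerayHopf (S : ShearMode β lam F e) (γ : ℝ) {T : ℝ} (hT : 0 < T) :
    IsLerayHopf β (shearFlow γ lam F e 0) T (shearFlow γ lam F e)
      (fun t => grad (shearFlow γ lam F e t)) (shearFlow γ lam F e) where
  memLp i := memLp_volQ_of_continuous (S.contDiff_flow γ i).continuous 2 T
  memLp_grad i j := memLp_volQ_of_continuous (S.continuous_grad_flow γ i j) 2 T
  memLp_trace i := memLp_surfQ_of_continuous (S.contDiff_flow γ i).continuous 2 T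
  inV := Filter.Eventually.of_forall fun t => (S.flow γ t).inV
  bounded := by
    have hc := continuous_ip_shearFlow_self γ lam F e
    obtain ⟨C, hC⟩ := (isCompact_Icc (a := (0 : ℝ)) (b := T)).exists_bound_of_continuousOn
      hc.continuousOn
    refine ⟨C, ?_⟩
    filter_upwards [ae_restrict_mem measurableSet_Ioo] with t ht
    exact (le_abs_self _).trans (hC t (Ioo_subset_Icc_self ht))
  weak φ Φ η hφ χ hχ _ hsupp := by
    set K := ip (shearField F e) φ with hK
    have h1 : ∀ t, stokesForm β (grad (shearFlow γ lam F e t)) (shearFlow γ lam F e t) Φ η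
        = lam * (decay γ lam t * K) := by
      intro t
      rw [stokesForm_comm]
      simp only [shearFlow]
      rw [(S.flow γ t).stokesForm_eq hφ, ip_comm, ip_shearField_const_mul]
    have h2 : ∀ t, convection (shearFlow γ lam F e t) (grad (shearFlow γ lam F e t)) φ = 0 :=
      fun t => (S.flow γ t).convection_eq_zero φ
    have h3 : ∀ t, ip (shearFlow γ lam F e t) φ = decay γ lam t * K := fun t =>
      ip_shearField_const_mul _ _ _ _
    simp only [h1, h2, h3, add_zero]
    have hχd : ∀ s, HasDerivAt χ (deriv χ s) s := fun s =>
      (hχ.differentiable (by simp) s).hasDerivAt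
    have hχc : Continuous (deriv χ) := hχ.continuous_deriv (by simp)
    have hdc := continuous_decay γ lam
    have hFTC := integral_Ioo_deriv hT.le (f := fun s => decay γ lam s * K * χ s)
      (f' := fun s => decay γ lam s * K * deriv χ s - lam * (decay γ lam s * K) * χ s)
      (fun s => (((hasDerivAt_decay γ lam s).mul_const K).mul (hχd s)).congr_deriv (by ring))
      (by have := hχ.continuous; fun_prop)
    -- The closed support of χ lies in (-∞, T), so no boundary term survives at T.
    have hχT : χ T = 0 := by
      by_contra hne
      exact absurd (hsupp (subset_tsupport _ hne)) (lt_irrefl T)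
    rw [integral_sub, hχT] at hFTC
    · linarith
    · have : Continuous fun s => decay γ lam s * K * deriv χ s := by fun_prop
      exact (this.integrableOn_Icc (a := 0) (b := T)).mono_set Ioo_subset_Icc_self
    · have : Continuous fun s => lam * (decay γ lam s * K) * χ s := by
        have := hχ.continuous; fun_prop
      exact (this.integrableOn_Icc (a := 0) (b := T)).mono_set Ioo_subset_Icc_self
  energy := by
    filter_upwards [ae_restrict_mem measurableSet_Ioo] with t ht
    rw [← shearFlow_energy_eq γ lam F e ht.1.le]
    have h1 : ∀ s, stokesForm β (grad (shearFlow γ lam F e s)) (shearFlow γ lam F e s)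
        (grad (shearFlow γ lam F e s)) (shearFlow γ lam F e s)
        = lam * ip (shearFlow γ lam F e s) (shearFlow γ lam F e s) := fun s =>
      (S.flow γ s).stokesForm_eq (S.flow γ s).inV
    simp only [h1, le_refl]

/-- The shear flow satisfies the momentum equation in the sense of distributions. -/
lemma integral_flow_mul (S : ShearMode β lam F e) (γ : ℝ) {T : ℝ} (hT : 0 < T) {φ : ℝ × Pt → ℝ}
    (hφ : IsTest T φ) :
    ∫ s, decay γ lam s.1 * F s.2 * (-dt φ s - ∑ j, dx j (dx j φ) s) ∂(volQ T) = 0 := by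
  obtain ⟨δ, hδ, hvan⟩ := hφ.vanish
  have hdc : Continuous fun s : ℝ × Pt => decay γ lam s.1 :=
    (continuous_decay γ lam).comp continuous_fst
  have hFc : Continuous fun s : ℝ × Pt => F s.2 := S.smooth.continuous.comp continuous_snd
  have htc := (contDiff_dt hφ.smooth).continuous
  have hLc : Continuous fun s => ∑ j, dx j (dx j φ) s :=
    continuous_finsetSum _ fun j _ => (contDiff_dx (contDiff_dx hφ.smooth j) j).continuous
  have hφc := hφ.smooth.continuous
  have hI : ∀ {f : ℝ × Pt → ℝ}, Continuous f → Integrable f (volQ T) := fun hf =>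
    integrable_volQ_of_continuous hf T
  have hi1 : Integrable (fun s => decay γ lam s.1 * F s.2 * (-dt φ s)) (volQ T) :=
    hI ((hdc.mul hFc).mul htc.neg)
  have hi2 : Integrable (fun s => decay γ lam s.1 * F s.2 * ∑ j, dx j (dx j φ) s) (volQ T) :=
    hI ((hdc.mul hFc).mul hLc)
  have hi3 : Integrable (fun s => decay γ lam s.1 * F s.2 * (-lam * φ s)) (volQ T) :=
    hI ((hdc.mul hFc).mul (continuous_const.mul hφc))
  have hlap : ∫ s, decay γ lam s.1 * F s.2 * ∑ j, dx j (dx j φ) s ∂(volQ T)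
      = ∫ s, decay γ lam s.1 * F s.2 * (-lam * φ s) ∂(volQ T) := by
    rw [volQ, integral_prod _ hi2, integral_prod _ hi3]
    congr 1
    ext t
    have h := integral_mul_lap S.smooth S.periodic (contDiff_slice hφ.smooth t) (hφ.periodic t) hδ
      (fun x hx => hvan t x (Or.inr (Or.inr hx)))
    simp only [lap_slice hφ.smooth, S.lap_eq] at h
    simp only [mul_assoc, integral_const_mul] at h ⊢
    rw [h, ← integral_const_mul]
    congr 2
    ext x
    ring
  -- At fixed x the bracket is the time derivative of decay · φ, and φ vanishes at both ends of (0,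
  -- T).
  have htime : ∫ s, F s.2 * (decay γ lam s.1 * dt φ s - lam * decay γ lam s.1 * φ s) ∂(volQ T)
      = 0 := by
    have hc : Continuous fun s : ℝ × Pt =>
      F s.2 * (decay γ lam s.1 * dt φ s - lam * decay γ lam s.1 * φ s) :=
      hFc.mul ((hdc.mul htc).sub ((continuous_const.mul hdc).mul hφc))
    rw [volQ, integral_prod_symm _ (hI hc)]
    refine integral_eq_zero_of_ae (Filter.Eventually.of_forall fun x => ?_)
    dsimp only [Pi.zero_apply]
    rw [integral_const_mul]
    have hx : Continuous fun t : ℝ => (t, x) := by fun_prop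
    have := integral_Ioo_deriv hT.le (f := fun t => decay γ lam t * φ (t, x))
      (f' := fun t => decay γ lam t * dt φ (t, x) - lam * decay γ lam t * φ (t, x))
      (fun t => ((hasDerivAt_decay γ lam t).mul (hasDerivAt_dt hφ.smooth t x)).congr_deriv
        (by ring))
      (((continuous_decay γ lam).mul (htc.comp hx)).sub
        ((continuous_const.mul (continuous_decay γ lam)).mul (hφc.comp hx)))
    rw [this, hvan T x (Or.inr (Or.inl (by linarith))), hvan 0 x (Or.inl hδ.le)]
    simp
  have hsplit : ∫ s, decay γ lam s.1 * F s.2 * (-dt φ s - ∑ j, dx j (dx j φ) s) ∂(volQ T)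
      = ∫ s, decay γ lam s.1 * F s.2 * (-dt φ s) ∂(volQ T)
        - ∫ s, decay γ lam s.1 * F s.2 * ∑ j, dx j (dx j φ) s ∂(volQ T) := by
    rw [← integral_sub hi1 hi2]
    simp only [mul_sub]
  rw [hsplit, hlap, ← integral_sub hi1 hi3, ← neg_eq_zero, ← integral_neg, ← htime]
  congr 1
  ext s
  ring

end ShearMode

lemma IsTest.of_field {T : ℝ} {Φ : ℝ → Pt → Pt}
    (h1 : ContDiff ℝ ∞ fun s : ℝ × Pt => Φ s.1 s.2) (h2 : ∀ t, PeriodicXY (Φ t))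
    (h3 : ∃ δ : ℝ, 0 < δ ∧ ∀ t x, t ≤ δ ∨ T - δ ≤ t ∨ 1 - δ ≤ |x 2| → Φ t x = 0) (i : Fin 3) :
    IsTest T fun s => Φ s.1 s.2 i where
  smooth := contDiff_pi.1 h1 i
  periodic t := (h2 t).comp fun a => a i
  vanish := by
    obtain ⟨δ, hδ, h⟩ := h3
    exact ⟨δ, hδ, fun t x htx => by simp [h t x htx]⟩

/-- The part of the distributional momentum equation which does not contain the pressure. -/
lemma ShearMode.momentum_integrand {β lam : ℝ} {F : Pt → ℝ} {e : Pt} (S : ShearMode β lam F e)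
    (γ : ℝ) {T : ℝ} (hT : 0 < T) {Φ : ℝ → Pt → Pt} (hΦ : ∀ i, IsTest T fun s => Φ s.1 s.2 i) :
    Integrable (fun s : ℝ × Pt => (∑ i, shearFlow γ lam F e s.1 s.2 i *
          (-(deriv (fun r => Φ r s.2 i) s.1) - lap (fun y => Φ s.1 y i) s.2))
        + (grad (shearFlow γ lam F e s.1) s.2).mulVec (shearFlow γ lam F e s.1 s.2)
          ⬝ᵥ Φ s.1 s.2) (volQ T) ∧
    ∫ s : ℝ × Pt, ((∑ i, shearFlow γ lam F e s.1 s.2 i *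
          (-(deriv (fun r => Φ r s.2 i) s.1) - lap (fun y => Φ s.1 y i) s.2))
        + (grad (shearFlow γ lam F e s.1) s.2).mulVec (shearFlow γ lam F e s.1 s.2)
          ⬝ᵥ Φ s.1 s.2) ∂(volQ T) = 0 := by
  have he : ∀ s : ℝ × Pt, (∑ i, shearFlow γ lam F e s.1 s.2 i *
          (-(deriv (fun r => Φ r s.2 i) s.1) - lap (fun y => Φ s.1 y i) s.2))
        + (grad (shearFlow γ lam F e s.1) s.2).mulVec (shearFlow γ lam F e s.1 s.2) ⬝ᵥ Φ s.1 s.2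
      = ∑ i, e i * (decay γ lam s.1 * F s.2 * (-dt (fun s => Φ s.1 s.2 i) s
          - ∑ j, dx j (dx j fun s => Φ s.1 s.2 i) s)) := by
    intro s
    have h1 := (S.flow γ s.1).mulVec_grad s.2
    simp only [shearFlow] at h1 ⊢
    rw [h1, zero_dotProduct, add_zero]
    refine Finset.sum_congr rfl fun i _ => ?_
    have h2 := (hasDerivAt_dt (hΦ i).smooth s.1 s.2).deriv
    have h3 := lap_slice (hΦ i).smooth s.1 s.2
    simp only at h2 h3
    rw [h2, h3]
    simp only [shearField, Pi.smul_apply, smul_eq_mul]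
    ring
  simp only [he]
  have hi : ∀ i, Integrable (fun s : ℝ × Pt => e i * (decay γ lam s.1 * F s.2 *
      (-dt (fun s => Φ s.1 s.2 i) s - ∑ j, dx j (dx j fun s => Φ s.1 s.2 i) s))) (volQ T) := by
    intro i
    have h1 : Continuous fun s => ∑ j, dx j (dx j fun s : ℝ × Pt => Φ s.1 s.2 i) s :=
      continuous_finsetSum _ fun j _ =>
        (contDiff_dx (contDiff_dx (hΦ i).smooth j) j).continuous
    exact integrable_volQ_of_continuous (continuous_const.mul
      ((((continuous_decay γ lam).comp continuous_fst).mul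
        (S.smooth.continuous.comp continuous_snd)).mul
        ((contDiff_dt (hΦ i).smooth).continuous.neg.sub h1))) T
  refine ⟨integrable_finsetSum _ fun i _ => hi i, ?_⟩
  rw [integral_finsetSum _ fun i _ => hi i]
  refine Finset.sum_eq_zero fun i _ => ?_
  rw [integral_const_mul, S.integral_flow_mul γ hT (hΦ i), mul_zero]

/-- A constant pressure is paired with the integral of a divergence, which is zero for periodic
fields vanishing near the walls. -/
lemma ShearMode.isPressure_const {β lam : ℝ} {F : Pt → ℝ} {e : Pt} (S : ShearMode β lam F e)
    (γ : ℝ) {T : ℝ} (hT : 0 < T) (Q₀ : ℝ) :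
    IsPressure T (shearFlow γ lam F e) (fun t => grad (shearFlow γ lam F e t))
      (fun _ _ => Q₀) where
  periodic _ := periodicXY_const Q₀
  integrable _ _ := (integrable_const Q₀).integrableOn
  momentum Φ h1 h2 h3 := by
    have hΦ := IsTest.of_field h1 h2 h3
    obtain ⟨hint, hzero⟩ := S.momentum_integrand γ hT hΦ
    have hd : ∀ s : ℝ × Pt, Q₀ * dvg (Φ s.1) s.2 = Q₀ * ∑ i, dx i (fun s => Φ s.1 s.2 i) s := by
      intro s
      have : ∀ i, pd i (fun y => Φ s.1 y i) s.2 = dx i (fun s => Φ s.1 s.2 i) s := fun i =>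
        congrFun (pd_slice (hΦ i).smooth s.1 i) s.2
      simp only [dvg, this]
    have hi : ∀ i, Integrable (dx i fun s => Φ s.1 s.2 i) (volQ T) := fun i =>
      integrable_volQ_of_continuous (contDiff_dx (hΦ i).smooth i).continuous T
    simp only [hd]
    rw [integral_sub hint ((integrable_finsetSum _ fun i _ => hi i).const_mul Q₀), hzero,
      integral_const_mul, integral_finsetSum _ fun i _ => hi i,
      Finset.sum_eq_zero fun i _ => (hΦ i).integral_dx i]
    simp

end ChannelNS
end

/-! ### Functions of time: primitives of weak derivatives and Grönwall's inequality. -/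

noncomputable section
namespace ChannelNS

/-! ### Scalar functions of time -/

lemma setIntegral_indicator_Ioi {T s : ℝ} (hs : s ∈ Ioo 0 T) (ψ : ℝ → ℝ) :
    ∫ t in Ioo 0 T, (Ioi s).indicator ψ t = ∫ t in Ioo s T, ψ t := by
  rw [setIntegral_indicator measurableSet_Ioi]
  congr 2
  ext t
  simp only [mem_inter_iff, mem_Ioo, mem_Ioi]
  exact ⟨fun h => ⟨h.2, h.1.2⟩, fun h => ⟨⟨hs.1.trans h.1, h.2⟩, h.1⟩⟩

lemma setIntegral_indicator_Iio {T t : ℝ} (ht : t ∈ Ioo 0 T) (h : ℝ → ℝ) :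
    ∫ s in Ioo 0 T, (Iio t).indicator h s = ∫ s in Ioo 0 t, h s := by
  rw [setIntegral_indicator measurableSet_Iio]
  congr 2
  ext s
  simp only [mem_inter_iff, mem_Ioo, mem_Iio]
  exact ⟨fun h => ⟨h.1.1, h.2⟩, fun h => ⟨⟨h.1, h.2.trans ht.2⟩, h.2⟩⟩

/-- Fubini on the triangle s < t. It plays the role of an integration by parts for functions that
are merely integrable. -/
lemma integral_mul_tail_eq {T : ℝ} {h ψ : ℝ → ℝ} (hh : IntegrableOn h (Ioo 0 T))
    (hψ : IntegrableOn ψ (Ioo 0 T)) :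
    ∫ s in Ioo 0 T, h s * ∫ t in Ioo s T, ψ t = ∫ t in Ioo 0 T, (∫ s in Ioo 0 t, h s) * ψ t := by
  have hint : Integrable (fun p : ℝ × ℝ => {p : ℝ × ℝ | p.1 < p.2}.indicator
      (fun p => h p.1 * ψ p.2) p)
      ((volume.restrict (Ioo 0 T)).prod (volume.restrict (Ioo 0 T))) :=
    (Integrable.mul_prod hh hψ).indicator (measurableSet_lt measurable_fst measurable_snd)
  have hsw := integral_integral_swap (f := fun s t => {p : ℝ × ℝ | p.1 < p.2}.indicator
      (fun p => h p.1 * ψ p.2) (s, t)) hint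
  calc ∫ s in Ioo 0 T, h s * ∫ t in Ioo s T, ψ t
      = ∫ s in Ioo 0 T, ∫ t in Ioo 0 T, {p : ℝ × ℝ | p.1 < p.2}.indicator
          (fun p => h p.1 * ψ p.2) (s, t) := by
        refine setIntegral_congr_fun measurableSet_Ioo fun s hs => ?_
        rw [← setIntegral_indicator_Ioi hs, ← integral_const_mul]
        congr 1
        ext t
        by_cases hst : s < t <;> simp [indicator, hst]
    _ = _ := hsw
    _ = ∫ t in Ioo 0 T, (∫ s in Ioo 0 t, h s) * ψ t := by
        refine setIntegral_congr_fun measurableSet_Ioo fun t ht => ?_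
        rw [← setIntegral_indicator_Iio ht, ← integral_mul_const]
        congr 1
        ext s
        by_cases hst : s < t <;> simp [indicator, hst]

/-- A function on `(0,T)` whose distributional derivative is `-h`, with initial value `f₀`, is the
corresponding primitive. -/
lemma ae_eq_primitive {T f₀ : ℝ} {f h : ℝ → ℝ} (hf : IntegrableOn f (Ioo 0 T))
    (hh : IntegrableOn h (Ioo 0 T))
    (hw : ∀ χ : ℝ → ℝ, ContDiff ℝ ∞ χ → HasCompactSupport χ → tsupport χ ⊆ Iio T →
      (∫ t in Ioo 0 T, f t * deriv χ t) + f₀ * χ 0 = ∫ t in Ioo 0 T, h t * χ t) :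
    ∀ᵐ t ∂((volume : Measure ℝ).restrict (Ioo 0 T)), f t = f₀ - ∫ s in Ioo 0 t, h s := by
  have hprim : IntegrableOn (fun t => ∫ s in Ioo 0 t, h s) (Ioo 0 T) := by
    have hc : Continuous fun t => ∫ s in (0 : ℝ)..t, (Ioo 0 T).indicator h s :=
      intervalIntegral.continuous_primitive (fun a b =>
        ((integrable_indicator_iff measurableSet_Ioo).2 hh).intervalIntegrable) 0
    refine ((hc.integrableOn_Icc (a := 0) (b := T)).mono_set Ioo_subset_Icc_self).congr_fun ?_
      measurableSet_Ioo
    intro t ht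
    dsimp only
    rw [intervalIntegral.integral_of_le ht.1.le, integral_Ioc_eq_integral_Ioo]
    exact setIntegral_congr_fun measurableSet_Ioo fun s hs =>
      indicator_of_mem (show s ∈ Ioo 0 T from ⟨hs.1, hs.2.trans ht.2⟩) h
  set H : ℝ → ℝ := fun t => f₀ - ∫ s in Ioo 0 t, h s with hH
  have hHint : IntegrableOn H (Ioo 0 T) := by
    refine Integrable.sub ?_ hprim
    exact integrableOn_const (by simp)
  have hzero : ∀ᵐ t, t ∈ Ioo 0 T → f t - H t = 0 := by
    refine isOpen_Ioo.ae_eq_zero_of_integral_contDiff_smul_eq_zero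
      (hf.sub hHint).locallyIntegrableOn fun ψ hψ hc hsupp => ?_
    have hψc := hψ.continuous
    have hψint : ∀ s : Set ℝ, IntegrableOn ψ s := fun s =>
      (hψc.integrable_of_hasCompactSupport hc).integrableOn
    obtain ⟨δ, hδ, hδK⟩ := hc.isCompact.exists_forall_le' (f := fun t => T - t) (a := 0)
      (by fun_prop) fun t ht => sub_pos.2 (hsupp ht).2
    have hψ0 : ∀ t, T - δ < t → ψ t = 0 := by
      intro t ht
      by_contra hne
      have := hδK t (subset_tsupport _ hne)
      linarith
    -- To test against an arbitrary ψ, the function χ must be a primitive of ψ that vanishes near T.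
    -- The initial value then enters through χ₀(0) = -∫ψ.
    set χ₀ : ℝ → ℝ := fun t => ∫ s in T..t, ψ s with hχ₀
    have hχ₀d : ∀ t, HasDerivAt χ₀ (ψ t) t := fun t =>
      intervalIntegral.integral_hasDerivAt_right (hψc.intervalIntegrable _ _)
        (hψc.stronglyMeasurableAtFilter _ _) hψc.continuousAt
    have hχ₀s : ContDiff ℝ ∞ χ₀ := by
      rw [contDiff_infty_iff_deriv]
      refine ⟨fun t => (hχ₀d t).differentiableAt, ?_⟩
      rwa [show deriv χ₀ = ψ from funext fun t => (hχ₀d t).deriv]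
    have hχ₀0 : ∀ t, T - δ < t → χ₀ t = 0 := by
      intro t ht
      refine (intervalIntegral.integral_congr (g := fun _ => (0 : ℝ)) fun s hs => ?_).trans
        (by simp)
      refine hψ0 s (lt_of_lt_of_le (lt_min (by linarith) ht) hs.1)
    have hχ₀t : ∀ t ≤ T, χ₀ t = -∫ s in Ioo t T, ψ s := by
      intro t ht
      rw [hχ₀]
      dsimp only
      rw [intervalIntegral.integral_symm, intervalIntegral.integral_of_le ht,
        integral_Ioc_eq_integral_Ioo]
    -- To the left of the support of ψ the primitive is constant but need not vanish. The cutoff,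
    -- equal to 0 for t ≤ -1 and to 1 for t ≥ 0, makes the support compact and changes nothing on
    -- [0, T].
    have hηs : ContDiff ℝ ∞ fun t : ℝ => Real.smoothTransition (t + 1) :=
      Real.smoothTransition.contDiff.comp (contDiff_id.add contDiff_const)
    have hχzero : ∀ t, t ∉ Icc (-1) (T - δ) → Real.smoothTransition (t + 1) * χ₀ t = 0 := by
      intro t ht
      rw [mem_Icc, not_and_or, not_le, not_le] at ht
      rcases ht with ht | ht
      · rw [Real.smoothTransition.zero_of_nonpos (by linarith), zero_mul]
      · rw [hχ₀0 t ht, mul_zero]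
    have hsub : tsupport (fun t => Real.smoothTransition (t + 1) * χ₀ t) ⊆ Icc (-1) (T - δ) :=
      closure_minimal (fun t ht => by
        by_contra hn
        exact ht (hχzero t hn)) isClosed_Icc
    have hmain := hw (fun t => Real.smoothTransition (t + 1) * χ₀ t) (hηs.mul hχ₀s)
      (HasCompactSupport.of_support_subset_isCompact isCompact_Icc
        ((subset_tsupport _).trans hsub))
      (hsub.trans fun t ht => lt_of_le_of_lt ht.2 (by linarith))
    have hone : ∀ t, 0 ≤ t → Real.smoothTransition (t + 1) * χ₀ t = χ₀ t := fun t ht => by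
      rw [Real.smoothTransition.one_of_one_le (by linarith), one_mul]
    have hderiv : ∀ t ∈ Ioo 0 T, deriv (fun t => Real.smoothTransition (t + 1) * χ₀ t) t = ψ t := by
      intro t ht
      have hev : (fun t => Real.smoothTransition (t + 1) * χ₀ t) =ᶠ[nhds t] χ₀ := by
        filter_upwards [lt_mem_nhds ht.1] with s hs using hone s hs.le
      rw [hev.deriv_eq, (hχ₀d t).deriv]
    rw [hone 0 le_rfl] at hmain
    have hleft : ∫ t in Ioo 0 T, f t * deriv (fun t => Real.smoothTransition (t + 1) * χ₀ t) t
        = ∫ t in Ioo 0 T, f t * ψ t :=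
      setIntegral_congr_fun measurableSet_Ioo fun t ht => by rw [hderiv t ht]
    have hright : ∫ t in Ioo 0 T, h t * (Real.smoothTransition (t + 1) * χ₀ t)
        = ∫ t in Ioo 0 T, -(h t * ∫ s in Ioo t T, ψ s) :=
      setIntegral_congr_fun measurableSet_Ioo fun t ht => by
        rw [hone t ht.1.le, hχ₀t t ht.2.le]
        ring
    rw [hleft, hright, integral_neg, integral_mul_tail_eq hh (hψint _)] at hmain
    obtain ⟨Cψ, hCψ⟩ := hc.exists_bound_of_continuous hψc
    have hb : ∀ {k : ℝ → ℝ}, IntegrableOn k (Ioo 0 T) →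
        IntegrableOn (fun t => k t * ψ t) (Ioo 0 T) := fun hk =>
      Integrable.mul_bdd hk hψc.aestronglyMeasurable (Filter.Eventually.of_forall hCψ)
    rw [← setIntegral_eq_integral_of_forall_compl_eq_zero (s := Ioo 0 T) fun t ht => by
      rw [image_eq_zero_of_notMem_tsupport fun h => ht (hsupp h), zero_smul]]
    have e1 : ∫ t in Ioo 0 T, ψ t • (f t - H t) = ∫ t in Ioo 0 T,
        ((f t * ψ t - f₀ * ψ t) + (∫ s in Ioo 0 t, h s) * ψ t) := by
      refine setIntegral_congr_fun measurableSet_Ioo fun t _ => ?_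
      simp only [hH, smul_eq_mul]
      ring
    have hcc : IntegrableOn (fun t => f₀ * ψ t) (Ioo 0 T) := (hψint _).const_mul f₀
    have hfc : IntegrableOn (fun t => f t * ψ t - f₀ * ψ t) (Ioo 0 T) := (hb hf).sub hcc
    rw [e1, integral_add hfc (hb hprim), integral_sub (hb hf) hcc,
      integral_const_mul]
    by_cases hT : 0 ≤ T
    · rw [hχ₀t 0 hT] at hmain
      linarith
    · simp [Ioo_eq_empty (fun h => hT h.le)]
  rw [ae_restrict_iff' measurableSet_Ioo]
  filter_upwards [hzero] with t ht hmem
  have := ht hmem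
  simp only [hH] at this
  linarith

/-- Grönwall's inequality, for an inequality which holds almost everywhere. -/
lemma integral_eq_zero_of_le_primitive {T K : ℝ} (hT : 0 ≤ T) {y : ℝ → ℝ}
    (hy : IntegrableOn y (Ioo 0 T)) (hy0 : ∀ t, 0 ≤ y t) (hK : 0 ≤ K)
    (hle : ∀ᵐ t ∂((volume : Measure ℝ).restrict (Ioo 0 T)), y t ≤ K * ∫ s in Ioo 0 t, y s) :
    ∫ t in Ioo 0 T, y t = 0 := by
  have hyi : Integrable ((Ioo 0 T).indicator y) := (integrable_indicator_iff measurableSet_Ioo).2 hy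
  set Y : ℝ → ℝ := fun t => ∫ s in (0 : ℝ)..t, (Ioo 0 T).indicator y s with hY
  have hYc : Continuous Y :=
    intervalIntegral.continuous_primitive (fun a b => hyi.intervalIntegrable) 0
  have hYt : ∀ t ∈ Icc 0 T, Y t = ∫ s in Ioo 0 t, y s := by
    intro t ht
    rw [hY]
    dsimp only
    rw [intervalIntegral.integral_of_le ht.1, integral_Ioc_eq_integral_Ioo]
    exact setIntegral_congr_fun measurableSet_Ioo fun s hs =>
      indicator_of_mem (show s ∈ Ioo 0 T from ⟨hs.1, hs.2.trans_le ht.2⟩) y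
  have hY0 : ∀ t ∈ Icc 0 T, 0 ≤ Y t := fun t ht => by
    rw [hYt t ht]
    exact integral_nonneg hy0
  -- The assumption holds only almost everywhere and `y` need not be continuous. Integrating it once
  -- gives Y ≤ K ∫ Y at every time, and the differential form of Grönwall's inequality applies to
  -- the C¹ function P = ∫ Y.
  set P : ℝ → ℝ := fun t => ∫ s in (0 : ℝ)..t, Y s with hP
  have hPd : ∀ t, HasDerivAt P (Y t) t := fun t =>
    intervalIntegral.integral_hasDerivAt_right (hYc.intervalIntegrable _ _)
      (hYc.stronglyMeasurableAtFilter _ _) hYc.continuousAt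
  have hYP : ∀ t ∈ Icc 0 T, Y t ≤ K * P t := by
    intro t ht
    have e : P t = ∫ s in Ioo 0 t, Y s := by
      rw [hP]
      dsimp only
      rw [intervalIntegral.integral_of_le ht.1, integral_Ioc_eq_integral_Ioo]
    rw [hYt t ht, e, ← integral_const_mul]
    have hsub : Ioo 0 t ⊆ Ioo 0 T := Ioo_subset_Ioo_right ht.2
    refine integral_mono_ae (hy.mono_set hsub)
      (((hYc.integrableOn_Icc (a := 0) (b := t)).mono_set Ioo_subset_Icc_self).const_mul K) ?_
    filter_upwards [ae_restrict_of_ae_restrict_of_subset hsub hle,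
      ae_restrict_mem measurableSet_Ioo] with s hs hmem
    rw [hYt s ⟨hmem.1.le, hmem.2.le.trans ht.2⟩]
    exact hs
  have hP0 : ∀ t ∈ Icc 0 T, ‖P t‖ ≤ gronwallBound 0 K 0 (t - 0) :=
    norm_le_gronwallBound_of_norm_deriv_right_le
      (fun t _ => (hPd t).continuousAt.continuousWithinAt)
      (fun t _ => (hPd t).hasDerivWithinAt) (by simp [hP]) fun t ht => by
        have ht' : t ∈ Icc 0 T := ⟨ht.1, ht.2.le⟩
        rw [Real.norm_of_nonneg (hY0 t ht'), add_zero]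
        exact (hYP t ht').trans (mul_le_mul_of_nonneg_left (Real.le_norm_self _) hK)
  have hPT := hP0 T ⟨hT, le_rfl⟩
  rw [gronwallBound_ε0_δ0, norm_le_zero_iff] at hPT
  have h1 := hYP T ⟨hT, le_rfl⟩
  rw [hPT, mul_zero, hYt T ⟨hT, le_rfl⟩] at h1
  exact le_antisymm h1 (integral_nonneg hy0)

end ChannelNS
end

/-! ### The bilinear terms and the estimate of the convective term. -/

noncomputable section
namespace ChannelNS

/-! ### Integrability of the bilinear terms -/

section Integrability

variable {α : Type*} [MeasurableSpace α] {μ : Measure α}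

lemma memLp_symm {A : α → Matrix (Fin 3) (Fin 3) ℝ} (hA : ∀ i j, MemLp (fun x => A x i j) 2 μ)
    (i j : Fin 3) : MemLp (fun x => symm (A x) i j) 2 μ := by
  have := ((hA i j).add (hA j i)).const_mul (1 / 2 : ℝ)
  simpa [symm] using this

lemma integrable_frob {A B : α → Matrix (Fin 3) (Fin 3) ℝ}
    (hA : ∀ i j, MemLp (fun x => A x i j) 2 μ) (hB : ∀ i j, MemLp (fun x => B x i j) 2 μ) :
    Integrable (fun x => frob (A x) (B x)) μ :=
  integrable_finsetSum _ fun i _ => integrable_finsetSum _ fun j _ =>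
    (hA i j).integrable_mul (hB i j)

lemma integrable_dotProduct {a b : α → Pt} (ha : ∀ i, MemLp (fun x => a x i) 2 μ)
    (hb : ∀ i, MemLp (fun x => b x i) 2 μ) : Integrable (fun x => a x ⬝ᵥ b x) μ :=
  integrable_finsetSum _ fun i _ => (ha i).integrable_mul (hb i)

end Integrability

lemma memLp_vol_mul {k f : Pt → ℝ} (hk : Continuous k) (hf : MemLp f 2 vol) :
    MemLp (fun x => k x * f x) 2 vol := by
  obtain ⟨C, hC⟩ := exists_bound_on_box hk
  refine MemLp.of_le_mul (c := C) hf (hk.aestronglyMeasurable.mul hf.1) ?_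
  filter_upwards [ae_vol_mem_cell] with x hx
  rw [norm_mul]
  exact mul_le_mul_of_nonneg_right (hC x (cell_subset_box hx)) (norm_nonneg _)

lemma memLp_volQ_mul {T : ℝ} {k f : ℝ × Pt → ℝ} (hk : Continuous k) (hf : MemLp f 2 (volQ T)) :
    MemLp (fun s => k s * f s) 2 (volQ T) := by
  obtain ⟨C, hC⟩ := exists_bound_volQ hk T
  refine MemLp.of_le_mul (c := C) hf (hk.aestronglyMeasurable.mul hf.1) ?_
  filter_upwards [ae_volQ_mem T] with s hs
  rw [norm_mul]
  exact mul_le_mul_of_nonneg_right (hC _ (Ioo_subset_Icc_self hs.1) _ (cell_subset_box hs.2))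
    (norm_nonneg _)

/-- On a wall (x 2)² = 1, so removing the normal part removes exactly the third component. -/
lemma tang_dotProduct_tang {x : Pt} (hx : x ∈ wall) (a b : Pt) :
    tang x a ⬝ᵥ tang x b = a 0 * b 0 + a 1 * b 1 := by
  have h : x 2 * x 2 = 1 := by rcases hx with h | h <;> rw [h] <;> norm_num
  simp only [tang, normal, dotProduct, Fin.sum_univ_three, Pi.sub_apply, Pi.smul_apply,
    smul_eq_mul, Matrix.cons_val_zero, Matrix.cons_val_one, Matrix.cons_val]
  linear_combination (a 2 * b 2 * x 2 * x 2 - a 2 * b 2) * h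

lemma stokesForm_eq_horizontal (β : ℝ) (G : Pt → Matrix (Fin 3) (Fin 3) ℝ) (θ : Pt → Pt)
    (Φ : Pt → Matrix (Fin 3) (Fin 3) ℝ) (η : Pt → Pt) :
    stokesForm β G θ Φ η = 2 * (∫ x, frob (symm (G x)) (symm (Φ x)) ∂vol)
      + β * ∫ x, (θ x 0 * η x 0 + θ x 1 * η x 1) ∂surf := by
  rw [stokesForm]
  congr 2
  refine integral_congr_ae ?_
  filter_upwards [ae_surf_mem] with x hx using tang_dotProduct_tang hx.1 _ _

section InV

variable {u u' : Pt → Pt} {G G' : Pt → Matrix (Fin 3) (Fin 3) ℝ} {θ θ' : Pt → Pt}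

lemma InV.memLp_grad (h : InV u G θ) (i j : Fin 3) : MemLp (fun x => G x i j) 2 vol :=
  (h.grad_trace i).memLp_grad j

lemma InV.memLp_trace (h : InV u G θ) (i : Fin 3) : MemLp (fun x => θ x i) 2 surf :=
  (h.grad_trace i).memLp_trace

lemma ip_sub_self (h : InH u) (h' : InH u') :
    ip (fun x => u x - u' x) (fun x => u x - u' x) = ip u u - 2 * ip u u' + ip u' u' := by
  have h1 := integrable_dotProduct h.memLp h.memLp
  have h2 := integrable_dotProduct h.memLp h'.memLp
  have h3 := integrable_dotProduct h'.memLp h'.memLp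
  have h4 : Integrable (fun x => u x ⬝ᵥ u x - 2 * (u x ⬝ᵥ u' x)) vol := h1.sub (h2.const_mul 2)
  simp only [ip]
  rw [← integral_const_mul, ← integral_sub h1 (h2.const_mul 2), ← integral_add h4 h3]
  congr 1
  ext x
  rw [sub_dotProduct, dotProduct_sub, dotProduct_sub, dotProduct_comm (u' x) (u x)]
  ring

lemma stokesForm_sub_self (β : ℝ) (h : InV u G θ) (h' : InV u' G' θ') :
    stokesForm β (fun x => G x - G' x) (fun x => θ x - θ' x) (fun x => G x - G' x)
      (fun x => θ x - θ' x)
      = stokesForm β G θ G θ - 2 * stokesForm β G θ G' θ' + stokesForm β G' θ' G' θ' := by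
  have h1 := integrable_frob (memLp_symm h.memLp_grad) (memLp_symm h.memLp_grad)
  have h2 := integrable_frob (memLp_symm h.memLp_grad) (memLp_symm h'.memLp_grad)
  have h3 := integrable_frob (memLp_symm h'.memLp_grad) (memLp_symm h'.memLp_grad)
  have h4 : Integrable (fun x => frob (symm (G x)) (symm (G x))
      - 2 * frob (symm (G x)) (symm (G' x))) vol := h1.sub (h2.const_mul 2)
  have hs : ∀ {τ σ : Pt → Pt}, (∀ i, MemLp (fun x => τ x i) 2 surf) →
      (∀ i, MemLp (fun x => σ x i) 2 surf) →
      Integrable (fun x => τ x 0 * σ x 0 + τ x 1 * σ x 1) surf := fun hτ hσ =>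
    ((hτ 0).integrable_mul (hσ 0)).add ((hτ 1).integrable_mul (hσ 1))
  have k1 := hs h.memLp_trace h.memLp_trace
  have k2 := hs h.memLp_trace h'.memLp_trace
  have k3 := hs h'.memLp_trace h'.memLp_trace
  have k4 : Integrable (fun x => (θ x 0 * θ x 0 + θ x 1 * θ x 1)
      - 2 * (θ x 0 * θ' x 0 + θ x 1 * θ' x 1)) surf := k1.sub (k2.const_mul 2)
  have e1 : ∫ x, frob (symm (G x - G' x)) (symm (G x - G' x)) ∂vol
      = ∫ x, frob (symm (G x)) (symm (G x)) ∂vol - 2 * ∫ x, frob (symm (G x)) (symm (G' x)) ∂vol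
        + ∫ x, frob (symm (G' x)) (symm (G' x)) ∂vol := by
    rw [← integral_const_mul, ← integral_sub h1 (h2.const_mul 2), ← integral_add h4 h3]
    congr 1
    ext x
    simp only [frob, symm, Fin.sum_univ_three, Matrix.smul_apply, Matrix.add_apply,
      Matrix.sub_apply, Matrix.transpose_apply, smul_eq_mul]
    ring
  have e2 : ∫ x, ((θ x - θ' x) 0 * (θ x - θ' x) 0 + (θ x - θ' x) 1 * (θ x - θ' x) 1) ∂surf
      = ∫ x, (θ x 0 * θ x 0 + θ x 1 * θ x 1) ∂surf
        - 2 * ∫ x, (θ x 0 * θ' x 0 + θ x 1 * θ' x 1) ∂surf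
        + ∫ x, (θ' x 0 * θ' x 0 + θ' x 1 * θ' x 1) ∂surf := by
    rw [← integral_const_mul, ← integral_sub k1 (k2.const_mul 2), ← integral_add k4 k3]
    congr 1
    ext x
    simp only [Pi.sub_apply]
    ring
  simp only [stokesForm_eq_horizontal]
  rw [e1, e2]
  ring

end InV

/-! ### The convective term -/

/-- The normal is vertical, so the boundary term drops even for test functions that do not vanish on
Γ. This supplies the hypothesis `hweak` of `integral_shear_eq_zero`. -/
lemma HasGradTrace.integral_mul_fderiv_horizontal {f : Pt → ℝ} {g : Pt → Pt} {θ : Pt → ℝ}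
    (h : HasGradTrace f g θ) {e : Pt} (he : e 2 = 0) {ψ : Pt → ℝ} (hψ : ContDiff ℝ ∞ ψ)
    (hψp : PeriodicXY ψ) :
    ∫ x, f x * fderiv ℝ ψ x e ∂vol = -∫ x, (∑ i, e i * g x i) * ψ x ∂vol := by
  have hψ2 := memLp_vol_of_continuous hψ.continuous 2
  have h1 : ∀ i, Integrable (fun x => e i * (f x * pd i ψ x)) vol := fun i =>
    (integrable_mul_vol h.memLp
      (memLp_vol_of_continuous (contDiff_pd hψ i).continuous 2)).const_mul _
  have h2 : ∀ i, Integrable (fun x => e i * (g x i * ψ x)) vol := fun i =>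
    (integrable_mul_vol (h.memLp_grad i) hψ2).const_mul _
  have hg : ∀ i, ∫ x, e i * (f x * pd i ψ x) ∂vol = -∫ x, e i * (g x i * ψ x) ∂vol := by
    intro i
    rw [integral_const_mul, integral_const_mul]
    have hgreen := h.green ψ hψ hψp i
    have hzero : e i * ∫ x, θ x * ψ x * normal x i ∂surf = 0 := by
      rw [← integral_const_mul]
      refine integral_eq_zero_of_ae (Filter.Eventually.of_forall fun x => ?_)
      fin_cases i <;> simp [normal, he]
    linear_combination (e i) * hgreen + hzero
  have e1 : ∀ x, f x * fderiv ℝ ψ x e = ∑ i, e i * (f x * pd i ψ x) := fun x => by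
    rw [fderiv_eq_sum_pd, Finset.mul_sum]
    exact Finset.sum_congr rfl fun i _ => by ring
  have e2 : ∀ x, (∑ i, e i * g x i) * ψ x = ∑ i, e i * (g x i * ψ x) := fun x => by
    rw [Finset.sum_mul]
    exact Finset.sum_congr rfl fun i _ => by ring
  simp only [e1, e2]
  rw [integral_finsetSum _ fun i _ => h1 i, integral_finsetSum _ fun i _ => h2 i,
    ← Finset.sum_neg_distrib]
  exact Finset.sum_congr rfl fun i _ => hg i

/-- Here A stands for ∇z and p for ∇F. The splitting A = 2 symm A - Aᵀ turns the part quadratic in z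
into a dissipative term and F z · ∂ₑz. The other two terms are F² e · ∂ₑz and ½|e|² z · ∇(F²). After
integration only the dissipative term remains. -/
lemma mulVec_dotProduct_shear (A : Matrix (Fin 3) (Fin 3) ℝ) (z e p : Pt) (F : ℝ)
    (h : ∑ j, e j * p j = 0) :
    (A + Matrix.of fun i j => p j * e i).mulVec (z + F • e) ⬝ᵥ (F • e)
      = (((∑ i, ∑ j, 2 * symm A i j * (F * e i) * z j) - ∑ j, (F * (z j * ∑ i, e i * A j i)))
        + ∑ i, e i * ((∑ j, e j * A i j) * (F * F)))
        + (∑ i, e i ^ 2) / 2 * ∑ j, z j * (p j * F + F * p j) := by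
  simp only [Matrix.mulVec, dotProduct, symm, Fin.sum_univ_three, Matrix.smul_apply,
    Matrix.add_apply, Matrix.transpose_apply, Matrix.of_apply, Pi.add_apply, Pi.smul_apply,
    smul_eq_mul] at h ⊢
  linear_combination (F * F * (e 0 ^ 2 + e 1 ^ 2 + e 2 ^ 2)) * h

/-- Young's inequality in each entry, weighted so that the coefficient of |symm A|² is exactly the 2
present in the dissipation. -/
lemma sum_symm_mul_le (A : Matrix (Fin 3) (Fin 3) ℝ) (v z : Pt) :
    ∑ i, ∑ j, 2 * symm A i j * v i * z j
      ≤ 2 * frob (symm A) (symm A) + (∑ i, v i ^ 2) / 2 * (z ⬝ᵥ z) := by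
  have h : 2 * frob (symm A) (symm A) + (∑ i, v i ^ 2) / 2 * (z ⬝ᵥ z)
      = ∑ i, ∑ j, (2 * symm A i j ^ 2 + (v i * z j) ^ 2 / 2) := by
    simp only [frob, dotProduct, Fin.sum_univ_three]
    ring
  rw [h]
  refine Finset.sum_le_sum fun i _ => Finset.sum_le_sum fun j _ => ?_
  nlinarith [sq_nonneg (2 * symm A i j - v i * z j)]

lemma integral_sub_add_add_eq {a b c d : Pt → ℝ} (k : ℝ) (ha : Integrable a vol)
    (hb : Integrable b vol) (hc : Integrable c vol) (hd : Integrable d vol)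
    (hb0 : ∫ x, b x ∂vol = 0) (hc0 : ∫ x, c x ∂vol = 0) (hd0 : ∫ x, d x ∂vol = 0) :
    ∫ x, (((a x - b x) + c x) + k * d x) ∂vol = ∫ x, a x ∂vol := by
  have h1 : Integrable (fun x => a x - b x) vol := ha.sub hb
  have h2 : Integrable (fun x => (a x - b x) + c x) vol := h1.add hc
  rw [integral_add h2 (hd.const_mul k), integral_add h1 hc, integral_sub ha hb,
    integral_const_mul, hb0, hc0, hd0]
  ring

/-- The estimate of the convective term by the dissipation and the energy of the difference of a
field and a shear mode. -/
lemma ShearMode.convection_le {β lam : ℝ} {F : Pt → ℝ} {e : Pt} (S : ShearMode β lam F e)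
    {w : Pt → Pt} {G : Pt → Matrix (Fin 3) (Fin 3) ℝ} {θ : Pt → Pt} (h : InV w G θ) {M : ℝ}
    (hM : ∀ x ∈ cell, ∑ i, shearField F e x i ^ 2 ≤ M) :
    convection w G (shearField F e)
      ≤ 2 * (∫ x, frob (symm (G x - grad (shearField F e) x))
          (symm (G x - grad (shearField F e) x)) ∂vol)
        + M / 2 * ip (fun x => w x - shearField F e x) (fun x => w x - shearField F e x) := by
  have hz := h.sub S.inV
  set z : Pt → Pt := fun x => w x - shearField F e x with hzdef
  set A : Pt → Matrix (Fin 3) (Fin 3) ℝ := fun x => G x - grad (shearField F e) x with hAdef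
  have hFc := S.smooth.continuous
  have hFF : ContDiff ℝ ∞ fun x => F x * F x := S.smooth.mul S.smooth
  have hFFp : PeriodicXY fun x => F x * F x := S.periodic.mul S.periodic
  have hFF2 := memLp_vol_of_continuous hFF.continuous 2
  have hpdFF : ∀ j x, pd j (fun x => F x * F x) x = pd j F x * F x + F x * pd j F x := fun j x =>
    pd_mul S.differentiable S.differentiable j x
  have hzL : ∀ j, MemLp (fun x => z x j) 2 vol := hz.inH.memLp
  have hAL : ∀ i j, MemLp (fun x => A x i j) 2 vol := hz.memLp_grad
  have hgL : ∀ i, MemLp (fun x => ∑ j, e j * A x i j) 2 vol := fun i =>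
    memLp_finsetSum _ fun j _ => (hAL i j).const_mul _
  have i1 : Integrable (fun x => ∑ i, ∑ j, 2 * symm (A x) i j * (F x * e i) * z x j) vol := by
    refine integrable_finsetSum _ fun i _ => integrable_finsetSum _ fun j _ => ?_
    have := ((memLp_symm hAL i j).integrable_mul (memLp_vol_mul hFc (hzL j))).const_mul (2 * e i)
    refine this.congr (Filter.Eventually.of_forall fun x => ?_)
    simp only [Pi.mul_apply]
    ring
  have i0 : ∀ j, Integrable (fun x => F x * (z x j * ∑ i, e i * A x j i)) vol := fun j => by
    have := (memLp_vol_mul hFc (hzL j)).integrable_mul (hgL j)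
    refine this.congr (Filter.Eventually.of_forall fun x => ?_)
    simp only [Pi.mul_apply]
    ring
  have i2 : ∀ i, Integrable (fun x => e i * ((∑ j, e j * A x i j) * (F x * F x))) vol := fun i =>
    (integrable_mul_vol (hgL i) hFF2).const_mul _
  have i3 : Integrable (fun x => ∑ j, z x j * pd j (fun x => F x * F x) x) vol :=
    integrable_finsetSum _ fun j _ => integrable_mul_vol (hzL j)
      (memLp_vol_of_continuous (contDiff_pd hFF j).continuous 2)
  -- This is half the derivative of z_j² along `e`, weighted by a function constant along `e`.
  have z0 : ∀ j, ∫ x, F x * (z x j * ∑ i, e i * A x j i) ∂vol = 0 := fun j =>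
    integral_shear_eq_zero S.horizontal hFc S.periodic S.invariant (hzL j)
      (hz.inH.periodic.comp fun a => a j) (hgL j) fun ψ hψ hψp =>
        (hz.grad_trace j).integral_mul_fderiv_horizontal S.horizontal hψ hψp
  -- F² is itself a test function with zero derivative along `e`.
  have z2 : ∀ i, ∫ x, e i * ((∑ j, e j * A x i j) * (F x * F x)) ∂vol = 0 := fun i => by
    have h1 := (hz.grad_trace i).integral_mul_fderiv_horizontal S.horizontal hFF hFFp
    have h2 : ∀ x, fderiv ℝ (fun x => F x * F x) x e = 0 := fun x => by
      rw [fderiv_eq_sum_pd]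
      simp only [hpdFF]
      have := S.sum_pd_eq_zero x
      rw [Fin.sum_univ_three] at this ⊢
      linear_combination (2 * F x) * this
    simp only [h2, mul_zero, integral_zero] at h1
    rw [integral_const_mul, neg_eq_zero.1 h1.symm, mul_zero]
  -- F² need not vanish on Γ; it is admissible because the condition z · ν = 0 is encoded in the
  -- solenoidal identity.
  have z3 : ∫ x, ∑ j, z x j * pd j (fun x => F x * F x) x ∂vol = 0 :=
    hz.inH.solenoidal _ hFF hFFp
  have hpt : ∀ x, (G x).mulVec (w x) ⬝ᵥ shearField F e x
      = (((∑ i, ∑ j, 2 * symm (A x) i j * (F x * e i) * z x j)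
        - ∑ j, (F x * (z x j * ∑ i, e i * A x j i)))
        + ∑ i, e i * ((∑ j, e j * A x i j) * (F x * F x)))
        + (∑ i, e i ^ 2) / 2 * ∑ j, z x j * pd j (fun x => F x * F x) x := by
    intro x
    have h1 := mulVec_dotProduct_shear (A x) (z x) e (fun j => pd j F x) (F x) (S.sum_pd_eq_zero x)
    simp only [hpdFF]
    rw [← h1]
    have e1 : A x + Matrix.of (fun i j => pd j F x * e i) = G x := by
      ext i j
      simp [hAdef, S.grad_apply]
    have e2 : z x + F x • e = w x := by simp [hzdef, shearField]
    rw [e1, e2]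
    rfl
  have j0 := integrable_finsetSum Finset.univ fun j _ => i0 j
  have j2 := integrable_finsetSum Finset.univ fun i _ => i2 i
  have hconv : convection w G (shearField F e)
      = ∫ x, ∑ i, ∑ j, 2 * symm (A x) i j * (F x * e i) * z x j ∂vol := by
    simp only [convection, hpt]
    refine integral_sub_add_add_eq _ i1 j0 j2 i3 ?_ ?_ z3
    · rw [integral_finsetSum _ fun j _ => i0 j, Finset.sum_eq_zero fun j _ => z0 j]
    · rw [integral_finsetSum _ fun i _ => i2 i, Finset.sum_eq_zero fun i _ => z2 i]
  have if1 := integrable_frob (memLp_symm hAL) (memLp_symm hAL)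
  have if2 := integrable_dotProduct hzL hzL
  rw [hconv, ip, ← integral_const_mul, ← integral_const_mul,
    ← integral_add (if1.const_mul 2) (if2.const_mul _)]
  refine integral_mono_ae i1 ((if1.const_mul 2).add (if2.const_mul _)) ?_
  filter_upwards [ae_vol_mem_cell] with x hx
  refine (sum_symm_mul_le (A x) (fun i => F x * e i) (z x)).trans ?_
  have h2 : 0 ≤ z x ⬝ᵥ z x := Finset.sum_nonneg fun i _ => mul_self_nonneg _
  have h1 := hM x hx
  simp only [shearField, Pi.smul_apply, smul_eq_mul] at h1
  have h3 := mul_le_mul_of_nonneg_right (div_le_div_of_nonneg_right h1 (zero_le_two (α := ℝ))) h2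
  linarith

end ChannelNS
end

/-! ### Weak-strong uniqueness of the velocity. -/

noncomputable section
namespace ChannelNS

/-! ### Uniqueness of the velocity -/

section Uniqueness

variable {β lam : ℝ} {F : Pt → ℝ} {e : Pt} {T : ℝ} {v₀ : Pt → Pt} {w : ℝ → Pt → Pt}
  {G : ℝ → Pt → Matrix (Fin 3) (Fin 3) ℝ} {θ : ℝ → Pt → Pt}

lemma IsLerayHopf.integrable_ip_self (h : IsLerayHopf β v₀ T w G θ) :
    IntegrableOn (fun t => ip (w t) (w t)) (Ioo 0 T) :=
  (integrable_dotProduct (μ := volQ T) (a := fun s => w s.1 s.2) (b := fun s => w s.1 s.2)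
    h.memLp h.memLp).integral_prod_left

lemma IsLerayHopf.integrable_ip (h : IsLerayHopf β v₀ T w G θ) (S : ShearMode β lam F e) :
    IntegrableOn (fun t => ip (w t) (shearField F e)) (Ioo 0 T) :=
  (integrable_dotProduct (μ := volQ T) (a := fun s => w s.1 s.2)
    (b := fun s => shearField F e s.2) h.memLp fun i => memLp_volQ_of_continuous
      ((S.contDiff_apply i).continuous.comp continuous_snd) 2 T).integral_prod_left

lemma IsLerayHopf.integrable_convection (h : IsLerayHopf β v₀ T w G θ)
    (S : ShearMode β lam F e) :
    IntegrableOn (fun t => convection (w t) (G t) (shearField F e)) (Ioo 0 T) := by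
  have hi : Integrable (fun s : ℝ × Pt => (G s.1 s.2).mulVec (w s.1 s.2) ⬝ᵥ shearField F e s.2)
      (volQ T) := by
    have : Integrable (fun s : ℝ × Pt => ∑ i, ∑ j,
        G s.1 s.2 i j * (shearField F e s.2 i * w s.1 s.2 j)) (volQ T) :=
      integrable_finsetSum _ fun i _ => integrable_finsetSum _ fun j _ =>
        (h.memLp_grad i j).integrable_mul
          (memLp_volQ_mul ((S.contDiff_apply i).continuous.comp continuous_snd) (h.memLp j))
    refine this.congr (Filter.Eventually.of_forall fun s => ?_)
    simp only [Matrix.mulVec, dotProduct, Finset.sum_mul]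
    exact Finset.sum_congr rfl fun i _ => Finset.sum_congr rfl fun j _ => by ring
  exact hi.integral_prod_left

lemma IsLerayHopf.integrable_stokesForm (h : IsLerayHopf β v₀ T w G θ) :
    IntegrableOn (fun t => stokesForm β (G t) (θ t) (G t) (θ t)) (Ioo 0 T) := by
  simp only [stokesForm_eq_horizontal]
  have h1 : Integrable (fun t => ∫ x, frob (symm (G t x)) (symm (G t x)) ∂vol)
      (volume.restrict (Ioo 0 T)) := by
    have hs : ∀ i j, MemLp (fun s : ℝ × Pt => symm (G s.1 s.2) i j) 2 (volQ T) :=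
      memLp_symm h.memLp_grad
    have hi : Integrable (fun s : ℝ × Pt => frob (symm (G s.1 s.2)) (symm (G s.1 s.2)))
      (volQ T) := integrable_frob hs hs
    exact hi.integral_prod_left
  have h2 : Integrable (fun s : ℝ × Pt => θ s.1 s.2 0 * θ s.1 s.2 0 + θ s.1 s.2 1 * θ s.1 s.2 1)
      (surfQ T) :=
    ((h.memLp_trace 0).integrable_mul (h.memLp_trace 0)).add
      ((h.memLp_trace 1).integrable_mul (h.memLp_trace 1))
  exact (h1.const_mul 2).add (h2.integral_prod_left.const_mul β)

lemma convection_shearField_const_mul (u : Pt → Pt) (A : Pt → Matrix (Fin 3) (Fin 3) ℝ) (c : ℝ)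
    (F : Pt → ℝ) (e : Pt) :
    convection u A (shearField (fun x => c * F x) e) = c * convection u A (shearField F e) := by
  simp only [convection, shearField, mul_smul, dotProduct_smul, smul_eq_mul, integral_const_mul]

lemma ip_shearFlow (γ : ℝ) (u : Pt → Pt) (t : ℝ) :
    ip u (shearFlow γ lam F e t) = decay γ lam t * ip u (shearField F e) := by
  rw [ip_comm, shearFlow, ip_shearField_const_mul, ip_comm]

lemma integrableOn_mul_continuous {f k : ℝ → ℝ} (hf : IntegrableOn f (Ioo 0 T))
    (hk : Continuous k) : IntegrableOn (fun t => f t * k t) (Ioo 0 T) := by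
  obtain ⟨C, hC⟩ := (isCompact_Icc (a := (0 : ℝ)) (b := T)).exists_bound_of_continuousOn
    hk.continuousOn
  refine Integrable.mul_bdd hf hk.aestronglyMeasurable (c := C) ?_
  filter_upwards [ae_restrict_mem measurableSet_Ioo] with t ht using hC t (Ioo_subset_Icc_self ht)

/-- The evolution of the scalar product of a weak solution with the shear flow. -/
lemma IsLerayHopf.ip_shearFlow_eq (S : ShearMode β lam F e) (γ : ℝ)
    (h : IsLerayHopf β (shearFlow γ lam F e 0) T w G θ) :
    ∀ᵐ t ∂((volume : Measure ℝ).restrict (Ioo 0 T)), ip (w t) (shearFlow γ lam F e t)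
      = ip (shearFlow γ lam F e 0) (shearFlow γ lam F e 0)
        - ∫ s in Ioo 0 t, (2 * lam * ip (w s) (shearFlow γ lam F e s)
          + convection (w s) (G s) (shearFlow γ lam F e s)) := by
  have hdc := continuous_decay γ lam
  have hf := h.integrable_ip S
  have hc := h.integrable_convection S
  have hconv : ∀ s, convection (w s) (G s) (shearFlow γ lam F e s)
      = decay γ lam s * convection (w s) (G s) (shearField F e) := fun s =>
    convection_shearField_const_mul _ _ _ _ _
  simp only [hconv, ip_shearFlow]
  have hf1 : IntegrableOn (fun t => decay γ lam t * ip (w t) (shearField F e)) (Ioo 0 T) :=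
    (integrableOn_mul_continuous hf hdc).congr_fun (fun t _ => mul_comm _ _) measurableSet_Ioo
  have hc1 : IntegrableOn (fun t => decay γ lam t * convection (w t) (G t) (shearField F e))
      (Ioo 0 T) :=
    (integrableOn_mul_continuous hc hdc).congr_fun (fun t _ => mul_comm _ _) measurableSet_Ioo
  have hr : IntegrableOn (fun s => 2 * lam * (decay γ lam s * ip (w s) (shearField F e))
      + decay γ lam s * convection (w s) (G s) (shearField F e)) (Ioo 0 T) :=
    (hf1.const_mul (2 * lam)).add hc1
  refine ae_eq_primitive hf1 hr fun χ hχ hχc hχs => ?_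
  have hχ0 := hχ.continuous
  have hχ1 : Continuous (deriv χ) := hχ.continuous_deriv (by simp)
  have hts : tsupport (fun t => χ t * decay γ lam t) ⊆ tsupport χ := tsupport_mul_subset_left
  -- The time-dependent test field decay(t) F e is reached with a fixed φ by putting the decay into
  -- χ.
  have hmain := h.weak _ _ _ S.inV (fun t => χ t * decay γ lam t) (hχ.mul (contDiff_decay γ lam))
    hχc.mul_right (hts.trans hχs)
  have hderiv : ∀ t, deriv (fun t => χ t * decay γ lam t) t
      = deriv χ t * decay γ lam t + χ t * (-lam * decay γ lam t) := fun t =>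
    ((hχ.differentiable (by simp) t).hasDerivAt.mul (hasDerivAt_decay γ lam t)).deriv
  have i1 : IntegrableOn (fun t => decay γ lam t * ip (w t) (shearField F e) * deriv χ t)
      (Ioo 0 T) := integrableOn_mul_continuous hf1 hχ1
  have i2 : IntegrableOn (fun t => lam * (decay γ lam t * ip (w t) (shearField F e) * χ t))
      (Ioo 0 T) := (integrableOn_mul_continuous hf1 hχ0).const_mul lam
  have i3 : IntegrableOn (fun t => (2 * lam * (decay γ lam t * ip (w t) (shearField F e))
      + decay γ lam t * convection (w t) (G t) (shearField F e)) * χ t) (Ioo 0 T) :=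
    integrableOn_mul_continuous hr hχ0
  have hl : ∫ t in Ioo 0 T, ip (w t) (shearField F e) * deriv (fun t => χ t * decay γ lam t) t
      = (∫ t in Ioo 0 T, decay γ lam t * ip (w t) (shearField F e) * deriv χ t)
        - ∫ t in Ioo 0 T, lam * (decay γ lam t * ip (w t) (shearField F e) * χ t) := by
    rw [← integral_sub i1 i2]
    refine setIntegral_congr_fun measurableSet_Ioo fun t _ => ?_
    simp only [hderiv]
    ring
  -- The form contributes one λ by the weak eigenvalue equation; differentiating the decay
  -- contributes another. Hence the factor 2λ in the evolution of (w, v).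
  have hrr : ∫ t in Ioo 0 T, (stokesForm β (G t) (θ t) (grad (shearField F e)) (shearField F e)
        + convection (w t) (G t) (shearField F e)) * (χ t * decay γ lam t)
      = (∫ t in Ioo 0 T, (2 * lam * (decay γ lam t * ip (w t) (shearField F e))
          + decay γ lam t * convection (w t) (G t) (shearField F e)) * χ t)
        - ∫ t in Ioo 0 T, lam * (decay γ lam t * ip (w t) (shearField F e) * χ t) := by
    rw [← integral_sub i3 i2]
    refine integral_congr_ae ?_
    filter_upwards [h.inV] with t ht
    rw [S.stokesForm_eq ht]
    ring
  rw [hl, hrr, ip_comm, ip_shearFlow, ip_comm] at hmain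
  rw [ip_comm, ip_shearFlow, ip_comm (shearField F e)]
  linarith

/-- Weak-strong uniqueness for the decaying shear flow. -/
theorem IsLerayHopf.ae_eq_shearFlow (hβ : 0 ≤ β) (S : ShearMode β lam F e) (γ : ℝ) (hT : 0 < T)
    (h : IsLerayHopf β (shearFlow γ lam F e 0) T w G θ) :
    ∀ᵐ s ∂(volQ T), w s.1 s.2 = shearFlow γ lam F e s.1 s.2 := by
  set v := shearFlow γ lam F e with hv
  have hzL : ∀ i, MemLp (fun s : ℝ × Pt => (w s.1 s.2 - v s.1 s.2) i) 2 (volQ T) := fun i =>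
    (h.memLp i).sub (memLp_volQ_of_continuous (S.contDiff_flow γ i).continuous 2 T)
  have hzz := integrable_dotProduct hzL hzL
  set y : ℝ → ℝ := fun t => ip (fun x => w t x - v t x) (fun x => w t x - v t x) with hy
  have hyint : IntegrableOn y (Ioo 0 T) := hzz.integral_prod_left
  have hy0 : ∀ t, 0 ≤ y t := fun t =>
    integral_nonneg fun x => Finset.sum_nonneg fun i _ => mul_self_nonneg _
  obtain ⟨M, hM⟩ := exists_bound_volQ (f := fun s => ∑ i, v s.1 s.2 i ^ 2)
    (continuous_finsetSum _ fun i _ => (S.contDiff_flow γ i).continuous.pow 2) T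
  have hM0 : 0 ≤ M := (abs_nonneg _).trans
    (hM 0 ⟨le_rfl, hT.le⟩ 0 (by
      simp only [box, mem_Icc, Pi.le_def, Fin.forall_fin_succ]
      simp [Real.pi_pos.le]))
  have hww := h.integrable_ip_self
  have hst := h.integrable_stokesForm
  have hvv : IntegrableOn (fun t => ip (v t) (v t)) (Ioo 0 T) :=
    ((continuous_ip_shearFlow_self γ lam F e).integrableOn_Icc (a := 0) (b := T)).mono_set
      Ioo_subset_Icc_self
  have hwv : IntegrableOn (fun t => ip (w t) (v t)) (Ioo 0 T) := by
    simp only [hv, ip_shearFlow]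
    exact (integrableOn_mul_continuous (h.integrable_ip S) (continuous_decay γ lam)).congr_fun
      (fun t _ => mul_comm _ _) measurableSet_Ioo
  have hcv : IntegrableOn (fun t => convection (w t) (G t) (v t)) (Ioo 0 T) := by
    have hconv : ∀ s, convection (w s) (G s) (v s)
        = decay γ lam s * convection (w s) (G s) (shearField F e) := fun s =>
      convection_shearField_const_mul _ _ _ _ _
    simp only [hconv]
    exact (integrableOn_mul_continuous (h.integrable_convection S)
      (continuous_decay γ lam)).congr_fun (fun t _ => mul_comm _ _) measurableSet_Ioo
  -- With z = w - v, the eigenvalue equation expands the Stokes form of z as that of w minus 2λ(w,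
  -- v) plus λ‖v‖². The left side is therefore convection minus the form of z. As β ≥ 0, that form
  -- is at least 2‖𝔻z‖², which absorbs the dissipative part of the convection bound.
  have hpt : ∀ᵐ t ∂((volume : Measure ℝ).restrict (Ioo 0 T)),
      2 * lam * ip (w t) (v t) + convection (w t) (G t) (v t)
        - stokesForm β (G t) (θ t) (G t) (θ t) - lam * ip (v t) (v t) ≤ M / 2 * y t := by
    filter_upwards [h.inV, ae_restrict_mem measurableSet_Ioo] with t ht htm
    have hF := S.flow γ t
    have h1 := hF.convection_le ht (M := M) fun x hx =>
      (le_abs_self _).trans (hM t (Ioo_subset_Icc_self htm) x (cell_subset_box hx))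
    have h2 := stokesForm_sub_self β ht hF.inV
    rw [hF.stokesForm_eq ht, hF.stokesForm_eq hF.inV] at h2
    have h3 : 2 * (∫ x, frob (symm (G t x - grad (v t) x)) (symm (G t x - grad (v t) x)) ∂vol)
        ≤ stokesForm β (fun x => G t x - grad (v t) x) (fun x => θ t x - v t x)
          (fun x => G t x - grad (v t) x) (fun x => θ t x - v t x) := by
      rw [stokesForm_eq_horizontal]
      have h4 : 0 ≤ ∫ x, ((θ t x - v t x) 0 * (θ t x - v t x) 0
          + (θ t x - v t x) 1 * (θ t x - v t x) 1) ∂surf :=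
        integral_nonneg fun x => add_nonneg (mul_self_nonneg _) (mul_self_nonneg _)
      have h5 := mul_nonneg hβ h4
      linarith
    have h6 := h1.trans (add_le_add_left h3 _)
    simp only [hy]
    simp only [hv, shearFlow] at h2 h6 ⊢
    linarith
  -- From ½‖z‖² = ½‖w‖² - (w, v) + ½‖v‖² and the three balances for the terms on the right; the
  -- initial contributions ½ - 1 + ½ cancel.
  have hle : ∀ᵐ t ∂((volume : Measure ℝ).restrict (Ioo 0 T)), y t ≤ M * ∫ s in Ioo 0 t, y s := by
    filter_upwards [h.inV, h.energy, h.ip_shearFlow_eq S γ, ae_restrict_mem measurableSet_Ioo]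
      with t ht hE hI htm
    have hsub : Ioo 0 t ⊆ Ioo 0 T := Ioo_subset_Ioo_right htm.2.le
    have e1 := ip_sub_self ht.inH (S.flow γ t).inV.inH
    have e2 := shearFlow_energy_eq γ lam F e htm.1.le
    have m1 := hst.mono_set hsub
    have m2 := (hvv.mono_set hsub).const_mul lam
    have m3 := (hwv.mono_set hsub).const_mul (2 * lam)
    have m4 := hcv.mono_set hsub
    have m34 : IntegrableOn (fun s => 2 * lam * ip (w s) (v s) + convection (w s) (G s) (v s))
      (Ioo 0 t) := m3.add m4
    have m341 : IntegrableOn (fun s => 2 * lam * ip (w s) (v s) + convection (w s) (G s) (v s)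
      - stokesForm β (G s) (θ s) (G s) (θ s)) (Ioo 0 t) := m34.sub m1
    have hmono := integral_mono_ae (m341.sub m2) ((hyint.mono_set hsub).const_mul (M / 2))
      (ae_restrict_of_ae_restrict_of_subset hsub hpt)
    simp only [Pi.sub_apply] at hmono
    rw [integral_sub m341 m2, integral_sub m34 m1, integral_const_mul (M / 2)] at hmono
    change y t = _ at e1
    change ip (w t) (v t) = _ at hI
    simp only [hv, shearFlow] at *
    linarith
  have hzero := integral_eq_zero_of_le_primitive hT.le hyint hy0 hM0 hle
  have hzero2 : ∫ s : ℝ × Pt, (w s.1 s.2 - v s.1 s.2) ⬝ᵥ (w s.1 s.2 - v s.1 s.2) ∂(volQ T) = 0 := by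
    rw [← hzero]
    exact integral_prod _ hzz
  have hae := (integral_eq_zero_iff_of_nonneg (fun s => Finset.sum_nonneg fun i _ =>
    mul_self_nonneg _) hzz).1 hzero2
  filter_upwards [hae] with s hs
  exact sub_eq_zero.1 (dotProduct_self_eq_zero.1 hs)

end Uniqueness

end ChannelNS
end

/-! ### The pressure: distributions with zero spatial gradient depend on time only. -/

noncomputable section
namespace ChannelNS

/-! ### Functions with vanishing distributional spatial gradient -/

/-- The function which is positive exactly on the open space-time cell `(0,T) × openCell`. -/
def gap (T : ℝ) (s : ℝ × Pt) : ℝ := min (min s.1 (T - s.1)) (cellGap s.2)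

/-- The open space-time cell. -/
def openCellQ (T : ℝ) : Set (ℝ × Pt) := Ioo 0 T ×ˢ openCell

lemma continuous_gap (T : ℝ) : Continuous (gap T) :=
  (continuous_fst.min (continuous_const.sub continuous_fst)).min
    (continuous_cellGap.comp continuous_snd)

lemma gap_pos {T : ℝ} {s : ℝ × Pt} (hs : s ∈ openCellQ T) : 0 < gap T s :=
  lt_min (lt_min hs.1.1 (sub_pos.2 hs.1.2)) (cellGap_pos hs.2)

lemma isOpen_openCellQ (T : ℝ) : IsOpen (openCellQ T) := isOpen_Ioo.prod isOpen_openCell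

lemma convex_openCell : Convex ℝ openCell := by
  intro x hx y hy a b ha hb hab
  exact ⟨(convex_Ioo _ _) hx.1 hy.1 ha hb hab, (convex_Ioo _ _) hx.2.1 hy.2.1 ha hb hab,
    (convex_Ioo _ _) hx.2.2 hy.2.2 ha hb hab⟩

lemma volQ_eq (T : ℝ) : volQ T = (volume : Measure (ℝ × Pt)).restrict (openCellQ T) := by
  rw [volQ, vol_eq_openCell, Measure.prod_restrict, openCellQ, Measure.volume_eq_prod]

/-- The derivative falls on the kernel, so integrability of `p` suffices. For spatial directions the
resulting integral is the distributional gradient tested against a translated kernel. -/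
lemma hasDerivAt_integral_mollifier {p φ : ℝ × Pt → ℝ} (hp : Integrable p) (hφ : ContDiff ℝ ∞ φ)
    (hc : HasCompactSupport φ) (z a : ℝ × Pt) (r : ℝ) :
    HasDerivAt (fun r : ℝ => ∫ s, φ (z + r • a - s) * p s)
      (∫ s, fderiv ℝ φ (z + r • a - s) a * p s) r := by
  have hD : Continuous fun s => fderiv ℝ φ s a :=
    ((hφ.fderiv_right (m := ∞) (by simp)).clm_apply contDiff_const).continuous
  have hDc : HasCompactSupport fun s => fderiv ℝ φ s a := hc.fderiv_apply ℝ a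
  obtain ⟨C, hC⟩ := hDc.exists_bound_of_continuous hD
  obtain ⟨C', hC'⟩ := hc.exists_bound_of_continuous hφ.continuous
  have hm : ∀ {k : ℝ × Pt → ℝ}, Continuous k → ∀ r : ℝ,
      AEStronglyMeasurable (fun s => k (z + r • a - s)) volume := fun hk r =>
    (hk.comp (continuous_const.sub continuous_id)).aestronglyMeasurable
  refine (hasDerivAt_integral_of_dominated_loc_of_deriv_le
    (F := fun (r : ℝ) s => φ (z + r • a - s) * p s)
    (F' := fun (r : ℝ) s => fderiv ℝ φ (z + r • a - s) a * p s)
    (bound := fun s => C * ‖p s‖) (s := univ) Filter.univ_mem ?_ ?_ ?_ ?_ ?_ ?_).2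
  · exact Filter.Eventually.of_forall fun r => (hm hφ.continuous r).mul hp.1
  · exact hp.bdd_mul (hm hφ.continuous r) (Filter.Eventually.of_forall fun s => hC' _)
  · exact (hm hD r).mul hp.1
  · refine Filter.Eventually.of_forall fun s r _ => ?_
    rw [norm_mul]
    exact mul_le_mul_of_nonneg_right (hC _) (norm_nonneg _)
  · exact hp.norm.const_mul C
  · refine Filter.Eventually.of_forall fun s r _ => ?_
    have h1 : HasDerivAt (fun r : ℝ => z + r • a - s) a r := by
      simpa using (((hasDerivAt_id r).smul_const a).const_add z).sub_const s
    exact ((hφ.differentiable (by simp) _).hasFDerivAt.comp_hasDerivAt r h1).mul_const _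

/-- A locally integrable function on the space-time cell whose distributional spatial gradient
vanishes is a function of time only. -/
lemma exists_ae_eq_of_gradient_eq_zero {T : ℝ} {q : ℝ × Pt → ℝ}
    (hq : ∀ δ > 0, IntegrableOn q {s | δ < gap T s})
    (h : ∀ ψ : ℝ × Pt → ℝ, ContDiff ℝ ∞ ψ → HasCompactSupport ψ → tsupport ψ ⊆ openCellQ T →
      ∀ a : Pt, ∫ s, fderiv ℝ ψ s (0, a) * q s = 0) :
    ∃ g : ℝ → ℝ, ∀ᵐ s : ℝ × Pt, s ∈ openCellQ T → q s = g s.1 := by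
  -- The outer radius is always twice the inner one; a bounded ratio is what convergence of the
  -- mollifications almost everywhere requires.
  let φ : ℕ → ContDiffBump (0 : ℝ × Pt) := fun k =>
    { rIn := 1 / (2 * ((k : ℝ) + 1))
      rOut := 1 / ((k : ℝ) + 1)
      rIn_pos := by positivity
      rIn_lt_rOut := one_div_lt_one_div_of_lt (by positivity)
        (by have : (0 : ℝ) ≤ k := Nat.cast_nonneg k
            linarith) }
  set N : ℕ → ℝ × Pt → ℝ := fun k => (φ k).normed volume with hN
  have hNs : ∀ k, ContDiff ℝ ∞ (N k) := fun k => (φ k).contDiff_normed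
  have hNc : ∀ k, HasCompactSupport (N k) := fun k => (φ k).hasCompactSupport_normed
  have hNsupp : ∀ k s, s ∈ tsupport (N k) → ‖s‖ ≤ 1 / ((k : ℝ) + 1) := fun k s hs => by
    rw [hN, (φ k).tsupport_normed_eq, mem_closedBall_zero_iff] at hs
    exact hs
  have hrOut : Filter.Tendsto (fun k : ℕ => (φ k).rOut) Filter.atTop (nhds 0) :=
    tendsto_one_div_add_atTop_nhds_zero_nat
  -- q need not be integrable up to the boundary of the cell. The truncations are, and their
  -- mollifications all converge outside one common null set.
  set p : ℕ → ℝ × Pt → ℝ := fun n => {s | 1 / ((n : ℝ) + 1) < gap T s}.indicator q with hpdef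
  have hmeas : ∀ n : ℕ, MeasurableSet {s | 1 / ((n : ℝ) + 1) < gap T s} := fun n =>
    measurableSet_lt measurable_const (continuous_gap T).measurable
  have hp : ∀ n, Integrable (p n) := fun n =>
    (integrable_indicator_iff (hmeas n)).2 (hq _ (by positivity))
  have hconv : ∀ n, ∀ᵐ s₀ : ℝ × Pt, Filter.Tendsto
      (fun k => ∫ s, N k (s₀ - s) * p n s) Filter.atTop (nhds (p n s₀)) := by
    intro n
    have : (volume : Measure (ℝ × Pt)).IsAddHaarMeasure := by
      rw [Measure.volume_eq_prod]
      infer_instance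
    have := ContDiffBump.ae_convolution_tendsto_right_of_locallyIntegrable (μ := volume) (K := 2)
      (φ := φ) (l := Filter.atTop) hrOut (Filter.Eventually.of_forall fun k => le_of_eq (by
        change 1 / ((k : ℝ) + 1) = 2 * (1 / (2 * ((k : ℝ) + 1)))
        have : (k : ℝ) + 1 ≠ 0 := by positivity
        field_simp)) (hp n).locallyIntegrable
    simpa only [hN, MeasureTheory.convolution_eq_swap, ContinuousLinearMap.lsmul_apply, smul_eq_mul] using this
  set c : Pt := ![Real.pi, Real.pi, 0] with hcdef
  have hcmem : c ∈ openCell := by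
    have := Real.pi_pos
    refine ⟨⟨?_, ?_⟩, ⟨?_, ?_⟩, ?_, ?_⟩ <;> simp [hcdef] <;> linarith
  -- The candidate is the limit of mollifications of q at the centre of the cell. Convergence at (t,
  -- c) is not known beforehand but inherited from a good point s₀ at the same time; at times
  -- without such a point the default value of `limUnder` is harmless.
  refine ⟨fun t => Filter.limUnder Filter.atTop fun k => ∫ s, N k ((t, c) - s) * q s, ?_⟩
  filter_upwards [ae_all_iff.2 hconv] with s₀ hs₀ hmem
  set a : Pt := c - s₀.2 with ha
  -- The segment at fixed time from s₀ to the centre stays in the cell by convexity. So does a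
  -- compact tube around it, on which a single truncation coincides with q.
  set K : Set (ℝ × Pt) := (fun r : ℝ => s₀ + r • ((0 : ℝ), a)) '' Icc 0 1 with hK
  have hKc : IsCompact K := isCompact_Icc.image (by fun_prop)
  have hKU : K ⊆ openCellQ T := by
    rintro _ ⟨r, hr, rfl⟩
    refine ⟨by simpa using hmem.1, ?_⟩
    have := convex_openCell.add_smul_sub_mem hmem.2 hcmem hr
    simpa [ha] using this
  obtain ⟨ρ, hρ, hρU⟩ := hKc.exists_cthickening_subset_open (isOpen_openCellQ T) hKU
  obtain ⟨η, hη, hηK⟩ := (hKc.cthickening (r := ρ)).exists_forall_le'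
    (continuous_gap T).continuousOn (a := 0) fun s hs => gap_pos (hρU hs)
  obtain ⟨n, hn⟩ := exists_nat_one_div_lt hη
  have hpq : ∀ s ∈ Metric.cthickening ρ K, p n s = q s := fun s hs =>
    indicator_of_mem (show s ∈ {s | 1 / ((n : ℝ) + 1) < gap T s} from hn.trans_le (hηK s hs)) q
  have hsupp : ∀ k : ℕ, 1 / ((k : ℝ) + 1) < ρ → ∀ z ∈ K, ∀ s, z - s ∈ tsupport (N k) →
      s ∈ Metric.cthickening ρ K := by
    intro k hk z hz s hs
    refine Metric.mem_cthickening_of_dist_le s z ρ K hz ?_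
    rw [dist_comm, dist_eq_norm]
    exact (hNsupp k _ hs).trans hk.le
  have hend : ∀ k : ℕ, 1 / ((k : ℝ) + 1) < ρ → ∀ z ∈ K,
      ∫ s, N k (z - s) * p n s = ∫ s, N k (z - s) * q s := by
    intro k hk z hz
    congr 1
    ext s
    by_cases hs : N k (z - s) = 0
    · rw [hs, zero_mul, zero_mul]
    · rw [hpq s (hsupp k hk z hz s (subset_tsupport _ hs))]
  -- As a function of s, the reflected and translated kernel is a test function supported in the
  -- tube; the reflection only changes the sign of its derivative.
  have hderiv : ∀ k : ℕ, 1 / ((k : ℝ) + 1) < ρ → ∀ z ∈ K,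
      ∫ s, fderiv ℝ (N k) (z - s) (0, a) * p n s = 0 := by
    intro k hk z hz
    set ψ : ℝ × Pt → ℝ := fun s => N k (z - s) with hψ
    have hψs : ContDiff ℝ ∞ ψ := (hNs k).comp (contDiff_const.sub contDiff_id)
    have hts : tsupport ψ ⊆ (fun s => z - s) ⁻¹' tsupport (N k) :=
      closure_minimal (fun s hs => subset_tsupport (N k) hs)
        ((isClosed_tsupport _).preimage (continuous_const.sub continuous_id))
    have hsub : tsupport ψ ⊆ Metric.cthickening ρ K := fun s hs => hsupp k hk z hz s (hts hs)
    have hψc : HasCompactSupport ψ :=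
      (hKc.cthickening (r := ρ)).of_isClosed_subset (isClosed_tsupport _) hsub
    have hfd : ∀ s, fderiv ℝ ψ s (0, a) = -fderiv ℝ (N k) (z - s) (0, a) := by
      intro s
      have h1 : HasFDerivAt (fun s : ℝ × Pt => z - s) (-ContinuousLinearMap.id ℝ (ℝ × Pt)) s :=
        (hasFDerivAt_id s).const_sub z
      have h2 := ((hNs k).differentiable (by simp) (z - s)).hasFDerivAt.comp s h1
      have h3 : fderiv ℝ ψ s = _ := h2.fderiv
      rw [h3]
      simp
    have hzero := h ψ hψs hψc (hsub.trans hρU) a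
    have hneg : ∫ s, fderiv ℝ (N k) (z - s) (0, a) * p n s
        = -∫ s, fderiv ℝ ψ s (0, a) * q s := by
      rw [← integral_neg]
      congr 1
      ext s
      rw [← neg_mul, hfd, neg_neg]
      by_cases hs : s ∈ tsupport ψ
      · rw [hpq s (hsub hs)]
      · have h0 : fderiv ℝ ψ s = 0 := by
          by_contra hne
          exact hs (support_fderiv_subset ℝ hne)
        have h1 := hfd s
        rw [h0, zero_apply, zero_eq_neg] at h1
        rw [h1, zero_mul, zero_mul]
    rw [hneg, hzero, neg_zero]
  have hs₀K : s₀ ∈ K := ⟨0, by simp, by simp⟩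
  have hcK : (s₀.1, c) ∈ K := ⟨1, by simp, by ext <;> simp [ha]⟩
  have hconst : ∀ k : ℕ, 1 / ((k : ℝ) + 1) < ρ →
      ∫ s, N k (s₀ - s) * p n s = ∫ s, N k ((s₀.1, c) - s) * q s := by
    intro k hk
    rw [← hend k hk _ hcK]
    have hd := fun r => hasDerivAt_integral_mollifier (hp n) (hNs k) (hNc k) s₀ ((0 : ℝ), a) r
    have hle := Convex.norm_image_sub_le_of_norm_hasDerivWithin_le (s := Icc (0 : ℝ) 1) (C := 0)
      (f := fun r : ℝ => ∫ s, N k (s₀ + r • ((0 : ℝ), a) - s) * p n s) (x := 0) (y := 1)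
      (fun r _ => (hd r).hasDerivWithinAt)
      (fun r hr => by rw [hderiv k hk _ ⟨r, hr, rfl⟩, norm_zero]) (convex_Icc 0 1)
      (by simp) (by simp)
    rw [zero_mul, norm_le_zero_iff, sub_eq_zero] at hle
    have e1 : s₀ + (1 : ℝ) • ((0 : ℝ), a) = (s₀.1, c) := by ext <;> simp [ha]
    have e0 : s₀ + (0 : ℝ) • ((0 : ℝ), a) = s₀ := by simp
    simp only [e1, e0] at hle
    exact hle.symm
  have hpn : p n s₀ = q s₀ := hpq s₀ (Metric.self_subset_cthickening K hs₀K)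
  have hlim := hs₀ n
  rw [hpn] at hlim
  refine (Filter.Tendsto.limUnder_eq (hlim.congr' ?_)).symm
  filter_upwards [hrOut.eventually_lt_const hρ] with k hk using hconst k hk

/-! ### The pressure -/

section Pressure

variable {β lam : ℝ} {F : Pt → ℝ} {e : Pt} {T : ℝ} {v₀ : Pt → Pt} {w : ℝ → Pt → Pt}
  {G : ℝ → Pt → Matrix (Fin 3) (Fin 3) ℝ} {θ : ℝ → Pt → Pt}

lemma HasGradTrace.grad_ae_eq_zero {f : Pt → ℝ} {g : Pt → Pt} {τ : Pt → ℝ}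
    (h : HasGradTrace f g τ) (hf : ∀ᵐ x ∂vol, f x = 0) (j : Fin 3) : ∀ᵐ x ∂vol, g x j = 0 := by
  refine ae_eq_zero_of_forall_test ((h.memLp_grad j).integrable (by norm_num))
    fun ψ hψ hψp ⟨δ, hδ, hvan⟩ => ?_
  have h1 := h.green ψ hψ hψp j
  have h2 : ∫ x, f x * pd j ψ x ∂vol = 0 :=
    integral_eq_zero_of_ae (by filter_upwards [hf] with x hx; simp [hx])
  rw [h2, add_zero, integral_surf_eq_zero fun x hx => by
    rw [hvan x (by have := one_le_abs_of_mem_wall hx; linarith)]; ring] at h1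
  rw [← h1]
  congr 1
  ext x
  ring

/-- Weak gradients are unique on almost every time slice. Fubini for the integral of the squared
difference, a jointly measurable function, turns this into a statement almost everywhere on Q_T. -/
lemma IsLerayHopf.grad_ae_eq (S : ShearMode β lam F e) (γ : ℝ)
    (h : IsLerayHopf β v₀ T w G θ)
    (hw : ∀ᵐ s ∂(volQ T), w s.1 s.2 = shearFlow γ lam F e s.1 s.2) :
    ∀ᵐ s ∂(volQ T), G s.1 s.2 = grad (shearFlow γ lam F e s.1) s.2 := by
  have hij : ∀ i j, ∀ᵐ s ∂(volQ T),
      G s.1 s.2 i j - grad (shearFlow γ lam F e s.1) s.2 i j = 0 := by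
    intro i j
    have hL : MemLp (fun s : ℝ × Pt => G s.1 s.2 i j - grad (shearFlow γ lam F e s.1) s.2 i j) 2
        (volQ T) := (h.memLp_grad i j).sub
      (memLp_volQ_of_continuous (S.continuous_grad_flow γ i j) 2 T)
    have hsq : Integrable (fun s : ℝ × Pt =>
        (G s.1 s.2 i j - grad (shearFlow γ lam F e s.1) s.2 i j)
          * (G s.1 s.2 i j - grad (shearFlow γ lam F e s.1) s.2 i j)) (volQ T) :=
      hL.integrable_mul hL
    have hzero : ∫ s : ℝ × Pt, (G s.1 s.2 i j - grad (shearFlow γ lam F e s.1) s.2 i j)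
          * (G s.1 s.2 i j - grad (shearFlow γ lam F e s.1) s.2 i j) ∂(volQ T) = 0 := by
      refine (integral_prod _ hsq).trans (integral_eq_zero_of_ae ?_)
      filter_upwards [h.inV, Measure.ae_ae_of_ae_prod hw] with t ht hwt
      refine integral_eq_zero_of_ae ?_
      have h1 := (ht.sub (S.flow γ t).inV).grad_trace i
      filter_upwards [h1.grad_ae_eq_zero (by
        filter_upwards [hwt] with x hx
        simp [hx, shearFlow]) j] with x hx
      have h2 : G t x i j - grad (shearFlow γ lam F e t) x i j = 0 := hx
      simp [h2]
    filter_upwards [(integral_eq_zero_iff_of_nonneg (fun s => mul_self_nonneg _) hsq).1 hzero]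
      with s hs using mul_self_eq_zero.1 hs
  filter_upwards [ae_all_iff.2 fun i => ae_all_iff.2 fun j => hij i j] with s hs
  ext i j
  exact sub_eq_zero.1 (hs i j)

/-- q is integrable only away from t = 0, t = T and Γ, where the derivatives of φ vanish. Halving δ
ensures that outside the smaller set φ is zero on a whole spatial neighbourhood. -/
lemma IsPressure.integrable_mul_dx {q : ℝ → Pt → ℝ} (hq : IsPressure T w G q)
    {φ : ℝ × Pt → ℝ} (hφ : IsTest T φ) (j : Fin 3) :
    Integrable (fun s : ℝ × Pt => q s.1 s.2 * dx j φ s) (volQ T) := by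
  obtain ⟨δ, hδ, hvan⟩ := hφ.vanish
  have hzero : ∀ s : ℝ × Pt, s ∉ {s : ℝ × Pt | s.1 ∈ Ioo (δ / 2) (T - δ / 2) ∧ |s.2 2| < 1 - δ / 2} →
      dx j φ s = 0 := by
    rintro ⟨t, x⟩ hs
    have e : dx j φ (t, x) = pd j (fun y => φ (t, y)) x := (congrFun (pd_slice hφ.smooth t j) x).symm
    rw [e]
    by_cases ht : t ≤ δ ∨ T - δ ≤ t
    · have : (fun y => φ (t, y)) = fun _ => 0 := by
        ext y
        rcases ht with ht | ht
        · exact hvan t y (Or.inl ht)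
        · exact hvan t y (Or.inr (Or.inl ht))
      rw [this, pd_const]
    · push Not at ht
      have hx : 1 - δ / 2 ≤ |x 2| := by
        by_contra hx
        exact hs ⟨⟨by linarith, by linarith⟩, not_le.1 hx⟩
      have hc : Continuous fun y : Pt => |y 2| := by fun_prop
      have hev : (fun y => φ (t, y)) =ᶠ[nhds x] fun _ => 0 := by
        filter_upwards [hc.continuousAt.eventually_const_lt (show 1 - δ < |x 2| by linarith)]
          with y hy using hvan t y (Or.inr (Or.inr hy.le))
      rw [pd, hev.fderiv_eq]
      simp
  have hc := (contDiff_dx hφ.smooth j).continuous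
  obtain ⟨C, hC⟩ := exists_bound_volQ hc T
  have hon : IntegrableOn (fun s : ℝ × Pt => q s.1 s.2 * dx j φ s)
      {s | s.1 ∈ Ioo (δ / 2) (T - δ / 2) ∧ |s.2 2| < 1 - δ / 2} (volQ T) := by
    refine Integrable.mul_bdd (hq.integrable _ (half_pos hδ)) hc.aestronglyMeasurable (c := C) ?_
    filter_upwards [ae_restrict_of_ae (ae_volQ_mem T)] with s hs
    exact hC _ (Ioo_subset_Icc_self hs.1) _ (cell_subset_box hs.2)
  exact hon.integrable_of_forall_notMem_eq_zero fun s hs => by rw [hzero s hs, mul_zero]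

/-- The pressure of a weak solution which coincides with the shear flow has a vanishing gradient. -/
lemma IsPressure.integral_mul_dx_eq_zero (S : ShearMode β lam F e) (γ : ℝ) (hT : 0 < T)
    (hw : ∀ᵐ s ∂(volQ T), w s.1 s.2 = shearFlow γ lam F e s.1 s.2)
    (hG : ∀ᵐ s ∂(volQ T), G s.1 s.2 = grad (shearFlow γ lam F e s.1) s.2)
    {q : ℝ → Pt → ℝ} (hq : IsPressure T w G q) {φ : ℝ × Pt → ℝ} (hφ : IsTest T φ) (j : Fin 3) :
    ∫ s, q s.1 s.2 * dx j φ s ∂(volQ T) = 0 := by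
  -- A test field with one nonzero component has divergence ∂ⱼφ and isolates one component of the
  -- pressure gradient. The velocity terms are those of the shear flow and integrate to zero.
  set Φ : ℝ → Pt → Pt := fun t x => φ (t, x) • (Pi.single j 1 : Pt) with hΦ
  have h1 : ContDiff ℝ ∞ fun s : ℝ × Pt => Φ s.1 s.2 := hφ.smooth.smul contDiff_const
  have h2 : ∀ t, PeriodicXY (Φ t) := fun t => (hφ.periodic t).comp fun r => r • (Pi.single j 1 : Pt)
  have h3 : ∃ δ : ℝ, 0 < δ ∧ ∀ t x, t ≤ δ ∨ T - δ ≤ t ∨ 1 - δ ≤ |x 2| → Φ t x = 0 := by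
    obtain ⟨δ, hδ, hvan⟩ := hφ.vanish
    exact ⟨δ, hδ, fun t x htx => by simp [hΦ, hvan t x htx]⟩
  have hdvg : ∀ s : ℝ × Pt, dvg (Φ s.1) s.2 = dx j φ s := by
    intro s
    have hd : Differentiable ℝ fun y => φ (s.1, y) :=
      (contDiff_slice hφ.smooth s.1).differentiable (by simp)
    have : ∀ i, pd i (fun y => Φ s.1 y i) s.2 = dx i φ s * (Pi.single j 1 : Pt) i := fun i => by
      have h := pd_mul_const hd ((Pi.single j 1 : Pt) i) i s.2
      rw [pd_slice hφ.smooth] at h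
      exact h
    simp only [dvg, this]
    rw [Finset.sum_eq_single j (fun i _ hi => by simp [hi]) (by simp)]
    simp
  obtain ⟨hint, hzero⟩ := S.momentum_integrand γ hT (IsTest.of_field h1 h2 h3)
  have hmom := hq.momentum Φ h1 h2 h3
  simp only [hdvg] at hmom
  have hsub := integral_sub hint (hq.integrable_mul_dx hφ j)
  rw [hzero, zero_sub] at hsub
  rw [← neg_eq_zero, ← hsub, ← hmom]
  refine integral_congr_ae ?_
  filter_upwards [hw, hG] with s hs1 hs2
  rw [hs1, hs2]

/-- This links the compactly supported tests of the mollification argument with the periodic ones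
allowed by `IsPressure`. Periodization acts in the horizontal variables only. -/
lemma exists_isTest_eq {ψ : ℝ × Pt → ℝ} (hψ : ContDiff ℝ ∞ ψ) (hc : HasCompactSupport ψ)
    (hsupp : tsupport ψ ⊆ openCellQ T) :
    ∃ φ, IsTest T φ ∧ ∀ s ∈ openCellQ T, φ s = ψ s := by
  obtain ⟨δ, hδ, hδK⟩ := hc.isCompact.exists_forall_le' (continuous_gap T).continuousOn (a := 0)
    fun s hs => gap_pos (hsupp hs)
  have hne : ∀ s, ψ s ≠ 0 → (δ ≤ s.1 ∧ s.1 ≤ T - δ) ∧ δ ≤ cellGap s.2 := fun s hs => by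
    have := hδK s (subset_tsupport _ hs)
    simp only [gap, le_min_iff] at this
    exact ⟨⟨this.1.1, by linarith⟩, this.2⟩
  obtain ⟨Ψ, hΨ, hper, heq, hval⟩ := exists_periodization
    (ℓ₀ := (ContinuousLinearMap.proj (R := ℝ) (φ := fun _ : Fin 3 => ℝ) 0).comp
      (ContinuousLinearMap.snd ℝ ℝ Pt))
    (ℓ₁ := (ContinuousLinearMap.proj (R := ℝ) (φ := fun _ : Fin 3 => ℝ) 1).comp
      (ContinuousLinearMap.snd ℝ ℝ Pt)) (L := 2 * Real.pi) two_pi_pos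
    (a₀ := ((0 : ℝ), (Pi.single 0 (2 * Real.pi) : Pt)))
    (a₁ := ((0 : ℝ), (Pi.single 1 (2 * Real.pi) : Pt))) (by simp) (by simp)
    (by simp) (by simp) hψ hδ (fun s hs => (le_cellGap_iff.1 (hne s hs).2).1)
  refine ⟨Ψ, ⟨hΨ, fun t x => ?_, δ / 2, half_pos hδ, fun t x htx => ?_⟩, fun s hs => ?_⟩
  · have := hper (t, x)
    simpa using this
  · obtain ⟨j, k, hjk⟩ := hval (t, x)
    by_contra h0
    rw [hjk] at h0
    obtain ⟨h1, h2⟩ := hne _ h0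
    have h3 := (le_cellGap_iff.1 h2).2
    simp at h1 h3
    rcases htx with h | h | h <;> linarith
  · exact heq s (Ioo_subset_Ico_self hs.2.1) (Ioo_subset_Ico_self hs.2.2.1)

/-- The pressure of a weak solution which coincides with the shear flow depends on time only. -/
theorem IsPressure.exists_ae_eq (S : ShearMode β lam F e) (γ : ℝ) (hT : 0 < T)
    (hw : ∀ᵐ s ∂(volQ T), w s.1 s.2 = shearFlow γ lam F e s.1 s.2)
    (hG : ∀ᵐ s ∂(volQ T), G s.1 s.2 = grad (shearFlow γ lam F e s.1) s.2)
    {q : ℝ → Pt → ℝ} (hq : IsPressure T w G q) :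
    ∃ g : ℝ → ℝ, ∀ᵐ s ∂(volQ T), q s.1 s.2 = g s.1 := by
  rw [volQ_eq]
  simp only [ae_restrict_iff' (isOpen_openCellQ T).measurableSet]
  refine exists_ae_eq_of_gradient_eq_zero (q := fun s => q s.1 s.2) ?_ ?_
  · intro δ hδ
    have hsub : {s | δ < gap T s} ⊆ {s : ℝ × Pt | s.1 ∈ Ioo δ (T - δ) ∧ |s.2 2| < 1 - δ} := by
      intro s hs
      simp only [gap, cellGap, mem_ofPred_eq, lt_min_iff] at hs ⊢
      exact ⟨⟨hs.1.1, by linarith [hs.1.2]⟩, by linarith [hs.2.2]⟩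
    have hsub2 : {s | δ < gap T s} ⊆ openCellQ T := by
      intro s hs
      simp only [gap, cellGap, mem_ofPred_eq, lt_min_iff] at hs
      obtain ⟨⟨h1, h2⟩, ⟨⟨h3, h4⟩, h5, h6⟩, h7⟩ := hs
      have h8 := abs_lt.1 (show |s.2 2| < 1 by linarith)
      exact ⟨⟨by linarith, by linarith⟩, ⟨by linarith, by linarith⟩, ⟨by linarith, by linarith⟩, h8⟩
    have h1 := (hq.integrable δ hδ).mono_set hsub
    rwa [volQ_eq, IntegrableOn, Measure.restrict_restrict_of_subset hsub2] at h1
  · intro ψ hψ hc hsupp a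
    obtain ⟨φ, hφ, hφψ⟩ := exists_isTest_eq hψ hc hsupp
    have hfd : ∀ s ∈ openCellQ T, fderiv ℝ ψ s = fderiv ℝ φ s := fun s hs => by
      refine Filter.EventuallyEq.fderiv_eq ?_
      filter_upwards [(isOpen_openCellQ T).mem_nhds hs] with r hr using (hφψ r hr).symm
    have hi : ∀ j, Integrable (fun s => a j * (q s.1 s.2 * dx j φ s)) (volQ T) := fun j =>
      (hq.integrable_mul_dx hφ j).const_mul (a j)
    have hsum : ∫ s, ∑ j, a j * (q s.1 s.2 * dx j φ s) ∂(volQ T) = 0 := by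
      rw [integral_finsetSum _ fun j _ => hi j]
      refine Finset.sum_eq_zero fun j _ => ?_
      rw [integral_const_mul, hq.integral_mul_dx_eq_zero S γ hT hw hG hφ j, mul_zero]
    refine Eq.trans ?_ hsum
    rw [volQ_eq, ← setIntegral_eq_integral_of_forall_compl_eq_zero (s := openCellQ T)]
    · refine setIntegral_congr_fun (isOpen_openCellQ T).measurableSet fun s hs => ?_
      have e1 : fderiv ℝ φ s ((0 : ℝ), a) = ∑ j, a j * dx j φ s := by
        have h1 := fderiv_eq_sum_pd (fun y => φ (s.1, y)) s.2 a
        have h2 : fderiv ℝ (fun y => φ (s.1, y)) s.2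
            = (fderiv ℝ φ s).comp (ContinuousLinearMap.inr ℝ ℝ Pt) :=
          ((hφ.smooth.differentiable (by simp) s).hasFDerivAt.comp s.2
            (hasFDerivAt_prodMk_right s.1 s.2)).fderiv
        rw [h2] at h1
        simp only [pd_slice hφ.smooth] at h1
        simpa using h1
      simp only [hfd s hs, e1, Finset.sum_mul]
      exact Finset.sum_congr rfl fun j _ => by ring
    · intro s hs
      have : fderiv ℝ ψ s = 0 := by
        by_contra hne
        exact hs (hsupp (support_fderiv_subset ℝ hne))
      simp [this]

end Pressure

end ChannelNS
end

/-! ### Identification of the eigenfunctions with shear modes. -/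

noncomputable section
namespace ChannelNS

/-! ### The eigenfunctions as shear modes -/

/-- The product of a vertical profile and a horizontal plane wave. -/
def wave (Z Q : ℝ → ℝ) (c₀ c₁ : ℝ) (x : Pt) : ℝ := Z (x 2) * Q (c₀ * x 0 + c₁ * x 1)

lemma contDiff_wave {Z Q : ℝ → ℝ} (hZ : ContDiff ℝ ∞ Z) (hQ : ContDiff ℝ ∞ Q) (c₀ c₁ : ℝ) :
    ContDiff ℝ ∞ (wave Z Q c₀ c₁) := by
  have h : ∀ i : Fin 3, ContDiff ℝ ∞ fun x : Pt => x i := fun i => contDiff_apply ℝ ℝ i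
  exact (hZ.comp (h 2)).mul (hQ.comp ((contDiff_const.mul (h 0)).add (contDiff_const.mul (h 1))))

lemma pd_eq_of_hasDerivAt {f : Pt → ℝ} (hf : Differentiable ℝ f) {i : Fin 3} {x : Pt} {d : ℝ}
    (h : HasDerivAt (fun r : ℝ => f (x + r • Pi.single i 1)) d 0) : pd i f x = d := by
  have h1 : HasDerivAt (fun r : ℝ => x + r • (Pi.single i 1 : Pt)) (Pi.single i 1) 0 := by
    simpa using ((hasDerivAt_id (0 : ℝ)).smul_const (Pi.single i 1 : Pt)).const_add x
  have h2 : HasFDerivAt f (fderiv ℝ f x) (x + (0 : ℝ) • (Pi.single i 1 : Pt)) := by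
    simpa using (hf x).hasFDerivAt
  exact (h2.comp_hasDerivAt (0 : ℝ) h1).unique h

section Wave

variable {Z Z' Q Q' : ℝ → ℝ} {c₀ c₁ : ℝ}

lemma pd_zero_wave (hZ : ContDiff ℝ ∞ Z) (hQ : ContDiff ℝ ∞ Q)
    (hQ' : ∀ t, HasDerivAt Q (Q' t) t) :
    pd 0 (wave Z Q c₀ c₁) = fun x => wave Z Q' c₀ c₁ x * c₀ := by
  ext x
  refine pd_eq_of_hasDerivAt ((contDiff_wave hZ hQ c₀ c₁).differentiable (by simp)) ?_
  have h1 : HasDerivAt (fun r : ℝ => c₀ * (x 0 + r) + c₁ * x 1) c₀ 0 := by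
    simpa using (((hasDerivAt_id (0 : ℝ)).const_add (x 0)).const_mul c₀).add_const (c₁ * x 1)
  have h2 := ((hQ' _).comp (0 : ℝ) h1).const_mul (Z (x 2))
  simpa [wave, Function.comp_def, mul_assoc] using h2

lemma pd_one_wave (hZ : ContDiff ℝ ∞ Z) (hQ : ContDiff ℝ ∞ Q)
    (hQ' : ∀ t, HasDerivAt Q (Q' t) t) :
    pd 1 (wave Z Q c₀ c₁) = fun x => wave Z Q' c₀ c₁ x * c₁ := by
  ext x
  refine pd_eq_of_hasDerivAt ((contDiff_wave hZ hQ c₀ c₁).differentiable (by simp)) ?_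
  have h1 : HasDerivAt (fun r : ℝ => c₀ * x 0 + c₁ * (x 1 + r)) c₁ 0 := by
    simpa using (((hasDerivAt_id (0 : ℝ)).const_add (x 1)).const_mul c₁).const_add (c₀ * x 0)
  have h2 := ((hQ' _).comp (0 : ℝ) h1).const_mul (Z (x 2))
  simpa [wave, Function.comp_def, mul_assoc] using h2

lemma pd_two_wave (hZ : ContDiff ℝ ∞ Z) (hQ : ContDiff ℝ ∞ Q)
    (hZ' : ∀ t, HasDerivAt Z (Z' t) t) :
    pd 2 (wave Z Q c₀ c₁) = wave Z' Q c₀ c₁ := by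
  ext x
  refine pd_eq_of_hasDerivAt ((contDiff_wave hZ hQ c₀ c₁).differentiable (by simp)) ?_
  have h1 : HasDerivAt (fun r : ℝ => x 2 + r) 1 0 := (hasDerivAt_id (0 : ℝ)).const_add (x 2)
  have h2 := ((hZ' _).comp (0 : ℝ) h1).mul_const (Q (c₀ * x 0 + c₁ * x 1))
  simpa [wave, Function.comp_def] using h2

/-- Separation of variables: the horizontal phase contributes c₀² + c₁² to the eigenvalue and the
profile contributes κ. Orthogonality of `e` to the wave vector makes the wave constant along `e`,
and the Robin conditions at z = ±1 are the friction condition. -/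
lemma shearMode_wave {β lam κ : ℝ} {e : Pt} (hZ : ContDiff ℝ ∞ Z) (hZs : ContDiff ℝ ∞ Z')
    (hQ : ContDiff ℝ ∞ Q) (hQs : ContDiff ℝ ∞ Q')
    (hZ1 : ∀ t, HasDerivAt Z (Z' t) t) (hZ2 : ∀ t, HasDerivAt Z' (-κ * Z t) t)
    (hQ1 : ∀ t, HasDerivAt Q (Q' t) t) (hQ2 : ∀ t, HasDerivAt Q' (-Q t) t)
    (hQ₀ : ∀ t, Q (t + c₀ * (2 * Real.pi)) = Q t) (hQ₁ : ∀ t, Q (t + c₁ * (2 * Real.pi)) = Q t)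
    (hlam : lam = c₀ ^ 2 + c₁ ^ 2 + κ) (he : c₀ * e 0 + c₁ * e 1 = 0) (he2 : e 2 = 0)
    (htop : Z' 1 + β * Z 1 = 0) (hbot : -Z' (-1) + β * Z (-1) = 0) :
    ShearMode β lam (wave Z Q c₀ c₁) e where
  smooth := contDiff_wave hZ hQ c₀ c₁
  periodic x := by
    constructor
    · rw [wave, wave, ← hQ₀ (c₀ * x 0 + c₁ * x 1)]
      simp
      left
      congr 1
      ring
    · rw [wave, wave, ← hQ₁ (c₀ * x 0 + c₁ * x 1)]
      simp
      left
      congr 1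
      ring
  lap_eq x := by
    have hd := (contDiff_wave hZ hQs c₀ c₁).differentiable (by simp)
    have hQneg : ContDiff ℝ ∞ fun t => -Q t := hQ.neg
    rw [lap, Fin.sum_univ_three, pd_zero_wave hZ hQ hQ1, pd_one_wave hZ hQ hQ1,
      pd_two_wave hZ hQ hZ1, pd_mul_const hd, pd_mul_const hd, pd_zero_wave hZ hQs hQ2,
      pd_one_wave hZ hQs hQ2, pd_two_wave hZs hQ hZ2, hlam]
    simp only [wave]
    ring
  invariant x s := by
    have : c₀ * (x + s • e) 0 + c₁ * (x + s • e) 1 = c₀ * x 0 + c₁ * x 1 := by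
      simp only [Pi.add_apply, Pi.smul_apply, smul_eq_mul]
      linear_combination s * he
    rw [wave, wave, this]
    simp [he2]
  horizontal := he2
  friction x hx := by
    rw [pd_two_wave hZ hQ hZ1]
    simp only [wave]
    rcases hx with h | h
    · rw [h]
      linear_combination (Q (c₀ * x 0 + c₁ * x 1)) * htop
    · rw [h]
      linear_combination (Q (c₀ * x 0 + c₁ * x 1)) * hbot

end Wave

/-- The horizontal profile of the eigenfunctions with aligned coefficients. -/
def plane (A B t : ℝ) : ℝ := A * Real.sin t + B * Real.cos t

lemma contDiff_plane (A B : ℝ) : ContDiff ℝ ∞ (plane A B) := by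
  unfold plane
  exact (contDiff_const.mul Real.contDiff_sin).add (contDiff_const.mul Real.contDiff_cos)

lemma hasDerivAt_plane (A B t : ℝ) : HasDerivAt (plane A B) (plane (-B) A t) t := by
  refine (((Real.hasDerivAt_sin t).const_mul A).add
    ((Real.hasDerivAt_cos t).const_mul B)).congr_deriv ?_
  simp only [plane]
  ring

lemma plane_add_int_mul (A B t : ℝ) (k : ℤ) : plane A B (t + k * (2 * Real.pi)) = plane A B t := by
  rw [plane, Real.sin_add_int_mul_two_pi, Real.cos_add_int_mul_two_pi, plane]

/-- With denominators cleared, the transcendental equation is the Robin condition at z = 1; the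
parity of the profile gives the one at z = -1. -/
lemma exists_vertical_profile {β : ℝ} (hβ : 0 < β) {m n p : ℕ} {lam : ℝ}
    (hlam : IsEigenvalue β m n p lam) :
    ∃ Z' : ℝ → ℝ, ContDiff ℝ ∞ (Zfun m n p lam) ∧ ContDiff ℝ ∞ Z' ∧
      (∀ t, HasDerivAt (Zfun m n p lam) (Z' t) t) ∧
      (∀ t, HasDerivAt Z' (-(lam - ((m : ℝ) ^ 2 + (n : ℝ) ^ 2)) * Zfun m n p lam t) t) ∧
      Z' 1 + β * Zfun m n p lam 1 = 0 ∧ -Z' (-1) + β * Zfun m n p lam (-1) = 0 := by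
  obtain ⟨⟨hlow, -⟩, heven, hodd⟩ := hlam
  have hpos : 0 < lam - ((m : ℝ) ^ 2 + (n : ℝ) ^ 2) := by
    have : 0 ≤ Real.pi ^ 2 / 4 * (p : ℝ) ^ 2 := by positivity
    linarith
  set k := √(lam - ((m : ℝ) ^ 2 + (n : ℝ) ^ 2)) with hk
  have hk0 : 0 < k := Real.sqrt_pos.2 hpos
  have hk2 : lam - ((m : ℝ) ^ 2 + (n : ℝ) ^ 2) = k ^ 2 := (Real.sq_sqrt hpos.le).symm
  have hkβ : k / β ≠ 0 := (div_pos hk0 hβ).ne'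
  have hlin : ∀ t : ℝ, HasDerivAt (fun z : ℝ => k * z) k t := fun t => by
    simpa using (hasDerivAt_id t).const_mul k
  have hlins : ContDiff ℝ ∞ fun z : ℝ => k * z := contDiff_const.mul contDiff_id
  rw [hk2]
  by_cases hp : Even p
  · have hZ : Zfun m n p lam = fun z => Real.cos (k * z) := by
      ext z
      rw [Zfun, if_pos hp]
    have hcot := heven hp
    -- Division by zero would give the cotangent the value 0, whereas k/β is nonzero.
    have hsin : Real.sin k ≠ 0 := by
      intro h0
      rw [Real.cot_eq_cos_div_sin, h0, div_zero] at hcot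
      exact hkβ hcot.symm
    rw [Real.cot_eq_cos_div_sin, div_eq_div_iff hsin hβ.ne'] at hcot
    rw [hZ]
    refine ⟨fun z => -(k * Real.sin (k * z)), Real.contDiff_cos.comp hlins,
      (contDiff_const.mul (Real.contDiff_sin.comp hlins)).neg, fun t => ?_, fun t => ?_, ?_, ?_⟩
    · exact (hlin t).cos.congr_deriv (by ring)
    · exact ((hlin t).sin.const_mul k).fun_neg.congr_deriv (by ring)
    · simp only [mul_one]
      linarith
    · simp only [mul_neg, mul_one, Real.sin_neg, Real.cos_neg]
      linarith
  · have hZ : Zfun m n p lam = fun z => Real.sin (k * z) := by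
      ext z
      rw [Zfun, if_neg hp]
    have htan := hodd (Nat.not_even_iff_odd.1 hp)
    -- As for the cotangent: the default value 0 of the tangent is excluded by k/β ≠ 0.
    have hcos : Real.cos k ≠ 0 := by
      intro h0
      rw [Real.tan_eq_sin_div_cos, h0, div_zero] at htan
      exact hkβ (neg_eq_zero.1 htan.symm)
    rw [Real.tan_eq_sin_div_cos, ← neg_div, div_eq_div_iff hcos hβ.ne'] at htan
    rw [hZ]
    refine ⟨fun z => k * Real.cos (k * z), Real.contDiff_sin.comp hlins,
      contDiff_const.mul (Real.contDiff_cos.comp hlins), fun t => ?_, fun t => ?_, ?_, ?_⟩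
    · exact (hlin t).sin.congr_deriv (by ring)
    · exact ((hlin t).cos.const_mul k).congr_deriv (by ring)
    · simp only [mul_one]
      linarith
    · simp only [mul_neg, mul_one, Real.sin_neg, Real.cos_neg]
      linarith

/-- Under the condition on the coefficients, the eigenfunction is a shear mode. -/
lemma exists_shearMode_eq_eigenfun {β : ℝ} (hβ : 0 < β) {m n p : ℕ} (hn : 0 < n) {lam : ℝ}
    (hlam : IsEigenvalue β m n p lam) {a b c d : ℝ}
    (habcd : (a = -c ∧ b = d) ∨ (a = c ∧ b = -d)) :
    ∃ F e, ShearMode β lam F e ∧ eigenfun m n p lam a b c d = shearField F e := by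
  obtain ⟨Z', hZ, hZs, hZ1, hZ2, htop, hbot⟩ := exists_vertical_profile hβ hlam
  have hn' : (n : ℝ) ≠ 0 := Nat.cast_ne_zero.2 hn.ne'
  have hnper : ∀ A B t, plane A B (t + (n : ℝ) * (2 * Real.pi)) = plane A B t := fun A B t => by
    simpa using plane_add_int_mul A B t n
  rcases habcd with ⟨rfl, rfl⟩ | ⟨rfl, rfl⟩
  -- Both polynomials equal -c sin(mx + ny) + b cos(mx + ny), so the direction is (1, -m/n, 0),
  -- orthogonal to (m, n, 0).
  · refine ⟨wave (Zfun m n p lam) (plane (-c) b) m n, ![1, -((m : ℝ) / n), 0],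
      shearMode_wave hZ hZs (contDiff_plane _ _) (contDiff_plane _ _) hZ1 hZ2 (hasDerivAt_plane _ _)
        (fun t => (hasDerivAt_plane _ _ t).congr_deriv (by simp only [plane]; ring))
        (fun t => by simpa using plane_add_int_mul (-c) b t m) (hnper _ _) (by ring) ?_ rfl htop
        hbot, ?_⟩
    · simp only [Matrix.cons_val_zero, Matrix.cons_val_one]
      field_simp
      ring
    · ext x i
      fin_cases i <;>
        simp [eigenfun, shearField, wave, plane, Pu, Pv, Real.sin_add, Real.cos_add] <;>
        first | ring1 | (left; ring1)
  -- Here 𝒫ᵘ = a sin(ny - mx) + d cos(ny - mx) and 𝒫ᵛ = -𝒫ᵘ, which flips the sign of the second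
  -- component of the direction.
  · refine ⟨wave (Zfun m n p lam) (plane a d) (-m) n, ![1, (m : ℝ) / n, 0],
      shearMode_wave hZ hZs (contDiff_plane _ _) (contDiff_plane _ _) hZ1 hZ2 (hasDerivAt_plane _ _)
        (fun t => (hasDerivAt_plane _ _ t).congr_deriv (by simp only [plane]; ring))
        (fun t => by simpa using plane_add_int_mul a d t (-m)) (hnper _ _) (by ring) ?_ rfl htop
        hbot, ?_⟩
    · simp only [Matrix.cons_val_zero, Matrix.cons_val_one]
      field_simp
      ring
    · ext x i
      fin_cases i <;>
        simp [eigenfun, shearField, wave, plane, Pu, Pv, Real.sin_add, Real.cos_add] <;>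
        first | ring1 | (left; ring1)

end ChannelNS
end

theorem proposition3p10 (β : ℝ) (hβ : 0 < β) (m n p : ℕ) (hm : 0 < m) (hn : 0 < n)
    (lam : ℝ) (hlam : ChannelNS.IsEigenvalue β m n p lam)
    (a b c d : ℝ) (habcd : (a = -c ∧ b = d) ∨ (a = c ∧ b = -d))
    (γ : ℝ) (v₀ : ChannelNS.Pt → ChannelNS.Pt)
    (hv₀ : v₀ = fun x => γ • ChannelNS.eigenfun m n p lam a b c d x)
    (v : ℝ → ChannelNS.Pt → ChannelNS.Pt)
    (hv : v = fun t x => (γ * Real.exp (-lam * t)) • ChannelNS.eigenfun m n p lam a b c d x) :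
    -- existence: with any constant pressure, `v` is a smooth global solution ...
    (∀ Q₀ : ℝ, ChannelNS.IsClassicalSolution β v₀ v (fun _ _ => Q₀)) ∧
    -- ... and a weak solution with that pressure on every time interval
    (∀ T : ℝ, 0 < T → ∃ G θ, ChannelNS.IsLerayHopf β v₀ T v G θ ∧
      ∀ Q₀ : ℝ, ChannelNS.IsPressure T v G (fun _ _ => Q₀)) ∧
    -- uniqueness of the velocity, and of the pressure up to constants in space
    (∀ T : ℝ, 0 < T → ∀ w G θ, ChannelNS.IsLerayHopf β v₀ T w G θ →
      (∀ᵐ s ∂(ChannelNS.volQ T), w s.1 s.2 = v s.1 s.2) ∧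
      ∀ q : ℝ → ChannelNS.Pt → ℝ, ChannelNS.IsPressure T w G q →
        ∃ g : ℝ → ℝ, ∀ᵐ s ∂(ChannelNS.volQ T), q s.1 s.2 = g s.1) := by
  obtain ⟨F, e, S, hF⟩ := ChannelNS.exists_shearMode_eq_eigenfun hβ hn hlam habcd
  have hv' : v = ChannelNS.shearFlow γ lam F e := by
    rw [hv, hF]
    funext t x
    simp only [ChannelNS.shearFlow, ChannelNS.shearField, ChannelNS.decay, mul_smul]
  have hv₀' : v₀ = ChannelNS.shearFlow γ lam F e 0 := by
    rw [hv₀, hF]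
    funext x
    simp only [ChannelNS.shearFlow, ChannelNS.shearField, ChannelNS.decay_zero, mul_smul]
  rw [hv', hv₀']
  refine ⟨fun Q₀ => S.isClassicalSolution γ Q₀, fun T hT => ⟨_, _, S.isLerayHopf γ hT, fun Q₀ =>
    S.isPressure_const γ hT Q₀⟩, fun T hT w G θ h => ?_⟩
  have hw := h.ae_eq_shearFlow hβ.le S γ hT
  exact ⟨hw, fun q hq => hq.exists_ae_eq S γ hT hw (h.grad_ae_eq S γ hw)⟩
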